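/- Let $\mathbb{F}$ be a field of characteristic $0$, $H$ a pointed cocommutative Hopf algebra over $\mathbb{F}$, and $V$ a finite-dimensional $H$-module with a non-degenerate symmetric bilinear form $\langle\cdot,\cdot\rangle$ that is $H$-invariant, i.e. $\langle h\cdot v,w\rangle=\langle v,S(h)\cdot w\rangle$. Let $C=C(V)$ be the Clifford algebra with relations $vw+wv=2\langle v,w\rangle$. Let $\kappa:V\wedge V\to H$ be linear and let $A=(T(V)\rtimes H)/I_\kappa$, where $T(V)\rtimes H$ is the algebra generated by $T(V)$ and $H$ with the relations $hv=(h_{(1)}\cdot v)h_{(2)}$, and $I_\kappa$ is the ideal generated by the elements $vw-wv-\kappa(v\wedge w)$, $v,w\in V$. Assume the PBW property: the natural surjection from $S(V)\rtimes H$ to the associated graded algebra of $A$ (for the filtration by tensor degree in $T(V)$) is an isomorphism. If $K$ is a pointed cocommutative Hopf algebra acting on $V$ such that the form is $K$-invariant, give $K$ the $\mathbb{Z}_2$-gradation (as an algebra) in which primitive elements are even and a group-like element $g$ satisfies $(-1)^{|g|}=\det(g|_V)$. Let $(\tilde H,\pi,\gamma)$ be a pin cover of $H$ with respect to $V$: $\tilde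 H$ is a pointed cocommutative Hopf algebra, $\pi:\tilde H\to H$ is a surjective Hopf algebra map such that $\tilde H\cong H\oplus H$ as coalgebras with $\pi$ restricting to an isomorphism on each copy of $H$, and $\gamma:\tilde H\to C$ is an algebra map preserving the $\mathbb{Z}_2$-gradations (that of $\tilde H$ taken with respect to $V$ as an $\tilde H$-module via $\pi$) with $(-1)^{|\tilde h|}\pi(\tilde h)\cdot v=\gamma(\tilde h_{(1)})\,v\,\gamma(S\tilde h_{(2)})$ in $C$ for all $v\in V$ and homogeneous $\tilde h\in\tilde H$. Put $\Delta_C:\tilde H\to H\otimes C\to A\otimes C$, $\Delta_C(\tilde h)=\pi(\tilde h_{(1)})\otimes\gamma(\tilde h_{(2)})$, and let $\tilde H$ act on $A\otimes C$ by $\tilde h\cdot x=\Delta_C(\tilde h_{(1)})\,x\,\Delta_C(S\tilde h_{(2)})$. Let $(A\otimes C)_{\mathrm{triv}}$ and $(A\otimes C)_{\mathrm{det}}$ be the subspaces on which every $\tilde h\in\tilde H$ acts as $\varepsilon(\tilde h)$, respectively every homogeneous $\tilde h$ acts as $(-1)^{|\tilde h|}\varepsilon(\tilde h)$. Let $D=\sum_k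 v_k\otimes v^k\in A\otimes C$ for a basis $(v_k)$ of $V$ and its dual basis $(v^k)$ with respect to $\langle\cdot,\cdot\rangle$, and let $d:A\otimes C\to A\otimes C$ be the linear map with $d(x)=Dx-(-1)^{|x|}xD$ for $x$ homogeneous with respect to the $\mathbb{Z}_2$-gradation inherited from $C$. Let $d_{\mathrm{triv}}$ and $d_{\mathrm{det}}$ be the restrictions of $d$ to $(A\otimes C)_{\mathrm{triv}}$ and $(A\otimes C)_{\mathrm{det}}$. Assume the Parthasarathy condition $D^2\in Z(A\otimes C)+\Delta_C(\tilde H^{\mathrm{even}})$. Then $$\ker d_{\mathrm{triv}}=\operatorname{im} d_{\mathrm{det}}\oplus\Delta_C(Z(\tilde H)),$$ where $Z$ denotes the center and the sum is an internal direct sum of subspaces of $A\otimes C$. -/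

import Mathlib

open scoped TensorProduct

noncomputable section

namespace BarbaschSahi

/-! ### Coalgebra notions -/

section Coalgebras

variable (F : Type*) [Field F]

/-- A subspace `W` of a coalgebra is a subcoalgebra if `Δ(W) ⊆ W ⊗ W`. -/
def IsSubcoalgebra {K : Type*} [AddCommGroup K] [Module F K] [Coalgebra F K]
    (W : Submodule F K) : Prop :=
  ∀ x ∈ W, Coalgebra.comul (R := F) x ∈ LinearMap.range (TensorProduct.map W.subtype W.subtype)

/-- A coalgebra is pointed if every simple subcoalgebra is one-dimensional. -/
def IsPointed (K : Type*) [AddCommGroup K] [Module F K] [Coalgebra F K] : Prop :=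
  ∀ W : Submodule F K, IsSubcoalgebra F W → W ≠ ⊥ →
    (∀ W' : Submodule F K, W' ≤ W → IsSubcoalgebra F W' → W' = ⊥ ∨ W' = W) →
    Module.finrank F W = 1

/-- Primitive elements: `Δ x = 1 ⊗ x + x ⊗ 1`. -/
def IsPrimitive {K : Type*} [Ring K] [HopfAlgebra F K] (x : K) : Prop :=
  Coalgebra.comul (R := F) x = 1 ⊗ₜ[F] x + x ⊗ₜ[F] 1

end Coalgebras

section Orthogonal

variable {F : Type*} [Field F] {V : Type*} [AddCommGroup V] [Module F V]
variable {K : Type*} [Ring K] [HopfAlgebra F K]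

/-- `B` is a non-degenerate symmetric bilinear form on the `K`-module `V` (with action `ρ`) which is
invariant: `⟨h v, w⟩ = ⟨v, S(h) w⟩`. -/
structure IsOrthogonal (ρ : K →ₐ[F] Module.End F V) (B : LinearMap.BilinForm F V) : Prop where
  symm : B.IsSymm
  nondegenerate : B.Nondegenerate
  invariant : ∀ (h : K) (v w : V), B (ρ h v) w = B v (ρ (HopfAlgebra.antipode F h) w)

/-- The homogeneous components of the `ℤ/2`-gradation of a pointed cocommutative Hopf algebra `K`
over a field of characteristic zero, with respect to an orthogonal `K`-module `V`. Primitive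
elements have degree `0`, and a group-like element `g` has degree `i` where `det (g|_V) = (-1)^i`.
Since `K = U(P(K)) ⋊ F[G(K)]`, the component of degree `i` is spanned by the products `u g` with `u`
in the subalgebra generated by the primitive elements and `g` group-like of degree `i`. -/
def parity (ρ : K →ₐ[F] Module.End F V) (i : ZMod 2) : Submodule F K :=
  Submodule.span F {x | ∃ u ∈ Algebra.adjoin F {y : K | IsPrimitive F y}, ∃ g : K,
    IsGroupLikeElem F g ∧ LinearMap.det (ρ g) = (-1) ^ i.val ∧ x = u * g}

/-- For an algebra map `f : K → R` from a Hopf algebra, the adjoint-type action of `K` on `R`,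
`h • x = f(h₍₁₎) x f(S h₍₂₎)`. -/
def adAction {R : Type*} [Ring R] [Algebra F R] (f : K →ₐ[F] R) : K →ₗ[F] Module.End F R :=
  TensorProduct.lift
      (LinearMap.mk₂ F
        (fun h k : K => LinearMap.mulLeft F (f h) ∘ₗ
          LinearMap.mulRight F (f (HopfAlgebra.antipode F k)))
        (fun _ _ _ => by ext; simp [add_mul])
        (fun _ _ _ => by ext; simp)
        (fun _ _ _ => by ext; simp [mul_add])
        (fun _ _ _ => by ext; simp))
    ∘ₗ Coalgebra.comul

end Orthogonal

/-! ### Algebra filtrations and the associated graded algebra -/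

/-- An increasing algebra filtration `F₀ ⊆ F₁ ⊆ …` of `R`
(with `F₋₁ = 0`). -/
structure AlgFiltration (F R : Type*) [Field F] [Ring R] [Algebra F R] where
  level : ℕ → Submodule F R
  mono : Monotone level
  one_mem : 1 ∈ level 0
  mul_mem : ∀ {m n : ℕ} {x y : R}, x ∈ level m → y ∈ level n → x * y ∈ level (m + n)

namespace AlgFiltration

variable {F R : Type*} [Field F] [Ring R] [Algebra F R] (𝓕 : AlgFiltration F R)

/-- The previous step `F_{n-1}` of the filtration, with `F₋₁ = 0`. -/
def pred : ℕ → Submodule F R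
  | 0 => ⊥
  | n + 1 => 𝓕.level n

theorem pred_mul_mem {m n : ℕ} {x y : R} (hx : x ∈ 𝓕.pred m) (hy : y ∈ 𝓕.level n) :
    x * y ∈ 𝓕.pred (m + n) := by
  cases m with
  | zero =>
    have : x = 0 := by simpa [pred] using hx
    simp [this]
  | succ m =>
    have := 𝓕.mul_mem (m := m) hx hy
    rw [show m + 1 + n = (m + n) + 1 by omega]
    exact this

theorem mul_pred_mem {m n : ℕ} {x y : R} (hx : x ∈ 𝓕.level m) (hy : y ∈ 𝓕.pred n) :
    x * y ∈ 𝓕.pred (m + n) := by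
  cases n with
  | zero =>
    have : y = 0 := by simpa [pred] using hy
    simp [this]
  | succ n => exact 𝓕.mul_mem (n := n) hx hy

/-- The graded algebra `⨁ₙ Fₙ`, realised as the algebra of polynomials `∑ aₙ tⁿ` with `aₙ ∈ Fₙ`. -/
def rees : Subalgebra F (Polynomial R) where
  carrier := {p | ∀ n, p.coeff n ∈ 𝓕.level n}
  mul_mem' {p q} hp hq n := by
    rw [Polynomial.coeff_mul]
    refine Submodule.sum_mem _ fun x hx => ?_
    obtain ⟨i, j⟩ := x
    obtain rfl : i + j = n := by simpa using hx
    exact 𝓕.mul_mem (hp i) (hq j)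
  add_mem' {p q} hp hq n := by
    rw [Polynomial.coeff_add]
    exact Submodule.add_mem _ (hp n) (hq n)
  algebraMap_mem' r n := by
    rw [Polynomial.algebraMap_apply, Polynomial.coeff_C]
    split_ifs with h
    · subst h
      rw [Algebra.algebraMap_eq_smul_one]
      exact Submodule.smul_mem _ _ 𝓕.one_mem
    · exact Submodule.zero_mem _

/-- The congruence on `⨁ₙ Fₙ` modulo the two-sided ideal `⨁ₙ F_{n-1}`. -/
def grCon : RingCon 𝓕.rees where
  r p q := ∀ n, p.1.coeff n - q.1.coeff n ∈ 𝓕.pred n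
  iseqv :=
    { refl := fun p n => by simp
      symm := fun {p q} h n => by simpa using Submodule.neg_mem _ (h n)
      trans := fun {p q r} h h' n => by simpa using Submodule.add_mem _ (h n) (h' n) }
  add' {p p' q q'} h h' n := by
    change (p.1 + q.1).coeff n - (p'.1 + q'.1).coeff n ∈ _
    rw [Polynomial.coeff_add, Polynomial.coeff_add, add_sub_add_comm]
    exact Submodule.add_mem _ (h n) (h' n)
  mul' {p p' q q'} h h' n := by
    change (p.1 * q.1).coeff n - (p'.1 * q'.1).coeff n ∈ _
    rw [Polynomial.coeff_mul, Polynomial.coeff_mul, ← Finset.sum_sub_distrib]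
    refine Submodule.sum_mem _ fun x hx => ?_
    obtain ⟨i, j⟩ := x
    obtain rfl : i + j = n := by simpa using hx
    rw [← sub_add_sub_cancel _ (p'.1.coeff i * q.1.coeff j),
      ← sub_mul, ← mul_sub]
    exact Submodule.add_mem _ (𝓕.pred_mul_mem (h _) (q.2 _)) (𝓕.mul_pred_mem (p'.2 _) (h' _))

/-- The associated graded algebra `⨁ₙ Fₙ / F_{n-1}`. -/
abbrev Gr : Type _ := 𝓕.grCon.Quotient

/-- The class in degree `n` of the associated graded algebra of an element of `Fₙ`. -/
def toGr (n : ℕ) : 𝓕.level n →ₗ[F] 𝓕.Gr where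
  toFun x := (RingCon.mkₐ F 𝓕.grCon) ⟨Polynomial.monomial n x.1, fun m => by
    rw [Polynomial.coeff_monomial]
    split_ifs with h
    · exact h ▸ x.2
    · exact Submodule.zero_mem _⟩
  map_add' x y := by
    rw [← map_add]
    congr 1
    ext1
    simp
  map_smul' c x := by
    rw [RingHom.id_apply, ← map_smul]
    congr 1
    ext1
    exact (Polynomial.smul_monomial c n x.1).symm

theorem toGr_mul {m n : ℕ} (x : 𝓕.level m) (y : 𝓕.level n) :
    𝓕.toGr m x * 𝓕.toGr n y = 𝓕.toGr (m + n) ⟨x.1 * y.1, 𝓕.mul_mem x.2 y.2⟩ := by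
  simp only [toGr, LinearMap.coe_mk, AddHom.coe_mk]
  rw [← map_mul]
  congr 1
  ext1
  simp [Polynomial.monomial_mul_monomial]

theorem toGr_eq {n : ℕ} (x y : 𝓕.level n) (h : x.1 - y.1 ∈ 𝓕.pred n) :
    𝓕.toGr n x = 𝓕.toGr n y := by
  refine (RingCon.eq _).2 fun m => ?_
  simp only [Polynomial.coeff_monomial]
  split_ifs with hm
  · exact hm ▸ h
  · simp

end AlgFiltration

/-! ### Hopf-Hecke algebras -/

section HopfHecke

variable {F : Type*} [Field F] {V : Type*} [AddCommGroup V] [Module F V]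
variable {H : Type*} [Ring H] [HopfAlgebra F H]

section Smash

variable (F V H)

/-- The generators `v ∈ V` of the free algebra on the space `V ⊕ H`. -/
def genV : V →ₗ[F] TensorAlgebra F (V × H) := TensorAlgebra.ι F ∘ₗ LinearMap.inl F V H

/-- The generators `h ∈ H` of the free algebra on the space `V ⊕ H`. -/
def genH : H →ₗ[F] TensorAlgebra F (V × H) := TensorAlgebra.ι F ∘ₗ LinearMap.inr F V H

end Smash

/-- The defining relations of `T(V) ⋊ H` on generators `V ⊕ H`: the relations of the algebra `H`
and `h v = (h₍₁₎ · v) h₍₂₎`. -/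
inductive SmashRel (ρ : H →ₐ[F] Module.End F V) :
    TensorAlgebra F (V × H) → TensorAlgebra F (V × H) → Prop
  | one : SmashRel ρ (genH F V H 1) 1
  | mul (h k : H) : SmashRel ρ (genH F V H h * genH F V H k) (genH F V H (h * k))
  | smash (h : H) (v : V) : SmashRel ρ (genH F V H h * genV F V H v)
      (LinearMap.mul' F _ (TensorProduct.map (genV F V H ∘ₗ ρ.toLinearMap.flip v) (genH F V H)
        (Coalgebra.comul (R := F) h)))

/-- The smash product `T(V) ⋊ H`: the algebra generated by `T(V)` and `H` subject to the relations
`h v = (h₍₁₎ · v) h₍₂₎`. -/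
def TensorSmash (ρ : H →ₐ[F] Module.End F V) : Type _ := RingQuot (SmashRel ρ)

instance (ρ : H →ₐ[F] Module.End F V) : Ring (TensorSmash ρ) :=
  inferInstanceAs (Ring (RingQuot (SmashRel ρ)))

instance (ρ : H →ₐ[F] Module.End F V) : Algebra F (TensorSmash ρ) :=
  inferInstanceAs (Algebra F (RingQuot (SmashRel ρ)))

namespace TensorSmash

variable (ρ : H →ₐ[F] Module.End F V)

/-- The quotient map from the free algebra on `V ⊕ H`. -/
def mk : TensorAlgebra F (V × H) →ₐ[F] TensorSmash ρ := RingQuot.mkAlgHom F (SmashRel ρ)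

theorem mk_rel {x y : TensorAlgebra F (V × H)} (h : SmashRel ρ x y) : mk ρ x = mk ρ y :=
  RingQuot.mkAlgHom_rel F h

/-- The map `V → T(V) ⋊ H`. -/
def ofV : V →ₗ[F] TensorSmash ρ := (mk ρ).toLinearMap ∘ₗ genV F V H

/-- The algebra map `H → T(V) ⋊ H`. -/
def ofH : H →ₐ[F] TensorSmash ρ :=
  AlgHom.ofLinearMap ((mk ρ).toLinearMap ∘ₗ genH F V H)
    (by
      have := mk_rel ρ (SmashRel.one (ρ := ρ))
      simpa using this)
    (fun h k => by
      have := mk_rel ρ (SmashRel.mul (ρ := ρ) h k)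
      simpa using this.symm)

theorem ofH_mul_ofV (h : H) (v : V) : ofH ρ h * ofV ρ v =
    LinearMap.mul' F _ (TensorProduct.map (ofV ρ ∘ₗ ρ.toLinearMap.flip v) (ofH ρ).toLinearMap
      (Coalgebra.comul (R := F) h)) := by
  have := mk_rel ρ (SmashRel.smash (ρ := ρ) h v)
  rw [map_mul] at this
  refine this.trans ?_
  generalize (Coalgebra.comul (R := F) h) = t
  induction t with
  | zero => simp
  | add x y hx hy => simp only [map_add, hx, hy]
  | tmul x y => simp [ofV, ofH]

end TensorSmash

/-- The generators `v w - w v = κ(v, w)` of the ideal `I_κ` of `T(V) ⋊ H`. -/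
inductive KappaRel (ρ : H →ₐ[F] Module.End F V) (κ : V →ₗ[F] V →ₗ[F] H) :
    TensorSmash ρ → TensorSmash ρ → Prop
  | comm (v w : V) : KappaRel ρ κ
      (TensorSmash.ofV ρ v * TensorSmash.ofV ρ w - TensorSmash.ofV ρ w * TensorSmash.ofV ρ v)
      (TensorSmash.ofH ρ (κ v w))

/-- The algebra `A_κ = (T(V) ⋊ H) / I_κ`. -/
def HeckeAlg (ρ : H →ₐ[F] Module.End F V) (κ : V →ₗ[F] V →ₗ[F] H) : Type _ :=
  RingQuot (KappaRel ρ κ)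

instance (ρ : H →ₐ[F] Module.End F V) (κ : V →ₗ[F] V →ₗ[F] H) : Ring (HeckeAlg ρ κ) :=
  inferInstanceAs (Ring (RingQuot (KappaRel ρ κ)))

instance (ρ : H →ₐ[F] Module.End F V) (κ : V →ₗ[F] V →ₗ[F] H) : Algebra F (HeckeAlg ρ κ) :=
  inferInstanceAs (Algebra F (RingQuot (KappaRel ρ κ)))

namespace HeckeAlg

variable (ρ : H →ₐ[F] Module.End F V) (κ : V →ₗ[F] V →ₗ[F] H)

/-- The quotient map `T(V) ⋊ H → A`. -/
def mk : TensorSmash ρ →ₐ[F] HeckeAlg ρ κ := RingQuot.mkAlgHom F (KappaRel ρ κ)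

theorem mk_rel {x y : TensorSmash ρ} (h : KappaRel ρ κ x y) : mk ρ κ x = mk ρ κ y :=
  RingQuot.mkAlgHom_rel F h

/-- The map `V → A`. -/
def ofV : V →ₗ[F] HeckeAlg ρ κ :=
  (mk ρ κ).toLinearMap ∘ₗ TensorSmash.ofV ρ

/-- The algebra map `H → A`. -/
def ofH : H →ₐ[F] HeckeAlg ρ κ := (mk ρ κ).comp (TensorSmash.ofH ρ)

theorem ofH_mul_ofV (h : H) (v : V) : ofH ρ κ h * ofV ρ κ v =
    LinearMap.mul' F _ (TensorProduct.map (ofV ρ κ ∘ₗ ρ.toLinearMap.flip v) (ofH ρ κ).toLinearMap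
      (Coalgebra.comul (R := F) h)) := by
  have := congrArg (mk ρ κ) (TensorSmash.ofH_mul_ofV ρ h v)
  rw [map_mul] at this
  refine this.trans ?_
  generalize (Coalgebra.comul (R := F) h) = t
  induction t with
  | zero => simp
  | add x y hx hy => simp only [map_add, hx, hy]
  | tmul x y => simp [ofV, ofH]

theorem ofV_comm (v w : V) :
    ofV ρ κ v * ofV ρ κ w - ofV ρ κ w * ofV ρ κ v = ofH ρ κ (κ v w) := by
  have := mk_rel ρ κ (KappaRel.comm (ρ := ρ) (κ := κ) v w)
  simpa [ofV, ofH] using this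

/-- The image of `F ⊕ V` in `A`. -/
def spaceV : Submodule F (HeckeAlg ρ κ) := 1 ⊔ LinearMap.range (ofV ρ κ)

/-- The image of `H` in `A`. -/
def spaceH : Submodule F (HeckeAlg ρ κ) := LinearMap.range (ofH ρ κ).toLinearMap

theorem spaceH_mul_spaceV : spaceH ρ κ * spaceV ρ κ ≤ spaceV ρ κ * spaceH ρ κ := by
  rw [spaceV, Submodule.mul_sup, Submodule.sup_mul, mul_one, one_mul]
  refine sup_le_sup le_rfl (Submodule.mul_le.2 ?_)
  rintro _ ⟨h, rfl⟩ _ ⟨v, rfl⟩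
  rw [AlgHom.toLinearMap_apply, ofH_mul_ofV]
  generalize (Coalgebra.comul (R := F) h) = t
  induction t with
  | zero => simp
  | add x y hx hy => simpa only [map_add] using Submodule.add_mem _ hx hy
  | tmul x y => exact Submodule.mul_mem_mul ⟨_, rfl⟩ ⟨_, rfl⟩

theorem spaceH_mul_self : spaceH ρ κ * spaceH ρ κ ≤ spaceH ρ κ := by
  refine Submodule.mul_le.2 ?_
  rintro _ ⟨h, rfl⟩ _ ⟨k, rfl⟩
  exact ⟨h * k, by simp⟩

theorem one_le_spaceH : 1 ≤ spaceH ρ κ := by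
  rw [Submodule.one_le]
  exact ⟨1, by simp⟩

theorem spaceH_mul_pow (n : ℕ) : spaceH ρ κ * spaceV ρ κ ^ n ≤ spaceV ρ κ ^ n * spaceH ρ κ := by
  induction n with
  | zero => simp
  | succ n ih =>
    calc spaceH ρ κ * spaceV ρ κ ^ (n + 1) = spaceH ρ κ * spaceV ρ κ ^ n * spaceV ρ κ := by
          rw [pow_succ, mul_assoc]
      _ ≤ spaceV ρ κ ^ n * spaceH ρ κ * spaceV ρ κ := mul_le_mul_left ih _
      _ = spaceV ρ κ ^ n * (spaceH ρ κ * spaceV ρ κ) := mul_assoc _ _ _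
      _ ≤ spaceV ρ κ ^ n * (spaceV ρ κ * spaceH ρ κ) :=
          mul_le_mul_right (spaceH_mul_spaceV ρ κ) _
      _ = spaceV ρ κ ^ (n + 1) * spaceH ρ κ := by rw [pow_succ, mul_assoc]

/-- The filtration of `A` coming from the tensor degree in `T(V)`: `Fₙ` is the image of
`T^{≤ n}(V) ⊗ H`, that is, it is spanned by the products `v₁ ⋯ vₖ h` with `k ≤ n`. -/
def filtration : AlgFiltration F (HeckeAlg ρ κ) where
  level n := spaceV ρ κ ^ n * spaceH ρ κ
  mono := monotone_nat_of_le_succ fun n => by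
    refine mul_le_mul_left ?_ _
    rw [pow_succ]
    calc spaceV ρ κ ^ n = spaceV ρ κ ^ n * 1 := (mul_one _).symm
      _ ≤ spaceV ρ κ ^ n * spaceV ρ κ := mul_le_mul_right le_sup_left _
  one_mem := by
    rw [pow_zero, one_mul]
    exact ⟨1, by simp⟩
  mul_mem {m n x y} hx hy := by
    refine (?_ : (spaceV ρ κ ^ m * spaceH ρ κ) * (spaceV ρ κ ^ n * spaceH ρ κ) ≤ _)
      (Submodule.mul_mem_mul hx hy)
    calc (spaceV ρ κ ^ m * spaceH ρ κ) * (spaceV ρ κ ^ n * spaceH ρ κ)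
        = spaceV ρ κ ^ m * (spaceH ρ κ * spaceV ρ κ ^ n) * spaceH ρ κ := by
          simp only [mul_assoc]
      _ ≤ spaceV ρ κ ^ m * (spaceV ρ κ ^ n * spaceH ρ κ) * spaceH ρ κ :=
          mul_le_mul_left (mul_le_mul_right (spaceH_mul_pow ρ κ n) _) _
      _ = spaceV ρ κ ^ (m + n) * (spaceH ρ κ * spaceH ρ κ) := by
          simp only [mul_assoc, pow_add]
      _ ≤ spaceV ρ κ ^ (m + n) * spaceH ρ κ :=
          mul_le_mul_right (spaceH_mul_self ρ κ) _

theorem ofH_mem (h : H) : ofH ρ κ h ∈ (filtration ρ κ).level 0 := by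
  change _ ∈ spaceV ρ κ ^ 0 * spaceH ρ κ
  rw [pow_zero, one_mul]
  exact ⟨h, rfl⟩

theorem ofV_mem (v : V) : ofV ρ κ v ∈ (filtration ρ κ).level 1 := by
  change _ ∈ spaceV ρ κ ^ 1 * spaceH ρ κ
  rw [pow_one, ← mul_one (ofV ρ κ v)]
  exact Submodule.mul_mem_mul (Submodule.mem_sup_right ⟨v, rfl⟩) ⟨1, by simp⟩

/-- The linear map `H → gr A` onto the component of degree zero. -/
def grH : H →ₗ[F] (filtration ρ κ).Gr :=
  (filtration ρ κ).toGr 0 ∘ₗ (ofH ρ κ).toLinearMap.codRestrict _ (ofH_mem ρ κ)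

/-- The linear map `V → gr A` into the component of degree one. -/
def grV : V →ₗ[F] (filtration ρ κ).Gr :=
  (filtration ρ κ).toGr 1 ∘ₗ (ofV ρ κ).codRestrict _ (ofV_mem ρ κ)

theorem grV_comm (v w : V) : grV ρ κ v * grV ρ κ w = grV ρ κ w * grV ρ κ v := by
  simp only [grV, LinearMap.comp_apply, AlgFiltration.toGr_mul]
  refine AlgFiltration.toGr_eq _ _ _ ?_
  change ofV ρ κ v * ofV ρ κ w - ofV ρ κ w * ofV ρ κ v ∈ (filtration ρ κ).level 1
  rw [ofV_comm]
  exact (filtration ρ κ).mono zero_le_one (ofH_mem ρ κ _)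

/-- The algebra map `S(V) → gr A` extending `V → gr A`. -/
def grS : SymmetricAlgebra F V →ₐ[F] (filtration ρ κ).Gr :=
  RingCon.liftₐ _ (TensorAlgebra.lift F (grV ρ κ)) (by
    refine RingCon.ringConGen_le.2 fun x y h => ?_
    induction h with
    | mul_comm v w =>
      rw [RingCon.ker_apply]
      simpa using grV_comm ρ κ v w)

/-- The natural surjection `S(V) ⋊ H → gr A`, `s h ↦ s h`, where the underlying vector space of the
smash product `S(V) ⋊ H` is `S(V) ⊗ H`. -/
def pbwMap : SymmetricAlgebra F V ⊗[F] H →ₗ[F] (filtration ρ κ).Gr :=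
  LinearMap.mul' F _ ∘ₗ TensorProduct.map (grS ρ κ).toLinearMap (grH ρ κ)

/-- The PBW property: the natural surjection `S(V) ⋊ H → gr A` is an isomorphism. -/
def PBW : Prop := Function.Bijective (pbwMap ρ κ)

end HeckeAlg

end HopfHecke

/-! ### Pin covers -/

section Pin

variable {F : Type*} [Field F] {V : Type*} [AddCommGroup V] [Module F V]
variable {H : Type*} [Ring H] [HopfAlgebra F H]

/-- The Clifford algebra `C(V)`, with relations `v w + w v = 2 ⟨v, w⟩`. -/
abbrev Cliff (B : LinearMap.BilinForm F V) : Type _ := CliffordAlgebra B.toQuadraticMap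

/-- A pin cover of `H` with respect to the orthogonal module `V` (with action `ρ` and form `B`):
a pointed cocommutative Hopf algebra `Ht`, a Hopf algebra epimorphism `π : Ht → H` and an algebra
map `γ : Ht → C(V)`, such that `(Ht, π)` is a double cover of `H`, `γ` preserves the
`ℤ/2`-gradation, and `(-1)^|h| π(h) · v = γ(h₍₁₎) v γ(S h₍₂₎)` for `v ∈ V` and homogeneous `h`. The
gradation of `Ht` is the one attached to the orthogonal `Ht`-module `V`, acting via `π`. -/
structure PinCover (ρ : H →ₐ[F] Module.End F V) (B : LinearMap.BilinForm F V)
    (Ht : Type*) [Ring Ht] [HopfAlgebra F Ht] where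
  cocomm : Coalgebra.IsCocomm F Ht
  pointed : IsPointed F Ht
  π : Ht →ₐc[F] H
  γ : Ht →ₐ[F] Cliff B
  π_surjective : Function.Surjective π
  /-- `Ht ≅ H ⊕ H` as coalgebras, and `π` restricts to an isomorphism on each copy of `H`. -/
  double_cover : ∃ e : (H × H) ≃ₗc[F] Ht,
    Function.Bijective (fun h : H => π (e (h, 0))) ∧ Function.Bijective (fun h : H => π (e (0, h)))
  γ_parity : ∀ (i : ZMod 2), ∀ h ∈ parity (ρ.comp (π : Ht →ₐ[F] H)) i,
    γ h ∈ CliffordAlgebra.evenOdd B.toQuadraticMap i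
  γ_conj : ∀ (i : ZMod 2), ∀ h ∈ parity (ρ.comp (π : Ht →ₐ[F] H)) i, ∀ v : V,
    (-1 : F) ^ i.val • CliffordAlgebra.ι B.toQuadraticMap (ρ (π h) v) =
      adAction γ h (CliffordAlgebra.ι B.toQuadraticMap v)

end Pin

/-! ### The Dirac element and the map `d` -/

section Dirac

variable {F : Type*} [Field F] {V : Type*} [AddCommGroup V] [Module F V]
variable {H : Type*} [Ring H] [HopfAlgebra F H]

/-- The algebra `A ⊗ C`, with its ordinary (ungraded) tensor product multiplication. -/
abbrev AC (ρ : H →ₐ[F] Module.End F V) (κ : V →ₗ[F] V →ₗ[F] H) (B : LinearMap.BilinForm F V) :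
    Type _ :=
  HeckeAlg ρ κ ⊗[F] Cliff B

variable (ρ : H →ₐ[F] Module.End F V) (κ : V →ₗ[F] V →ₗ[F] H) (B : LinearMap.BilinForm F V)

/-- The Dirac element `D = ∑ vᵢ ⊗ vⁱ` for a basis `(vᵢ)` and its `B`-dual basis `(vⁱ)`. -/
def dirac {ι : Type*} [Fintype ι] [DecidableEq ι] (hB : B.Nondegenerate) (b : Module.Basis ι F V) :
    AC ρ κ B :=
  ∑ i, HeckeAlg.ofV ρ κ (b i) ⊗ₜ[F] CliffordAlgebra.ι B.toQuadraticMap (B.dualBasis hB b i)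

/-- The automorphism `x ↦ (-1)^|x| x` of `A ⊗ C` for the `ℤ/2`-gradation inherited from `C`. -/
def sign : AC ρ κ B →ₐ[F] AC ρ κ B :=
  Algebra.TensorProduct.map (AlgHom.id F _) CliffordAlgebra.involute

/-- The map `d(x) = D x - (-1)^|x| x D`. -/
def dMap (D : AC ρ κ B) : AC ρ κ B →ₗ[F] AC ρ κ B :=
  LinearMap.mulLeft F D - LinearMap.mulRight F D ∘ₗ (sign ρ κ B).toLinearMap

variable {ρ B} {Ht : Type*} [Ring Ht] [HopfAlgebra F Ht] (P : PinCover ρ B Ht)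

namespace PinCover

/-- The `Ht`-module structure on `V` via `π`. -/
abbrev action : Ht →ₐ[F] Module.End F V := ρ.comp (P.π : Ht →ₐ[F] H)

/-- The diagonal map `Δ_C : Ht → H ⊗ C`, `h ↦ π(h₍₁₎) ⊗ γ(h₍₂₎)`. -/
def diag : Ht →ₐ[F] H ⊗[F] Cliff B :=
  (Algebra.TensorProduct.map (P.π : Ht →ₐ[F] H) P.γ).comp (Bialgebra.comulAlgHom F Ht)

/-- The diagonal map `Δ_C`, with values in `A ⊗ C`. -/
def diagAC : Ht →ₐ[F] AC ρ κ B :=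
  (Algebra.TensorProduct.map (HeckeAlg.ofH ρ κ) (AlgHom.id F (Cliff B))).comp P.diag

/-- The subspace `(A ⊗ C)_triv` on which every `h ∈ Ht` acts as `ε(h)`. Here `h` acts on `A ⊗ C` by
`h · x = Δ_C(h₍₁₎) x Δ_C(S h₍₂₎)`. -/
def triv : Submodule F (AC ρ κ B) :=
  ⨅ h : Ht, LinearMap.ker (adAction (P.diagAC κ) h -
    Coalgebra.counit (R := F) h • (LinearMap.id : AC ρ κ B →ₗ[F] AC ρ κ B))

/-- The subspace `(A ⊗ C)_det` on which every homogeneous `h ∈ Ht` acts as `(-1)^|h| ε(h)`. -/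
def det : Submodule F (AC ρ κ B) :=
  ⨅ (i : ZMod 2) (h : Ht) (_ : h ∈ parity P.action i),
    LinearMap.ker (adAction (P.diagAC κ) h -
      ((-1 : F) ^ i.val * Coalgebra.counit (R := F) h) •
        (LinearMap.id : AC ρ κ B →ₗ[F] AC ρ κ B))

/-- The Parthasarathy condition: `D² ∈ Z(A ⊗ C) + Δ_C(Ht^even)`. -/
def Parthasarathy (D : AC ρ κ B) : Prop :=
  ∃ z ∈ Subalgebra.center F (AC ρ κ B), ∃ h ∈ parity P.action 0, D ^ 2 = z + P.diagAC κ h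

end PinCover

end Dirac

end BarbaschSahi

end

set_option linter.unusedSectionVars false

noncomputable section

/-! Since `D` is odd, `d²` is the commutator with `D²`. Elements of the trivial and the determinant
component commute with `Δ_C` of even elements, so the Parthasarathy condition gives `d² = 0` on both
(`dMap_dMap_of_mem_twisted`). Invariance of `∑ v_k ⊗ v^k` gives `Δ_C(g) D = det(g) D Δ_C(g)` for
group-like `g`. Hence `d` exchanges the two components, is linear for right multiplication by
`Δ_C(Ht)`, and kills `Δ_C(Ht)`.

What remains is a Koszul argument. PBW, symmetrization and a coalgebra section `σ` of `π` identify
`S(V) ⊗ C ⊗ H` with `A ⊗ C` through `f ⊗ c ⊗ h ↦ (sym f ⊗ c) Δ_C(σ h)` (`triEquiv`). Up to terms of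
lower degree in `A`, `d` becomes the Koszul differential `2 ∑ v_k ⊗ contr(v^k)`. The de Rham
operator `∑ ∂_k ⊗ wedge(v_k)` is a homotopy whose anticommutator with it is twice the total degree.
Transported to `A ⊗ C`, this homotopy also exchanges the two components (`homotopy_mem_twisted`), so
all corrections stay inside them and no averaging is needed. Descent on the filtration
(`exists_eq_add_of_descent`) writes every `x` in one component with `d x` in filtration degree zero
as `d w + Δ_C(t)`, with `w` in the other component (`exists_eq_dMap_add_diagAC`). For `d x = 0` this
describes the kernel. For `x` in the determinant component with `d x = Δ_C(k)` it forces `d x = 0`,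
so the sum is direct.

Two facts on Hopf algebras support this. A pointed cocommutative Hopf algebra in characteristic zero
is generated by primitive and group-like elements (`hopfSpan_eq_top`), so equivariance is checked on
these. A double cover is `σ(H) + z σ(H)` with `z` a central group-like involution
(`exists_splitting`). As `γ(z)` is a scalar `s = ±1`, `Δ_C(Ht) = Δ_C(σ H)`, and multiplication by
the central element `(1 + s z) / 2` replaces an element with invariant image by a central one with
the same image (`exists_section`). -/

namespace BarbaschSahi

/-! ### Powers and logarithms of unipotent elements in characteristic zero. -/

section Unipotent

open Polynomial

variable {F Q : Type*} [Field F] [Ring Q] [Algebra F Q]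

/-- Apply a linear functional to the coefficients of a polynomial. -/
def mapCoeff (l : Q →ₗ[F] F) (P : Q[X]) : F[X] :=
  ∑ i ∈ Finset.range (P.natDegree + 1), monomial i (l (P.coeff i))

theorem coeff_mapCoeff (l : Q →ₗ[F] F) (P : Q[X]) (i : ℕ) :
    (mapCoeff l P).coeff i = l (P.coeff i) := by
  simp only [mapCoeff, finsetSum_coeff, coeff_monomial]
  rw [Finset.sum_ite_eq' (Finset.range (P.natDegree + 1)) i]
  split_ifs with h
  · rfl
  · rw [coeff_eq_zero_of_natDegree_lt (by simpa using h), map_zero]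

theorem eval_mapCoeff (l : Q →ₗ[F] F) (P : Q[X]) (k : ℕ) :
    (mapCoeff l P).eval (k : F) = l (P.eval (k : Q)) := by
  rw [mapCoeff, eval_finsetSum, eval_eq_sum_range, map_sum]
  refine Finset.sum_congr rfl fun i _ => ?_
  rw [eval_monomial]
  have : P.coeff i * (k : Q) ^ i = (k : F) ^ i • P.coeff i := by
    rw [Algebra.smul_def, map_pow, map_natCast, ((Nat.cast_commute k (P.coeff i)).pow_left i).eq]
  rw [this, map_smul, smul_eq_mul, mul_comm]

theorem polynomial_eq_of_eval_natCast [CharZero F] {p q : F[X]} (h : ∀ k : ℕ, p.eval (k : F) = q.eval (k : F)) :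
    p = q := by
  refine eq_of_infinite_eval_eq p q (Set.Infinite.mono ?_
    (Set.infinite_range_of_injective (Nat.cast_injective (R := F))))
  rintro _ ⟨k, rfl⟩
  exact h k

/-- Functionals separate the coefficients, which reduces the claim to scalar polynomials agreeing at
infinitely many points. This avoids evaluating at non-central elements of `Q`. -/
theorem ext_of_eval_natCast (F : Type*) [Field F] [CharZero F] [Algebra F Q] {P R : Q[X]}
    (h : ∀ k : ℕ, P.eval (k : Q) = R.eval (k : Q)) : P = R := by
  ext i
  rw [← sub_eq_zero, ← Module.forall_dual_apply_eq_zero_iff F]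
  intro l
  have : mapCoeff l P = mapCoeff l R := polynomial_eq_of_eval_natCast fun k => by
    rw [eval_mapCoeff, eval_mapCoeff, h]
  rw [map_sub, ← coeff_mapCoeff, ← coeff_mapCoeff, this, sub_self]

/-- The powers of a unipotent element depend polynomially on the exponent. -/
theorem exists_polynomial_eval_eq_pow (F : Type*) [Field F] [CharZero F] [Algebra F Q] 
    {N : Q} (hN : IsNilpotent N) :
    ∃ P : Q[X], ∀ k : ℕ, P.eval (k : Q) = (1 + N) ^ k := by
  obtain ⟨n, hn⟩ := hN
  -- The binomial series of `(1 + N) ^ k`, cut off at the nilpotency exponent, with `k choose j`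
  -- written as the polynomial `descPochhammer F j / j!` in `k`.
  refine ⟨∑ j ∈ Finset.range n, C (N ^ j) *
    (C ((j.factorial : F)⁻¹) * descPochhammer F j).map (algebraMap F Q), fun k => ?_⟩
  have key : ∀ j : ℕ, (C (N ^ j) *
      (C ((j.factorial : F)⁻¹) * descPochhammer F j).map (algebraMap F Q)).eval (k : Q) =
      N ^ j * (k.choose j : Q) := by
    intro j
    rw [eval_C_mul, eval_map, eval₂_at_natCast, eval_C_mul, descPochhammer_eval_eq_descFactorial,
      Nat.descFactorial_eq_factorial_mul_choose, Nat.cast_mul, inv_mul_cancel_left₀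
      (by exact_mod_cast j.factorial_ne_zero), map_natCast]
  rw [eval_finsetSum, Finset.sum_congr rfl fun j _ => key j, add_comm,
    (Commute.one_right N).add_pow]
  simp only [one_pow, mul_one]
  -- Both sums extend to a common range: beyond `n` the powers of `N` vanish, beyond `k` the
  -- binomial coefficients.
  have h1 : ∀ m, n ≤ m → ∑ j ∈ Finset.range m, N ^ j * (k.choose j : Q) =
      ∑ j ∈ Finset.range n, N ^ j * (k.choose j : Q) := fun m hm => by
    refine (Finset.sum_subset (Finset.range_mono hm) fun j _ hj => ?_).symm
    rw [pow_eq_zero_of_le (by simpa using hj) hn, zero_mul]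
  have h2 : ∀ m, k + 1 ≤ m → ∑ j ∈ Finset.range m, N ^ j * (k.choose j : Q) =
      ∑ j ∈ Finset.range (k + 1), N ^ j * (k.choose j : Q) := fun m hm => by
    refine (Finset.sum_subset (Finset.range_mono hm) fun j _ hj => ?_).symm
    rw [Nat.choose_eq_zero_of_lt (by simpa using hj), Nat.cast_zero, mul_zero]
  rw [← h1 _ (le_max_left n (k + 1)), h2 _ (le_max_right n (k + 1))]

variable [CharZero F] {Y : Q} {P : Q[X]}

theorem coeff_zero_of_eval_eq_pow (hP : ∀ k : ℕ, P.eval (k : Q) = Y ^ k) : P.coeff 0 = 1 := by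
  simpa [← coeff_zero_eq_eval_zero] using hP 0

-- `P` behaves like `k ↦ exp(k L)` with `L = P.coeff 1`: differentiating `P(k + m) = Y ^ k P(m)` in
-- `m` at `0` gives `P' = P L`. The recursion shows that all coefficients come from the logarithm
-- `L`.
variable (F) in
theorem coeff_succ_of_eval_eq_pow (hP : ∀ k : ℕ, P.eval (k : Q) = Y ^ k) (i : ℕ) :
    ((i : F) + 1) • P.coeff (i + 1) = P.coeff i * P.coeff 1 := by
  rw [← sub_eq_zero, ← Module.forall_dual_apply_eq_zero_iff F]
  intro l
  have key : derivative (mapCoeff l P) = mapCoeff (l ∘ₗ LinearMap.mulRight F (P.coeff 1)) P := by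
    refine polynomial_eq_of_eval_natCast fun k => ?_
    have h1 : (mapCoeff l P).comp (X + C (k : F)) =
        mapCoeff (l ∘ₗ LinearMap.mulLeft F (Y ^ k)) P := by
      refine polynomial_eq_of_eval_natCast fun m => ?_
      rw [eval_comp, eval_mapCoeff, LinearMap.comp_apply, LinearMap.mulLeft_apply, hP m, ← pow_add,
        ← hP, ← eval_mapCoeff]
      simp [add_comm]
    have h2 := congrArg (fun p => (derivative p).eval 0) h1
    simp only [derivative_comp, eval_mul, eval_comp] at h2
    rw [eval_mapCoeff, LinearMap.comp_apply, LinearMap.mulRight_apply, hP k,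
      ← LinearMap.mulLeft_apply (R := F), ← LinearMap.comp_apply, ← coeff_mapCoeff]
    simpa [← coeff_zero_eq_eval_zero, coeff_derivative] using h2
  have := congrArg (fun p => p.coeff i) key
  simp only [coeff_derivative, coeff_mapCoeff, LinearMap.comp_apply, LinearMap.mulRight_apply]
    at this
  rw [map_sub, map_smul, smul_eq_mul, mul_comm, this, sub_self]

variable (F) in
/-- If `f(Y) = a(Y) b(Y)` with commuting factors for algebra maps `f, a, b`, then the logarithm
`L` of `Y` satisfies `f(L) = a(L) + b(L)`. -/
theorem map_coeff_one_of_eval_eq_pow (hP : ∀ k : ℕ, P.eval (k : Q) = Y ^ k)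
    {R : Type*} [Ring R] [Algebra F R] (f a b : Q →ₐ[F] R)
    (hc : Commute (a Y) (b Y)) (h : f Y = a Y * b Y) :
    f (P.coeff 1) = a (P.coeff 1) + b (P.coeff 1) := by
  -- At `k` both sides equal `(a(Y) b(Y)) ^ k`, as the factors commute. The claim is the comparison
  -- of linear coefficients.
  have key : P.map (f : Q →+* R) = P.map (a : Q →+* R) * P.map (b : Q →+* R) := by
    refine ext_of_eval_natCast F fun k => ?_
    have e : ∀ g : Q →ₐ[F] R, (P.map (g : Q →+* R)).eval (k : R) = g Y ^ k := fun g => by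
      rw [eval_map, eval₂_at_natCast, hP]
      simp
    rw [e f, eval, eval₂_mul_noncomm _ _ fun i => ?_, ← eval, ← eval, e a, e b, h, hc.mul_pow]
    exact (Nat.cast_commute k _).symm
  have h1 := congrArg (fun p => p.coeff 1) key
  simp only [coeff_map, coeff_mul, Finset.Nat.antidiagonal_succ] at h1
  have h0 := coeff_zero_of_eval_eq_pow hP
  simp [h0] at h1
  rw [h1, add_comm]

end Unipotent

end BarbaschSahi

namespace BarbaschSahi

/-! ### Contraction of tensors with functionals. -/

section Slices

variable {F : Type*} [Field F] {M N : Type*} [AddCommGroup M] [Module F M]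
  [AddCommGroup N] [Module F N]

/-- Contract the second factor of a tensor with a functional. -/
def slice (φ : N →ₗ[F] F) : M ⊗[F] N →ₗ[F] M :=
  (TensorProduct.rid F M).toLinearMap ∘ₗ LinearMap.lTensor M φ

@[simp]
theorem slice_tmul (φ : N →ₗ[F] F) (x : M) (y : N) : slice φ (x ⊗ₜ[F] y) = φ y • x := by
  simp [slice]

theorem eq_zero_of_slice_eq_zero {t : M ⊗[F] N} (h : ∀ φ : N →ₗ[F] F, slice φ t = 0) : t = 0 := by
  classical
  let b := Module.Basis.ofVectorSpace F N
  apply (TensorProduct.equivFinsuppOfBasisRight b).injective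
  ext i
  rw [map_zero, Finsupp.zero_apply, ← h (b.coord i)]
  clear h
  induction t with
  | zero => simp
  | add x y hx hy => simp only [map_add, Finsupp.add_apply, hx, hy]
  | tmul x y => simp

theorem slice_rTensor {M' : Type*} [AddCommGroup M'] [Module F M'] (f : M →ₗ[F] M')
    (φ : N →ₗ[F] F) (t : M ⊗[F] N) : slice φ (f.rTensor N t) = f (slice φ t) := by
  induction t with
  | zero => simp
  | add x y hx hy => simp only [map_add, hx, hy]
  | tmul x y => simp

theorem slice_mem_of_mem_range {W : Submodule F M} {X : Submodule F N} (φ : N →ₗ[F] F) {t}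
    (ht : t ∈ LinearMap.range (TensorProduct.map W.subtype X.subtype)) : slice φ t ∈ W := by
  obtain ⟨t, rfl⟩ := ht
  induction t with
  | zero => simp
  | add x y hx hy => simpa only [map_add] using W.add_mem hx hy
  | tmul x y => simpa using W.smul_mem _ x.2

theorem exists_retraction (W : Submodule F M) : ∃ p : M →ₗ[F] M, (∀ x, p x ∈ W) ∧
    ∀ x ∈ W, p x = x := by
  obtain ⟨p, hp⟩ := W.subtype.exists_leftInverse_of_injective W.ker_subtype
  exact ⟨W.subtype ∘ₗ p, fun x => (p x).2, fun x hx =>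
    congrArg Subtype.val (LinearMap.congr_fun hp ⟨x, hx⟩)⟩

theorem rTensor_eq_self {W : Submodule F M} {p : M →ₗ[F] M} (hp : ∀ x ∈ W, p x = x)
    {t : M ⊗[F] N} (ht : ∀ φ : N →ₗ[F] F, slice φ t ∈ W) : p.rTensor N t = t := by
  rw [← sub_eq_zero]
  refine eq_zero_of_slice_eq_zero fun φ => ?_
  rw [map_sub, slice_rTensor, hp _ (ht φ), sub_self]

/-- For a projection `p` onto `W`, both `p ⊗ 1` and `1 ⊗ p` fix `t`, hence so does `p ⊗ p`. -/
theorem mem_range_map_subtype {W : Submodule F M} {t : M ⊗[F] M}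
    (h₁ : ∀ φ : M →ₗ[F] F, slice φ t ∈ W)
    (h₂ : ∀ φ : M →ₗ[F] F, slice φ (TensorProduct.comm F M M t) ∈ W) :
    t ∈ LinearMap.range (TensorProduct.map W.subtype W.subtype) := by
  obtain ⟨p, hpW, hp⟩ := exists_retraction W
  have e₁ := rTensor_eq_self hp h₁
  have e₂ := rTensor_eq_self hp h₂
  have e₃ : TensorProduct.map p p t = t := by
    conv_rhs => rw [← (TensorProduct.comm F M M).symm_apply_apply t, ← e₂, ← e₁]
    generalize t = s
    induction s with
    | zero => simp
    | add x y hx hy => simp only [map_add, hx, hy]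
    | tmul x y => simp
  refine ⟨TensorProduct.map (p.codRestrict W hpW) (p.codRestrict W hpW) t, ?_⟩
  rw [← LinearMap.comp_apply, ← TensorProduct.map_comp, LinearMap.subtype_comp_codRestrict, e₃]

end Slices

/-! ### Subcoalgebras of cocommutative coalgebras. -/

section Subcoalgebra

open Coalgebra

variable {F : Type*} [Field F] {K : Type*} [AddCommGroup K] [Module F K] [Coalgebra F K]

/-- The action of a functional on a coalgebra. -/
def hit (φ : K →ₗ[F] F) : K →ₗ[F] K := slice φ ∘ₗ comul

theorem hit_counit (x : K) : hit (counit (R := F)) x = x := by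
  simp [hit, slice]

theorem hit_hit (φ ψ : K →ₗ[F] F) (x : K) :
    hit φ (hit ψ x) = hit (LinearMap.mul' F F ∘ₗ TensorProduct.map φ ψ ∘ₗ comul) x := by
  have h1 : hit φ (hit ψ x) =
      slice φ (slice ψ (LinearMap.rTensor K comul (comul (R := F) x))) := by
    rw [slice_rTensor]; rfl
  have h2 := congrArg (TensorProduct.assoc F K K K).symm (coassoc_apply (R := F) x)
  rw [LinearEquiv.symm_apply_apply] at h2
  rw [h1, h2]
  simp only [hit, LinearMap.comp_apply]
  generalize comul (R := F) x = t
  induction t with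
  | zero => simp
  | add x y hx hy => simp only [map_add, hx, hy]
  | tmul x y =>
    simp only [LinearMap.lTensor_tmul, slice_tmul, LinearMap.comp_apply]
    generalize comul (R := F) y = t
    induction t with
    | zero => simp
    | add x y hx hy => simp only [map_add, TensorProduct.tmul_add, hx, hy, add_smul]
    | tmul y z => simp [smul_smul, mul_comm]

/-- By cocommutativity the slices of `Δ x` on either side coincide, so stability under one-sided
slices is enough. -/
theorem isSubcoalgebra_of_hit_mem [IsCocomm F K] {W : Submodule F K}
    (h : ∀ φ : K →ₗ[F] F, ∀ x ∈ W, hit φ x ∈ W) : IsSubcoalgebra F W := fun x hx =>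
  mem_range_map_subtype (fun φ => h φ x hx) fun φ => by
    rw [comm_comul]; exact h φ x hx

/-- The fundamental theorem of coalgebras, in the cocommutative case. -/
theorem exists_finiteDimensional_isSubcoalgebra [IsCocomm F K] (x : K) :
    ∃ W : Submodule F K, IsSubcoalgebra F W ∧ FiniteDimensional F W ∧ x ∈ W := by
  -- The subcoalgebra is the orbit of `x` under the dual algebra. It lies in the span of the left
  -- factors of one expression of `Δ x`, and contains `x` because the counit acts as the identity.
  let f : (K →ₗ[F] F) →ₗ[F] K :=
    { toFun := fun φ => hit φ x
      map_add' := fun φ ψ => by simp [hit, slice, LinearMap.lTensor_add]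
      map_smul' := fun c φ => by simp [hit, slice, LinearMap.lTensor_smul] }
  refine ⟨LinearMap.range f, isSubcoalgebra_of_hit_mem ?_, ?_, ⟨counit, hit_counit x⟩⟩
  · rintro φ _ ⟨ψ, rfl⟩
    exact ⟨_, (hit_hit φ ψ x).symm⟩
  · obtain ⟨s, hs⟩ := TensorProduct.exists_finset (comul (R := F) x)
    classical
    have : FiniteDimensional F (Submodule.span F (s.image Prod.fst : Set K)) :=
      FiniteDimensional.span_finset F _
    refine Submodule.finiteDimensional_of_le (S₂ := Submodule.span F (s.image Prod.fst : Set K)) ?_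
    rintro _ ⟨φ, rfl⟩
    change slice φ (comul (R := F) x) ∈ _
    rw [hs, map_sum]
    refine Submodule.sum_mem _ fun i hi => ?_
    rw [slice_tmul]
    exact Submodule.smul_mem _ _ (Submodule.subset_span (by
      simpa using ⟨i.2, hi⟩))

section Structure

variable (W : Submodule F K) (hW : IsSubcoalgebra F W)

theorem map_subtype_injective :
    Function.Injective (TensorProduct.map W.subtype W.subtype) :=
  TensorProduct.map_injective_of_flat_flat _ _ W.injective_subtype W.injective_subtype

/-- The restriction of the comultiplication to a subcoalgebra. -/
def subComul : W →ₗ[F] W ⊗[F] W :=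
  (LinearEquiv.ofInjective _ (map_subtype_injective W)).symm.toLinearMap ∘ₗ
    (comul ∘ₗ W.subtype).codRestrict (LinearMap.range (TensorProduct.map W.subtype W.subtype))
      (fun x => hW x.1 x.2)

theorem map_subComul (x : W) :
    TensorProduct.map W.subtype W.subtype (subComul W hW x) = comul (R := F) (x : K) := by
  have := LinearEquiv.ofInjective_apply (TensorProduct.map W.subtype W.subtype)
    (h := map_subtype_injective W) (subComul W hW x)
  rw [← this]
  simp only [subComul, LinearMap.comp_apply, LinearEquiv.coe_coe, LinearEquiv.apply_symm_apply]
  rfl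

/-- A subcoalgebra is a coalgebra. -/
abbrev subcoalgebra : Coalgebra F W where
  comul := subComul W hW
  counit := counit ∘ₗ W.subtype
  coassoc := by
    ext x
    -- Over a field the threefold tensor power of `W` embeds in that of `K`, so coassociativity is
    -- inherited.
    apply TensorProduct.map_injective_of_flat_flat _ _ W.injective_subtype
      (map_subtype_injective W)
    have h1 : ∀ t : W ⊗[F] W, TensorProduct.map W.subtype (TensorProduct.map W.subtype W.subtype)
        ((TensorProduct.assoc F W W W) ((subComul W hW).rTensor W t)) =
        TensorProduct.assoc F K K K (comul.rTensor K
          (TensorProduct.map W.subtype W.subtype t)) := by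
      intro t
      induction t with
      | zero => simp
      | add x y hx hy => simp only [map_add, hx, hy]
      | tmul x y =>
        simp only [LinearMap.rTensor_tmul, TensorProduct.map_tmul, Submodule.subtype_apply,
          ← map_subComul W hW x]
        generalize subComul W hW x = s
        induction s with
        | zero => simp
        | add x y hx hy => simp only [map_add, TensorProduct.add_tmul, hx, hy]
        | tmul a b => simp
    have h2 : ∀ t : W ⊗[F] W, TensorProduct.map W.subtype (TensorProduct.map W.subtype W.subtype)
        ((subComul W hW).lTensor W t) =
        comul.lTensor K (TensorProduct.map W.subtype W.subtype t) := by
      intro t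
      induction t with
      | zero => simp
      | add x y hx hy => simp only [map_add, hx, hy]
      | tmul x y => simp [map_subComul W hW y]
    simp only [LinearMap.comp_apply, LinearEquiv.coe_coe]
    rw [h1, h2, map_subComul, coassoc_apply]
  rTensor_counit_comp_comul := by
    ext x
    apply (TensorProduct.lid F W).injective
    apply W.injective_subtype
    have h1 : ∀ t : W ⊗[F] W, W.subtype (TensorProduct.lid F W
        ((counit ∘ₗ W.subtype).rTensor W t)) = TensorProduct.lid F K
        (counit.rTensor K (TensorProduct.map W.subtype W.subtype t)) := by
      intro t
      induction t with
      | zero => simp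
      | add x y hx hy => simp only [map_add, hx, hy]
      | tmul x y => simp
    rw [LinearMap.comp_apply, h1, map_subComul, rTensor_counit_comul]
    simp
  lTensor_counit_comp_comul := by
    ext x
    apply (TensorProduct.rid F W).injective
    apply W.injective_subtype
    have h1 : ∀ t : W ⊗[F] W, W.subtype (TensorProduct.rid F W
        ((counit ∘ₗ W.subtype).lTensor W t)) = TensorProduct.rid F K
        (counit.lTensor K (TensorProduct.map W.subtype W.subtype t)) := by
      intro t
      induction t with
      | zero => simp
      | add x y hx hy => simp only [map_add, hx, hy]
      | tmul x y => simp
    rw [LinearMap.comp_apply, h1, map_subComul, lTensor_counit_comul]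
    simp

theorem subcoalgebra_isCocomm [IsCocomm F K] :
    @IsCocomm F W _ _ _ (subcoalgebra W hW) := by
  let := subcoalgebra W hW
  refine ⟨?_⟩
  ext x
  apply map_subtype_injective W
  have : ∀ t : W ⊗[F] W, TensorProduct.map W.subtype W.subtype (TensorProduct.comm F W W t) =
      TensorProduct.comm F K K (TensorProduct.map W.subtype W.subtype t) := fun t => by
    induction t with
    | zero => simp
    | add x y hx hy => simp only [map_add, hx, hy]
    | tmul x y => simp
  change TensorProduct.map W.subtype W.subtype (TensorProduct.comm F W W (subComul W hW x)) =
    TensorProduct.map W.subtype W.subtype (subComul W hW x)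
  rw [this, map_subComul, comm_comul]

/-- The inclusion of a subcoalgebra. -/
def subcoalgebraIncl : letI := subcoalgebra W hW; W →ₗc[F] K :=
  letI := subcoalgebra W hW
  { W.subtype with
    counit_comp := rfl
    map_comp_comul := LinearMap.ext (map_subComul W hW) }

end Structure

end Subcoalgebra

end BarbaschSahi

namespace BarbaschSahi

open Coalgebra

/-! ### Idempotents of Artinian rings. -/

section Idempotents

/-- The primitive idempotents of an artinian ring. -/
theorem exists_idempotents {R : Type*} [CommRing R] [IsArtinianRing R]
    [Fintype (MaximalSpectrum R)] :
    ∃ e : MaximalSpectrum R → R, ∑ m, e m = 1 ∧ (∀ m, e m * e m = e m) ∧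
      ∀ m, ∀ a ∈ m.asIdeal, e m * a ∈ nilradical R := by
  classical
  -- The map to the product of the residue fields is onto by the Chinese remainder theorem and has
  -- nil kernel, so the coordinate idempotents lift.
  let f : R →+* ∀ m : MaximalSpectrum R, R ⧸ m.asIdeal :=
    RingHom.pi fun m => Ideal.Quotient.mk m.asIdeal
  have hf : RingHom.ker f ≤ nilradical R := by
    rw [IsArtinianRing.nilradical_eq_iInf, le_iInf_iff]
    intro m x hx
    exact Ideal.Quotient.eq_zero_iff_mem.1 (congrFun ((RingHom.mem_ker).1 hx) m)
  have hs : Function.Surjective f := fun x => by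
    obtain ⟨r, hr⟩ := Ideal.pi_quotient_surjective (I := fun m : MaximalSpectrum R => m.asIdeal)
      (fun m n hmn => Ideal.isCoprime_iff_sup_eq.2
        (m.isMaximal.coprime_of_ne n.isMaximal fun h => hmn (MaximalSpectrum.ext h))) x
    exact ⟨r, funext hr⟩
  obtain ⟨e, he, hfe⟩ := CompleteOrthogonalIdempotents.lift_of_isNilpotent_ker f
    (fun x hx => mem_nilradical.1 (hf hx))
    (CompleteOrthogonalIdempotents.single fun m : MaximalSpectrum R => R ⧸ m.asIdeal)
    (fun i => hs _)
  refine ⟨e, he.complete, fun m => he.idem m, fun m a ha => hf ?_⟩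
  rw [RingHom.mem_ker, map_mul, show f (e m) = Pi.single m 1 from congrFun hfe m]
  funext n
  by_cases h : n = m
  · subst h
    simpa [f] using (Ideal.Quotient.eq_zero_iff_mem.2 ha : Ideal.Quotient.mk n.asIdeal a = 0)
  · simp [h]

end Idempotents

/-! ### Pointed coalgebras: group-like elements as maximal ideals of the dual algebra. -/

section Pointed

variable {F : Type*} [Field F] {K : Type*} [AddCommGroup K] [Module F K] [Coalgebra F K]
  [IsCocomm F K]

theorem isSubcoalgebra_iff_hit_mem {W : Submodule F K} :
    IsSubcoalgebra F W ↔ ∀ φ : K →ₗ[F] F, ∀ x ∈ W, hit φ x ∈ W :=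
  ⟨fun h φ x hx => slice_mem_of_mem_range φ (h x hx), isSubcoalgebra_of_hit_mem⟩

variable {D : Type*} [AddCommGroup D] [Module F D] [Coalgebra F D] [IsCocomm F D]

theorem hit_map (j : D →ₗc[F] K) (ψ : K →ₗ[F] F) (d : D) :
    hit ψ (j d) = j (hit (ψ ∘ₗ (j : D →ₗ[F] K)) d) := by
  have h := CoalgHomClass.map_comp_comul_apply j d
  simp only [hit, LinearMap.comp_apply]
  rw [← h]
  generalize comul (R := F) d = t
  induction t with
  | zero => simp
  | add x y hx hy => simp only [map_add, hx, hy]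
  | tmul x y => simp

/-- Images and preimages under `j` identify the subcoalgebras of `D` with those of `K` inside the
image, so simple ones correspond. -/
theorem IsPointed.of_injective (hK : IsPointed F K) (j : D →ₗc[F] K)
    (hj : Function.Injective j) : IsPointed F D := by
  intro W hW hW0 hs
  have hstab : ∀ W' : Submodule F K, IsSubcoalgebra F W' →
      IsSubcoalgebra F (W'.comap (j : D →ₗ[F] K)) := by
    intro W' hW'
    rw [isSubcoalgebra_iff_hit_mem] at hW' ⊢
    intro ψ x hx
    -- `ψ ∘ p` extends the functional `ψ` from `D` to `K`.
    obtain ⟨p, hp⟩ := (j : D →ₗ[F] K).exists_leftInverse_of_injective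
      (LinearMap.ker_eq_bot.2 hj)
    have := hW' (ψ ∘ₗ p) _ hx
    rw [CoalgHom.coe_toLinearMap, hit_map, LinearMap.comp_assoc, hp] at this
    exact this
  have hmap : IsSubcoalgebra F (W.map (j : D →ₗ[F] K)) := by
    rw [isSubcoalgebra_iff_hit_mem] at hW ⊢
    rintro ψ _ ⟨x, hx, rfl⟩
    exact ⟨_, hW _ x hx, (hit_map j ψ x).symm⟩
  rw [← hK (W.map (j : D →ₗ[F] K)) hmap ?_ ?_]
  · exact (Submodule.equivMapOfInjective _ hj W).finrank_eq
  · intro h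
    refine hW0 (eq_bot_iff.2 fun x hx => hj ?_)
    rw [map_zero]
    exact (Submodule.mem_bot F).1 (h ▸ ⟨x, hx, rfl⟩)
  · intro W' hle hW'
    have hmc : (W'.comap (j : D →ₗ[F] K)).map (j : D →ₗ[F] K) = W' :=
      Submodule.map_comap_eq_of_le (hle.trans LinearMap.map_le_range)
    have hle' : W'.comap (j : D →ₗ[F] K) ≤ W := by
      refine (Submodule.map_le_map_iff_of_injective (f := (j : D →ₗ[F] K)) hj _ _).1 ?_
      rw [hmc]
      exact hle
    rcases hs _ hle' (hstab W' hW') with h | h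
    · left; rw [← hmc, h, Submodule.map_bot]
    · right; rw [← hmc, h]

theorem mul_apply_hit (φ ψ : WithConv (D →ₗ[F] F)) (d : D) :
    (φ * ψ) d = φ (hit ψ.ofConv d) := by
  rw [LinearMap.convMul_apply, hit, LinearMap.comp_apply]
  generalize comul (R := F) d = t
  induction t with
  | zero => simp
  | add x y hx hy => simp only [map_add, hx, hy]
  | tmul x y => simp [mul_comm]

/-- The annihilator in a coalgebra of an ideal of the dual algebra. -/
def perp (I : Ideal (WithConv (D →ₗ[F] F))) : Submodule F D where
  carrier := {d | ∀ φ ∈ I, φ d = 0}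
  zero_mem' := fun φ _ => by simp
  add_mem' := fun {x y} hx hy φ hφ => by rw [map_add, hx φ hφ, hy φ hφ, add_zero]
  smul_mem' := fun c x hx φ hφ => by rw [map_smul, hx φ hφ, smul_zero]

theorem isSubcoalgebra_perp (I : Ideal (WithConv (D →ₗ[F] F))) : IsSubcoalgebra F (perp I) := by
  rw [isSubcoalgebra_iff_hit_mem]
  intro ψ x hx φ hφ
  have := mul_apply_hit φ (WithConv.toConv ψ) x
  rw [WithConv.ofConv_toConv] at this
  rw [← this]
  exact hx _ (I.mul_mem_right _ hφ)

/-- In finite dimension a subspace of the dual equals its double annihilator. -/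
theorem mem_of_vanish_perp [FiniteDimensional F D] {I : Ideal (WithConv (D →ₗ[F] F))}
    {φ : WithConv (D →ₗ[F] F)} (h : ∀ d ∈ perp I, φ d = 0) : φ ∈ I := by
  let I' : Submodule F (Module.Dual F D) :=
    (I.restrictScalars F).map (WithConv.linearEquiv F (D →ₗ[F] F)).toLinearMap
  have h1 : φ.ofConv ∈ I'.dualCoannihilator.dualAnnihilator := by
    rw [Submodule.mem_dualAnnihilator]
    intro d hd
    refine h d fun ψ hψ => ?_
    rw [Submodule.mem_dualCoannihilator] at hd
    exact hd _ ⟨ψ, hψ, rfl⟩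
  have : FiniteDimensional F (Module.Dual F D) := inferInstance
  have : FiniteDimensional F I' := FiniteDimensional.finiteDimensional_submodule I'
  rw [Subspace.dualCoannihilator_dualAnnihilator_eq] at h1
  obtain ⟨ψ, hψ, h2⟩ := h1
  have : ψ = φ := WithConv.ofConv_injective h2
  exact this ▸ hψ

/-- In a pointed cocommutative finite-dimensional coalgebra, the maximal ideals of the dual
algebra are given by group-like elements. -/
theorem exists_isGroupLikeElem_of_isMaximal [FiniteDimensional F D] (hD : IsPointed F D)
    (m : Ideal (WithConv (D →ₗ[F] F))) [hm : m.IsMaximal] :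
    ∃ g : D, IsGroupLikeElem F g ∧ ∀ φ : WithConv (D →ₗ[F] F), φ ∈ m ↔ φ g = 0 := by
  have hne : perp m ≠ ⊥ := by
    intro h
    refine hm.ne_top ((Ideal.eq_top_iff_one _).2 (mem_of_vanish_perp fun d hd => ?_))
    rw [h, Submodule.mem_bot] at hd
    rw [hd, map_zero]
  have hdim := hD (perp m) (isSubcoalgebra_perp m) hne fun W' hle hW' => by
    rw [isSubcoalgebra_iff_hit_mem] at hW'
    -- The annihilator of `W'` is an ideal containing `m`. By maximality it is everything, so `W' =
    -- 0`, or equal to `m`, so `W'` is all of `perp m`.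
    let J : Ideal (WithConv (D →ₗ[F] F)) :=
      { carrier := {φ | ∀ d ∈ W', φ d = 0}
        zero_mem' := fun d _ => by simp
        add_mem' := fun {φ ψ} hφ hψ d hd => by
          simp only [WithConv.ofConv_add, LinearMap.add_apply, hφ d hd, hψ d hd, add_zero]
        smul_mem' := fun ψ φ hφ d hd => by
          rw [smul_eq_mul, mul_comm, mul_apply_hit]
          exact hφ _ (hW' _ _ hd) }
    have hmJ : m ≤ J := fun φ hφ d hd => hle hd φ hφ
    by_cases hJ : J = ⊤
    · left
      rw [eq_bot_iff]
      intro d hd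
      rw [Submodule.mem_bot, ← Module.forall_dual_apply_eq_zero_iff F]
      intro φ
      exact (show WithConv.toConv φ ∈ J by rw [hJ]; trivial) d hd
    · right
      have hJm : m = J := hm.eq_of_le hJ hmJ
      refine le_antisymm hle fun d hd => ?_
      by_contra hdW
      obtain ⟨φ, hφd, hφ⟩ := Submodule.exists_le_ker_of_notMem hdW
      refine hφd (hd (WithConv.toConv φ) ?_)
      rw [hJm]
      exact fun d hd => hφ hd
  obtain ⟨⟨w, hw⟩, hw0, hspan⟩ := finrank_eq_one_iff'.1 hdim
  have hspan' : ∀ d ∈ perp m, ∃ c : F, c • w = d := fun d hd => by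
    obtain ⟨c, hc⟩ := hspan ⟨d, hd⟩
    exact ⟨c, congrArg Subtype.val hc⟩
  have hmem : ∀ φ : WithConv (D →ₗ[F] F), φ ∈ m ↔ φ w = 0 := fun φ =>
    ⟨fun h => hw φ h, fun h => mem_of_vanish_perp fun d hd => by
      obtain ⟨c, rfl⟩ := hspan' d hd
      rw [map_smul, h, smul_zero]⟩
  -- The counit is the unit of the dual algebra and so is not in `m`. Thus `w` can be scaled to have
  -- counit one.
  have hε : counit (R := F) w ≠ 0 := fun h =>
    hm.ne_top ((Ideal.eq_top_iff_one _).2 ((hmem 1).2 h))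
  set g : D := (counit (R := F) w)⁻¹ • w with hg
  have hwg : w = counit (R := F) w • g := by rw [hg, smul_inv_smul₀ hε]
  have hεg : counit (R := F) g = 1 := by rw [hg, map_smul, smul_eq_mul, inv_mul_cancel₀ hε]
  have hgm : g ∈ perp m := Submodule.smul_mem _ _ hw
  have hc : ∃ c : F, comul (R := F) g = c • (g ⊗ₜ[F] g) := by
    obtain ⟨t, ht⟩ := isSubcoalgebra_perp m g hgm
    rw [← ht]
    clear ht
    induction t with
    | zero => exact ⟨0, by simp⟩
    | add x y hx hy =>
      obtain ⟨a, ha⟩ := hx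
      obtain ⟨b, hb⟩ := hy
      exact ⟨a + b, by rw [map_add, ha, hb, add_smul]⟩
    | tmul x y =>
      obtain ⟨a, ha⟩ := hspan' x x.2
      obtain ⟨b, hb⟩ := hspan' y y.2
      refine ⟨(a * counit (R := F) w) * (b * counit (R := F) w), ?_⟩
      rw [TensorProduct.map_tmul, Submodule.subtype_apply, Submodule.subtype_apply, ← ha, ← hb,
        hwg, map_smul, hεg, TensorProduct.smul_tmul_smul, TensorProduct.smul_tmul_smul,
        smul_smul, smul_eq_mul, mul_one]
      congr 1
      ring
  obtain ⟨c, hc⟩ := hc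
  have hc1 : c = 1 := by
    have h := hit_counit (F := F) g
    rw [hit, LinearMap.comp_apply, hc, map_smul, slice_tmul, hεg, one_smul] at h
    have := congrArg (counit (R := F)) h
    rwa [map_smul, hεg, smul_eq_mul, mul_one] at this
  refine ⟨g, ⟨hεg, by rw [hc, hc1, one_smul]⟩, fun φ => ?_⟩
  rw [hmem φ, hg, map_smul, smul_eq_mul, mul_eq_zero, or_iff_right (inv_ne_zero hε)]

end Pointed

end BarbaschSahi

namespace BarbaschSahi

open Coalgebra

/-! ### Convolution algebras of linear maps out of a cocommutative coalgebra. -/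

section Convolution

variable {F : Type*} [Field F] {D : Type*} [AddCommGroup D] [Module F D] [Coalgebra F D]
  {A B : Type*} [Ring A] [Algebra F A] [Ring B] [Algebra F B]

/-- Composition with an algebra map is an algebra map of convolution algebras. -/
def convMap (f : A →ₐ[F] B) : WithConv (D →ₗ[F] A) →ₐ[F] WithConv (D →ₗ[F] B) :=
  AlgHom.ofLinearMap
    { toFun := fun φ => WithConv.toConv (f.toLinearMap ∘ₗ φ.ofConv)
      map_add' := fun φ ψ => by ext; simp
      map_smul' := fun c φ => by ext; simp }
    (by ext; simp [LinearMap.convOne_def])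
    (fun φ ψ => by
      apply WithConv.ofConv_injective
      exact LinearMap.algHom_comp_convMul_distrib f φ ψ)

@[simp]
theorem convMap_apply (f : A →ₐ[F] B) (φ : WithConv (D →ₗ[F] A)) (d : D) :
    convMap f φ d = f (φ d) := rfl

theorem convMul_apply_mem (p q : WithConv (D →ₗ[F] A)) {M : Submodule F A}
    (h : ∀ x y, p x * q y ∈ M) (d : D) : (p * q) d ∈ M := by
  rw [LinearMap.convMul_apply]
  generalize comul (R := F) d = t
  induction t with
  | zero => simp
  | add x y hx hy => simpa only [map_add] using M.add_mem hx hy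
  | tmul x y => exact h x y

theorem convMul_comm_of_commute [IsCocomm F D] (p q : WithConv (D →ₗ[F] A))
    (h : ∀ x y, Commute (p x) (q y)) : Commute p q := by
  ext d
  rw [LinearMap.convMul_apply, LinearMap.convMul_apply]
  conv_rhs => rw [← comm_comul F d]
  generalize comul (R := F) d = t
  induction t with
  | zero => simp
  | add x y hx hy => simp only [map_add, hx, hy]
  | tmul x y => exact h x y

variable (F D) in
/-- The inclusion of an algebra in a convolution algebra, `a ↦ ε(·) a`. -/
def convConst (a : A) : WithConv (D →ₗ[F] A) := WithConv.toConv (counit.smulRight a)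

@[simp]
theorem convConst_apply (a : A) (d : D) : convConst F D a d = counit (R := F) d • a := rfl

theorem mul_convConst_apply (p : WithConv (D →ₗ[F] A)) (a : A) (d : D) :
    (p * convConst F D a) d = p d * a := by
  have h : (p * convConst F D a) d = p (TensorProduct.rid F D (counit.lTensor D
      (comul (R := F) d))) * a := by
    rw [LinearMap.convMul_apply]
    generalize comul (R := F) d = t
    induction t with
    | zero => simp
    | add x y hx hy => simp only [map_add, hx, hy, add_mul]
    | tmul x y => simp
  rw [h, lTensor_counit_comul]
  simp

theorem convConst_mul (a b : A) : convConst F D a * convConst F D b = convConst F D (a * b) := by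
  ext d
  rw [mul_convConst_apply]
  simp

theorem convConst_one : convConst F D (1 : A) = 1 := by
  ext d
  simp [Algebra.algebraMap_eq_smul_one]

variable (F D A) in
/-- The dual algebra maps to all convolution algebras. -/
def convScalar : WithConv (D →ₗ[F] F) →ₐ[F] WithConv (D →ₗ[F] A) := convMap (Algebra.ofId F A)

theorem convScalar_apply (φ : WithConv (D →ₗ[F] F)) (d : D) :
    convScalar F D A φ d = algebraMap F A (φ d) := rfl

theorem convMap_convScalar (f : A →ₐ[F] B) (φ : WithConv (D →ₗ[F] F)) :
    convMap f (convScalar F D A φ) = convScalar F D B φ := by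
  ext d
  simp [convScalar_apply]

theorem convScalar_commute [IsCocomm F D] (φ : WithConv (D →ₗ[F] F)) (p : WithConv (D →ₗ[F] A)) :
    Commute (convScalar F D A φ) p :=
  convMul_comm_of_commute _ _ fun _ _ => Algebra.commutes _ _

theorem convScalar_mul_convConst_apply (φ : WithConv (D →ₗ[F] F)) (a : A) (d : D) :
    (convScalar F D A φ * convConst F D a) d = φ d • a := by
  rw [mul_convConst_apply, convScalar_apply, Algebra.smul_def]

variable (A) in
/-- The subspace of a convolution algebra generated by an ideal of the dual algebra. -/
def convIdeal [IsCocomm F D] (I : Ideal (WithConv (D →ₗ[F] F))) :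
    Submodule F (WithConv (D →ₗ[F] A)) :=
  Submodule.span F {q | ∃ φ ∈ I, ∃ a : A, q = convScalar F D A φ * convConst F D a}

variable [IsCocomm F D]

theorem convIdeal_mul (I J : Ideal (WithConv (D →ₗ[F] F))) :
    convIdeal A I * convIdeal A J ≤ convIdeal A (I * J) := by
  rw [convIdeal, convIdeal, Submodule.span_mul_span, Submodule.span_le]
  rintro _ ⟨_, ⟨φ, hφ, a, rfl⟩, _, ⟨ψ, hψ, b, rfl⟩, rfl⟩
  refine Submodule.subset_span ⟨φ * ψ, Ideal.mul_mem_mul hφ hψ, a * b, ?_⟩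
  change convScalar F D A φ * convConst F D a * (convScalar F D A ψ * convConst F D b) = _
  rw [mul_assoc, ← mul_assoc (convConst F D a), ← (convScalar_commute ψ (convConst F D a)).eq,
    mul_assoc (convScalar F D A ψ), ← mul_assoc, convConst_mul, map_mul]

theorem convIdeal_pow (I : Ideal (WithConv (D →ₗ[F] F))) (n : ℕ) :
    convIdeal A I ^ n ≤ convIdeal A (I ^ n) := by
  induction n with
  | zero =>
    have h0 : I ^ 0 = 1 := pow_zero I
    rw [pow_zero, h0, Submodule.one_le]
    refine Submodule.subset_span ⟨1, ?_, 1, ?_⟩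
    · rw [Ideal.one_eq_top]; trivial
    · rw [map_one, convConst_one, mul_one]
  | succ n ih =>
    have h1 : I ^ (n + 1) = I ^ n * I := pow_succ I n
    rw [pow_succ, h1]
    exact (mul_le_mul_left ih _).trans (convIdeal_mul _ _)

/-- The dual algebra maps to the centre of the convolution algebra, so an `n`-fold product of such
elements has its scalar coefficients in `I ^ n`. -/
theorem isNilpotent_of_mem_convIdeal {I : Ideal (WithConv (D →ₗ[F] F))} (hI : IsNilpotent I)
    {q : WithConv (D →ₗ[F] A)} (hq : q ∈ convIdeal A I) : IsNilpotent q := by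
  obtain ⟨n, hn⟩ := hI
  refine ⟨n, ?_⟩
  have h := convIdeal_pow (A := A) I n (Submodule.pow_mem_pow _ hq n)
  rw [hn] at h
  have h0 : convIdeal A (0 : Ideal (WithConv (D →ₗ[F] F))) ≤ ⊥ := by
    rw [convIdeal, Submodule.span_le]
    rintro _ ⟨φ, hφ, a, rfl⟩
    rw [show φ = 0 from hφ]
    simp
  exact (Submodule.mem_bot F).1 (h0 h)

theorem convScalar_mul_mem_convIdeal {I J : Ideal (WithConv (D →ₗ[F] F))}
    {e : WithConv (D →ₗ[F] F)} (he : ∀ φ ∈ I, e * φ ∈ J) {q : WithConv (D →ₗ[F] A)}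
    (hq : q ∈ convIdeal A I) : convScalar F D A e * q ∈ convIdeal A J := by
  induction hq using Submodule.span_induction with
  | mem x hx =>
    obtain ⟨φ, hφ, a, rfl⟩ := hx
    exact Submodule.subset_span ⟨e * φ, he φ hφ, a, by rw [map_mul, mul_assoc]⟩
  | zero => simp
  | add x y _ _ hx hy => rw [mul_add]; exact Submodule.add_mem _ hx hy
  | smul c x _ hx => rw [mul_smul_comm]; exact Submodule.smul_mem _ _ hx

/-- The range of `q` is finite-dimensional. Expanding `q` in a basis of it gives coefficients of the
form `l ∘ q`, which lie in `I`. -/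
theorem mem_convIdeal [FiniteDimensional F D] {I : Ideal (WithConv (D →ₗ[F] F))}
    {q : WithConv (D →ₗ[F] A)}
    (h : ∀ l : A →ₗ[F] F, WithConv.toConv (l ∘ₗ q.ofConv) ∈ I) : q ∈ convIdeal A I := by
  let W := LinearMap.range q.ofConv
  let b := Module.finBasis F W
  obtain ⟨p, hp⟩ := W.subtype.exists_leftInverse_of_injective W.ker_subtype
  have e : q = ∑ i, convScalar F D A (WithConv.toConv ((b.coord i ∘ₗ p) ∘ₗ q.ofConv)) *
      convConst F D (b i : A) := by
    ext d
    have h1 := congrArg W.subtype (b.sum_repr ⟨q d, ⟨d, rfl⟩⟩)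
    rw [map_sum] at h1
    have h2 : p (q d) = ⟨q d, ⟨d, rfl⟩⟩ := LinearMap.congr_fun hp ⟨q d, ⟨d, rfl⟩⟩
    rw [WithConv.ofConv_sum, LinearMap.sum_apply]
    simp only [convScalar_mul_convConst_apply, LinearMap.comp_apply, h2, Module.Basis.coord_apply]
    exact h1.symm
  rw [e]
  exact Submodule.sum_mem _ fun i _ => Submodule.subset_span ⟨_, h _, _, rfl⟩

end Convolution

/-! ### Generation of pointed cocommutative Hopf algebras by primitive and group-like elements. -/

section Generation

theorem includeLeft_commute_includeRight {F A B : Type*} [CommRing F] [Ring A] [Algebra F A]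
    [Ring B] [Algebra F B] (a : A) (b : B) :
    Commute ((Algebra.TensorProduct.includeLeft : A →ₐ[F] A ⊗[F] B) a)
      (Algebra.TensorProduct.includeRight b) := by
  simp [commute_iff_eq]

variable {F : Type*} [Field F] [CharZero F] {K : Type*} [Ring K] [HopfAlgebra F K]

variable (F K) in
/-- The subalgebra generated by the primitive elements. -/
abbrev primAlg : Subalgebra F K := Algebra.adjoin F {y : K | IsPrimitive F y}

variable (F K) in
/-- The span of the products of elements of `primAlg` and group-like elements. -/
def hopfSpan : Submodule F K :=
  Submodule.span F {x | ∃ u ∈ primAlg F K, ∃ g : K, IsGroupLikeElem F g ∧ x = u * g}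

variable {D : Type*} [AddCommGroup D] [Module F D] [Coalgebra F D] [IsCocomm F D]

/-- A unipotent group-like element of a convolution algebra takes values in the subalgebra
generated by the primitive elements. -/
theorem apply_mem_primAlg_of_unipotent {N : WithConv (D →ₗ[F] K)} (hN : IsNilpotent N)
    (hg : convMap (Bialgebra.comulAlgHom F K) (1 + N) =
      convMap Algebra.TensorProduct.includeLeft (1 + N) *
        convMap Algebra.TensorProduct.includeRight (1 + N)) (d : D) :
    (1 + N) d ∈ primAlg F K := by
  obtain ⟨P, hP⟩ := exists_polynomial_eval_eq_pow F hN
  have hmul : ∀ p q : WithConv (D →ₗ[F] K), (∀ d, p d ∈ primAlg F K) → (∀ d, q d ∈ primAlg F K) →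
      ∀ d, (p * q) d ∈ primAlg F K := fun p q hp hq =>
    convMul_apply_mem (M := Subalgebra.toSubmodule (primAlg F K)) p q fun x y =>
      Subalgebra.mul_mem _ (hp x) (hq y)
  -- `P.coeff 1` is the logarithm of the group-like element `1 + N`. Its image under `Δ` is the sum
  -- of its two inclusions, so its values are primitive.
  have h1 : ∀ d, P.coeff 1 d ∈ primAlg F K := fun d => by
    refine Algebra.subset_adjoin ?_
    have := map_coeff_one_of_eval_eq_pow F hP (convMap (Bialgebra.comulAlgHom F K))
      (convMap Algebra.TensorProduct.includeLeft) (convMap Algebra.TensorProduct.includeRight)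
      (convMul_comm_of_commute _ _ fun x y => includeLeft_commute_includeRight _ _) hg
    have h := LinearMap.congr_fun (congrArg WithConv.ofConv this) d
    rw [add_comm] at h
    exact h
  have hall : ∀ i d, P.coeff i d ∈ primAlg F K := fun i => by
    induction i with
    | zero =>
      intro d
      rw [coeff_zero_of_eval_eq_pow hP, LinearMap.convOne_apply]
      exact Subalgebra.algebraMap_mem _ _
    | succ i ih =>
      intro d
      have h0 : ((i : F) + 1) ≠ 0 := by exact_mod_cast i.succ_ne_zero
      have := coeff_succ_of_eval_eq_pow F hP i
      rw [← inv_smul_smul₀ h0 (P.coeff (i + 1)), this]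
      exact Subalgebra.smul_mem _ (hmul _ _ ih h1 d) _
  -- Evaluation at the exponent `1` recovers `1 + N` as the sum of the coefficients.
  have h2 := hP 1
  rw [pow_one, Nat.cast_one, Polynomial.eval_eq_sum_range] at h2
  rw [← h2, WithConv.ofConv_sum, LinearMap.sum_apply]
  refine Subalgebra.sum_mem _ fun i _ => ?_
  rw [one_pow, mul_one]
  exact hall i d

/-- View `j` as an element `X` of the convolution algebra and split it by the idempotents `e m` of
the dual algebra. Each maximal ideal is evaluation at a group-like `g`. Dividing by `j g` leaves a
block that is group-like and unipotent, so it takes values in `primAlg`; multiplying back by `j g`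
gives elements of `hopfSpan`. -/
theorem apply_mem_hopfSpan [FiniteDimensional F D] (hD : IsPointed F D) (j : D →ₗc[F] K) (d : D) :
    j d ∈ hopfSpan F K := by
  have : Module.Finite F (WithConv (D →ₗ[F] F)) :=
    Module.Finite.equiv (WithConv.linearEquiv F (D →ₗ[F] F)).symm
  have : IsArtinianRing (WithConv (D →ₗ[F] F)) := IsArtinianRing.of_finite F _
  have := Fintype.ofFinite (MaximalSpectrum (WithConv (D →ₗ[F] F)))
  obtain ⟨e, he1, hei, hen⟩ := exists_idempotents (R := WithConv (D →ₗ[F] F))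
  let X : WithConv (D →ₗ[F] K) := WithConv.toConv (j : D →ₗ[F] K)
  have hX : X = ∑ m, convScalar F D K (e m) * X := by
    rw [← Finset.sum_mul, ← map_sum, he1, map_one, one_mul]
  change X d ∈ _
  rw [hX, WithConv.ofConv_sum, LinearMap.sum_apply]
  refine Submodule.sum_mem _ fun m _ => ?_
  have := m.isMaximal
  obtain ⟨g, hg, hgm⟩ := exists_isGroupLikeElem_of_isMaximal hD m.asIdeal
  have hjg : IsGroupLikeElem F (j g) := hg.map j
  set k := HopfAlgebra.antipode F (j g) with hk
  have hkg : IsGroupLikeElem F k := hjg.antipode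
  set G := X * convConst F D k with hG
  -- `G` takes the value `1` at `g`, so every coordinate functional of `G - 1` vanishes there.
  -- Multiplication by `e m` then moves these functionals into the nilradical.
  have hmem : G - 1 ∈ convIdeal K m.asIdeal := mem_convIdeal fun l => by
    rw [hgm]
    simp only [LinearMap.comp_apply, WithConv.ofConv_sub, LinearMap.sub_apply]
    rw [hG, mul_convConst_apply, LinearMap.convOne_apply, hg.counit_eq_one, map_one]
    change l (j g * k - 1) = 0
    rw [hk, hjg.mul_antipode_cancel, sub_self, map_zero]
  have hnil : IsNilpotent (convScalar F D K (e m) * (G - 1)) :=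
    isNilpotent_of_mem_convIdeal IsArtinianRing.isNilpotent_nilradical
      (convScalar_mul_mem_convIdeal (hen m) hmem)
  have hTX : convMap (Bialgebra.comulAlgHom F K) X =
      convMap Algebra.TensorProduct.includeLeft X *
        convMap Algebra.TensorProduct.includeRight X := by
    ext d
    rw [convMap_apply, Bialgebra.comulAlgHom_apply, LinearMap.convMul_apply]
    change comul (j d) = _
    rw [← CoalgHomClass.map_comp_comul_apply]
    generalize comul (R := F) d = t
    induction t with
    | zero => simp
    | add x y hx hy => simp only [map_add, hx, hy]
    | tmul x y => simp [X]
  have hTk : convMap (Bialgebra.comulAlgHom F K) (convConst F D k) =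
      convMap Algebra.TensorProduct.includeLeft (convConst F D k) *
        convMap Algebra.TensorProduct.includeRight (convConst F D k) := by
    have h1 : ∀ f : K →ₐ[F] K ⊗[F] K, convMap f (convConst F D k) = convConst F D (f k) :=
      fun f => by ext d; simp
    rw [h1, h1, h1, convConst_mul]
    simp [hkg.comul_eq_tmul_self]
  have hcomm : ∀ p q : WithConv (D →ₗ[F] K),
      Commute (convMap (Algebra.TensorProduct.includeLeft : K →ₐ[F] K ⊗[F] K) p)
        (convMap (Algebra.TensorProduct.includeRight : K →ₐ[F] K ⊗[F] K) q) := fun p q =>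
    convMul_comm_of_commute _ _ fun x y => includeLeft_commute_includeRight _ _
  have hTG : convMap (Bialgebra.comulAlgHom F K) G =
      convMap Algebra.TensorProduct.includeLeft G *
        convMap Algebra.TensorProduct.includeRight G := by
    rw [hG, map_mul, hTX, hTk, map_mul, map_mul]
    exact (hcomm _ _).symm.mul_mul_mul_comm _ _
  -- For a central idempotent `E`, `(1 + E (a - 1)) (1 + E (b - 1)) = 1 + E (a b - 1)`. So
  -- truncation to one block keeps the group-like property of `G`.
  have hTY := apply_mem_primAlg_of_unipotent hnil (by
    simp only [map_add, map_mul, map_sub, map_one, convMap_convScalar, hTG]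
    set E := convScalar F D (K ⊗[F] K) (e m) with hE
    have hEE : E * E = E := by rw [hE, ← map_mul, hei]
    generalize convMap (Algebra.TensorProduct.includeRight : K →ₐ[F] K ⊗[F] K) G = b
    have hc := convScalar_commute (e m) 
      (convMap (Algebra.TensorProduct.includeLeft : K →ₐ[F] K ⊗[F] K) G - 1)
    rw [← hE] at hc
    generalize convMap (Algebra.TensorProduct.includeLeft : K →ₐ[F] K ⊗[F] K) G = a at hc ⊢
    have : E * (a - 1) * (E * (b - 1)) = E * ((a - 1) * (b - 1)) := by
      rw [hc.eq, mul_assoc, ← mul_assoc E E, hEE, ← mul_assoc, ← hc.eq, mul_assoc]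
    rw [add_mul, mul_add, mul_add, this]
    noncomm_ring)
  have hfin : convScalar F D K (e m) * X =
      convScalar F D K (e m) * (1 + convScalar F D K (e m) * (G - 1)) * convConst F D (j g) := by
    have hGg : G * convConst F D (j g) = X := by
      rw [hG, mul_assoc, convConst_mul, hk, hjg.antipode_mul_cancel, convConst_one, mul_one]
    have hEE : convScalar F D K (e m) * convScalar F D K (e m) = convScalar F D K (e m) := by
      rw [← map_mul, hei]
    rw [mul_add, mul_one, ← mul_assoc, hEE, mul_sub, mul_one, add_sub_cancel, mul_assoc, hGg]
  rw [hfin, mul_convConst_apply]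
  refine Submodule.subset_span ⟨_, ?_, j g, hjg, rfl⟩
  refine convMul_apply_mem (M := Subalgebra.toSubmodule (primAlg F K)) _ _ (fun x y => ?_) d
  exact Subalgebra.mul_mem _ (Subalgebra.algebraMap_mem _ _) (hTY y)

variable (F K) in
/-- A pointed cocommutative Hopf algebra in characteristic zero is generated by its primitive
and group-like elements. -/
theorem hopfSpan_eq_top [IsCocomm F K] (hK : IsPointed F K) : hopfSpan F K = ⊤ := by
  refine eq_top_iff.2 fun x _ => ?_
  obtain ⟨W, hW, _, hx⟩ := exists_finiteDimensional_isSubcoalgebra (F := F) x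
  let := subcoalgebra W hW
  have := subcoalgebra_isCocomm W hW
  exact apply_mem_hopfSpan (hK.of_injective (subcoalgebraIncl W hW) W.injective_subtype)
    (subcoalgebraIncl W hW) ⟨x, hx⟩

end Generation

end BarbaschSahi

namespace BarbaschSahi

open Coalgebra

/-! ### Structure of double covers of Hopf algebras. -/

section DoubleCover

variable {F : Type*} [Field F] {K : Type*} [Ring K] [HopfAlgebra F K]
  {H : Type*} [Ring H] [HopfAlgebra F H]

theorem IsPrimitive.conj {z y : K} (hz : IsGroupLikeElem F z) (hzz : z * z = 1)
    (hy : IsPrimitive F y) : IsPrimitive F (z * y * z) := by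
  rw [IsPrimitive] at *
  rw [Bialgebra.comul_mul, Bialgebra.comul_mul, hz.comul_eq_tmul_self, hy]
  simp [mul_add, add_mul, hzz]

/-- The functional on `H × H` which is the counit on the first summand is idempotent. -/
theorem counit_fst_mul_self {H : Type*} [AddCommGroup H] [Module F H] [Coalgebra F H] :
    (WithConv.toConv (counit ∘ₗ LinearMap.fst F H H) : WithConv (H × H →ₗ[F] F)) *
      WithConv.toConv (counit ∘ₗ LinearMap.fst F H H) =
      WithConv.toConv (counit ∘ₗ LinearMap.fst F H H) := by
  refine WithConv.ofConv_injective (LinearMap.ext fun x => ?_)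
  rw [LinearMap.convMul_apply, Prod.comul_apply]
  obtain ⟨a, b⟩ := x
  have h1 : ∀ t : H ⊗[F] H, LinearMap.mul' F F (TensorProduct.map
      (counit ∘ₗ LinearMap.fst F H H) (counit ∘ₗ LinearMap.fst F H H)
      (TensorProduct.map (LinearMap.inl F H H) (LinearMap.inl F H H) t)) =
      counit (R := F) (TensorProduct.rid F H (counit.lTensor H t)) := fun t => by
    induction t with
    | zero => simp
    | add x y hx hy => simp only [map_add, hx, hy]
    | tmul x y => simp [mul_comm]
  have h2 : ∀ t : H ⊗[F] H, LinearMap.mul' F F (TensorProduct.map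
      (counit ∘ₗ LinearMap.fst F H H) (counit ∘ₗ LinearMap.fst F H H)
      (TensorProduct.map (LinearMap.inr F H H) (LinearMap.inr F H H) t)) = 0 := fun t => by
    induction t with
    | zero => simp
    | add x y hx hy => simp only [map_add, hx, hy, add_zero]
    | tmul x y => simp
  simp only [map_add]
  rw [h1, h2, lTensor_counit_comul]
  simp

/-- Multiplication by a primitive element is a derivation of the dual algebra, so it kills
idempotents. -/
theorem apply_primitive_mul_eq_zero [IsCocomm F K] {χ : WithConv (K →ₗ[F] F)} (hχ : χ * χ = χ)
    {y : K} (hy : IsPrimitive F y) (x : K) : χ (y * x) = 0 := by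
  let δ : WithConv (K →ₗ[F] F) := WithConv.toConv (χ.ofConv ∘ₗ LinearMap.mulLeft F y)
  have h1 : δ = χ * δ + δ * χ := by
    ext x
    change χ (y * x) = (χ * δ) x + (δ * χ) x
    conv_lhs => rw [← hχ]
    rw [LinearMap.convMul_apply, LinearMap.convMul_apply, LinearMap.convMul_apply,
      Bialgebra.comul_mul, show comul (R := F) y = _ from hy]
    generalize comul (R := F) x = t
    induction t with
    | zero => simp
    | add x y hx hy =>
      simp only [map_add, mul_add, hx, hy]
      abel
    | tmul x y => simp [δ, add_mul]
  -- Multiplying `δ = χ δ + δ χ` by the idempotent `χ` gives `χ δ = 2 χ δ`.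
  have h2 : χ * δ = 0 := by
    have h3 := congrArg (χ * ·) h1
    simp only [mul_add] at h3
    rw [mul_comm δ χ, ← mul_assoc, hχ] at h3
    simpa using h3
  have h3 : δ = 0 := by rw [h1, mul_comm δ χ, h2, add_zero]
  exact LinearMap.congr_fun (congrArg WithConv.ofConv h3) x

/-- For the idempotent of a double cover, `hit χ` projects to one copy of `H`. Since `χ` vanishes on
multiples of primitive elements, multiplication by `primAlg` commutes with this projection and does
not change the copy. -/
theorem hit_primAlg_mul [IsCocomm F K] {χ : WithConv (K →ₗ[F] F)} (hχ : χ * χ = χ)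
    {u : K} (hu : u ∈ primAlg F K) (x : K) :
    hit χ.ofConv (u * x) = u * hit χ.ofConv x := by
  induction hu using Algebra.adjoin_induction generalizing x with
  | mem y hy =>
    rw [hit, LinearMap.comp_apply, LinearMap.comp_apply, Bialgebra.comul_mul,
      show comul (R := F) y = _ from hy]
    generalize comul (R := F) x = t
    induction t with
    | zero => simp
    | add x y hx hy => simp only [map_add, mul_add, hx, hy]
    | tmul a b => simp [add_mul, apply_primitive_mul_eq_zero hχ hy]
  | algebraMap r => simp [← Algebra.smul_def]
  | add a b _ _ ha hb => rw [add_mul, map_add, ha, hb, add_mul]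
  | mul a b _ _ ha hb => rw [mul_assoc, ha, hb, mul_assoc]

/-- The two coalgebra sections of a double cover, with the first one through `1`. -/
theorem exists_sections (π : K →ₐc[F] H) (e : (H × H) ≃ₗc[F] K)
    (h₁ : Function.Bijective (fun h : H => π (e (h, 0))))
    (h₂ : Function.Bijective (fun h : H => π (e (0, h)))) :
    ∃ (σ σ' : H →ₗc[F] K) (χ : WithConv (K →ₗ[F] F)), (∀ h, π (σ h) = h) ∧ (∀ h, π (σ' h) = h) ∧
      χ * χ = χ ∧ (∀ h, χ (σ h) = counit (R := F) h) ∧ (∀ h, χ (σ' h) = 0) ∧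
      (∀ x, ∃ a b, x = σ a + σ' b) ∧ χ 1 = 1 := by
  -- A coalgebra map whose composite with `π` is bijective becomes a section after precomposition
  -- with the inverse of that composite.
  have key : ∀ s : H →ₗc[F] K, Function.Bijective (fun h => π (s h)) →
      ∃ v : H ≃ₗc[F] H, ∀ h, π (s (v h)) = h := by
    intro s hs
    let u : H →ₗc[F] H := (π : K →ₗc[F] H).comp s
    let v := CoalgEquiv.ofBijective (f := u) hs
    exact ⟨v.symm, fun h => v.apply_symm_apply h⟩
  let i₁ : H →ₗc[F] (H × H) :=
    { LinearMap.inl F H H with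
      counit_comp := Prod.counit_comp_inl F H H
      map_comp_comul := (Prod.comul_comp_inl F H H).symm }
  let i₂ : H →ₗc[F] (H × H) :=
    { LinearMap.inr F H H with
      counit_comp := Prod.counit_comp_inr F H H
      map_comp_comul := (Prod.comul_comp_inr F H H).symm }
  obtain ⟨v₁, hv₁⟩ := key ((e : (H × H) →ₗc[F] K).comp i₁) h₁
  obtain ⟨v₂, hv₂⟩ := key ((e : (H × H) →ₗc[F] K).comp i₂) h₂
  let s₁ : H →ₗc[F] K := ((e : (H × H) →ₗc[F] K).comp i₁).comp (v₁ : H →ₗc[F] H)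
  let s₂ : H →ₗc[F] K := ((e : (H × H) →ₗc[F] K).comp i₂).comp (v₂ : H →ₗc[F] H)
  have e₁ : ∀ h, s₁ h = e (v₁ h, 0) := fun h => rfl
  have e₂ : ∀ h, s₂ h = e (0, v₂ h) := fun h => rfl
  let χ : WithConv (K →ₗ[F] F) :=
    WithConv.toConv ((counit ∘ₗ LinearMap.fst F H H) ∘ₗ (e.symm : K →ₗc[F] (H × H)).toLinearMap)
  have hχ : χ * χ = χ := by
    apply WithConv.ofConv_injective
    have := LinearMap.convMul_comp_coalgHom_distrib
      (WithConv.toConv (counit ∘ₗ LinearMap.fst F H H) : WithConv (H × H →ₗ[F] F))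
      (WithConv.toConv (counit ∘ₗ LinearMap.fst F H H)) (e.symm : K →ₗc[F] (H × H))
    rw [counit_fst_mul_self] at this
    exact this.symm
  have hχ₁ : ∀ h, χ (s₁ h) = counit (R := F) h := fun h => by
    have : χ (s₁ h) = counit (R := F) (e.symm (e (v₁ h, 0))).1 := rfl
    rw [this, CoalgEquiv.symm_apply_apply]
    exact CoalgHomClass.counit_comp_apply v₁ h
  have hχ₂ : ∀ h, χ (s₂ h) = 0 := fun h => by
    have : χ (s₂ h) = counit (R := F) (e.symm (e (0, v₂ h))).1 := rfl
    rw [this, CoalgEquiv.symm_apply_apply, map_zero]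
  have hsum : ∀ x, ∃ a b, x = s₁ a + s₂ b := fun x => by
    refine ⟨v₁.symm (e.symm x).1, v₂.symm (e.symm x).2, ?_⟩
    rw [e₁, e₂, CoalgEquiv.apply_symm_apply, CoalgEquiv.apply_symm_apply, ← map_add]
    simp
  have h1 : χ 1 = 0 ∨ χ 1 = 1 := by
    have := LinearMap.congr_fun (congrArg WithConv.ofConv hχ) 1
    rw [LinearMap.convMul_apply, Bialgebra.comul_one] at this
    have h : χ 1 * χ 1 = χ 1 := by simpa [Algebra.TensorProduct.one_def] using this
    rcases eq_or_ne (χ 1) 0 with h0 | h0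
    · exact Or.inl h0
    · exact Or.inr (mul_left_cancel₀ h0 (by rw [h, mul_one]))
  -- If the unit lies on the second copy, the copies are exchanged and `χ` is replaced by `1 - χ`.
  rcases h1 with h1 | h1
  · refine ⟨s₂, s₁, 1 - χ, hv₂, hv₁, ?_, fun h => ?_, fun h => ?_, fun x => ?_, ?_⟩
    · rw [mul_sub, sub_mul, sub_mul, hχ]; simp
    · simp [hχ₂]
    · simp [hχ₁]
    · obtain ⟨a, b, h⟩ := hsum x
      exact ⟨b, a, by rw [h, add_comm]⟩
    · simp [h1]
  · exact ⟨s₁, s₂, χ, hv₁, hv₂, hχ, hχ₁, hχ₂, hsum, h1⟩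

/-- In a double cover `K` of `H`, there is a central group-like element `z` of order two such that
`K = σ(H) + z σ(H)` for a coalgebra section `σ`. -/
theorem exists_splitting [CharZero F] [IsCocomm F K] [IsCocomm F H] (hK : IsPointed F K)
    (π : K →ₐc[F] H) (e : (H × H) ≃ₗc[F] K)
    (h₁ : Function.Bijective (fun h : H => π (e (h, 0))))
    (h₂ : Function.Bijective (fun h : H => π (e (0, h)))) :
    ∃ (σ : H →ₗc[F] K) (z : K), (∀ h, π (σ h) = h) ∧ σ 1 = 1 ∧ IsGroupLikeElem F z ∧ π z = 1 ∧
      z * z = 1 ∧ (∀ x, z * x = x * z) ∧ ∀ x, ∃ a b, x = σ a + z * σ b := by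
  obtain ⟨σ, σ', χ, hσ, hσ', hχ, hχσ, hχσ', hsum, hχ1⟩ := exists_sections π e h₁ h₂
  have hq : ∀ a, hit χ.ofConv (σ a) = σ a := fun a => by
    rw [hit_map, show χ.ofConv ∘ₗ (σ : H →ₗ[F] K) = counit from LinearMap.ext hχσ, hit_counit]
  have hq' : ∀ a, hit χ.ofConv (σ' a) = 0 := fun a => by
    rw [hit_map, show χ.ofConv ∘ₗ (σ' : H →ₗ[F] K) = 0 from LinearMap.ext hχσ']
    simp [hit, slice]
  -- `hit χ` is the projection onto `σ(H)` along `σ'(H)`. An element fixed by it is determined by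
  -- its image under `π`, and likewise one killed by it.
  have hfix : ∀ x, hit χ.ofConv x = x → x = σ (π x) := fun x hx => by
    obtain ⟨a, b, rfl⟩ := hsum x
    rw [map_add, hq, hq', add_zero] at hx
    rw [← hx, hσ]
  have hker : ∀ x, hit χ.ofConv x = 0 → x = σ' (π x) := fun x hx => by
    obtain ⟨a, b, rfl⟩ := hsum x
    rw [map_add, hq, hq', add_zero] at hx
    rw [hx, zero_add, hσ']
  have hitg : ∀ g, IsGroupLikeElem F g → hit χ.ofConv g = χ g • g := fun g hg => by
    rw [hit, LinearMap.comp_apply, hg.comul_eq_tmul_self, slice_tmul]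
  have hg01 : ∀ g, IsGroupLikeElem F g → χ g = 0 ∨ χ g = 1 := fun g hg => by
    have := LinearMap.congr_fun (congrArg WithConv.ofConv hχ) g
    rw [LinearMap.convMul_apply, hg.comul_eq_tmul_self] at this
    have h : χ g * χ g = χ g := by simpa using this
    rcases eq_or_ne (χ g) 0 with h0 | h0
    · exact Or.inl h0
    · exact Or.inr (mul_left_cancel₀ h0 (by rw [h, mul_one]))
  have hgl : ∀ g, IsGroupLikeElem F g → (χ g = 1 ∧ g = σ (π g)) ∨ (χ g = 0 ∧ g = σ' (π g)) := by
    intro g hg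
    rcases hg01 g hg with h | h
    · exact Or.inr ⟨h, hker g (by rw [hitg g hg, h, zero_smul])⟩
    · exact Or.inl ⟨h, hfix g (by rw [hitg g hg, h, one_smul])⟩
  have hσ1 : σ 1 = 1 := by
    rcases hgl 1 .one with ⟨_, h⟩ | ⟨h, _⟩
    · rw [map_one] at h; exact h.symm
    · rw [hχ1] at h; exact absurd h one_ne_zero
  set z := σ' 1 with hz
  have hzg : IsGroupLikeElem F z := IsGroupLikeElem.one.map σ'
  have hπz : π z = 1 := hσ' 1
  have hz1 : z ≠ 1 := fun h => by
    have := hχσ' 1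
    rw [← hz, h, hχ1] at this
    exact one_ne_zero this
  -- The group-likes over `1` are exactly `1` and `z`. As `z ≠ 1`, this forces `z * z = 1` and shows
  -- that every conjugate of `z` by a group-like is `z`.
  have hone : ∀ g, IsGroupLikeElem F g → π g = 1 → g = 1 ∨ g = z := by
    intro g hg hπ
    rcases hgl g hg with ⟨_, h⟩ | ⟨_, h⟩
    · rw [hπ, hσ1] at h; exact Or.inl h
    · rw [hπ] at h; exact Or.inr h
  have hzz : z * z = 1 := by
    rcases hone (z * z) (hzg.mul hzg) (by rw [map_mul, hπz, one_mul]) with h | h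
    · exact h
    · exact absurd (hzg.isUnit.mul_left_cancel (by rw [h, mul_one])) hz1
  have hcg : ∀ g, IsGroupLikeElem F g → z * g = g * z := by
    intro g hg
    have hgi := hg.mul_antipode_cancel
    have hig := hg.antipode_mul_cancel
    rcases hone (g * z * HopfAlgebra.antipode F g) ((hg.mul hzg).mul hg.antipode)
      (by rw [map_mul, map_mul, hπz, mul_one, ← map_mul, hgi, map_one]) with h | h
    · have h' := congrArg (· * g) h
      simp only [mul_assoc, hig, mul_one, one_mul] at h'
      exact absurd (hg.isUnit.mul_left_cancel (by rw [h', mul_one])) hz1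
    · have h' := congrArg (· * g) h
      simp only [mul_assoc, hig, mul_one] at h'
      exact h'.symm
  have hprim : ∀ y, IsPrimitive F y → y = σ (π y) := fun y hy => hfix y (by
    have h0 := apply_primitive_mul_eq_zero hχ hy 1
    rw [mul_one] at h0
    rw [hit, LinearMap.comp_apply, show comul (R := F) y = _ from hy, map_add, slice_tmul,
      slice_tmul, h0, hχ1, zero_smul, one_smul, zero_add])
  have hcp : ∀ y, IsPrimitive F y → z * y = y * z := by
    intro y hy
    -- `z y z` is again primitive with the same image under `π`, and a primitive element is
    -- determined by its image.
    have h : z * y * z = y := by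
      rw [hprim _ (hy.conj hzg hzz), map_mul π, map_mul π, hπz, one_mul, mul_one, ← hprim y hy]
    calc z * y = z * y * (z * z) := by rw [hzz, mul_one]
      _ = z * y * z * z := by rw [mul_assoc (z * y)]
      _ = y * z := by rw [h]
  have hcu : ∀ u ∈ primAlg F K, z * u = u * z := by
    intro u hu
    induction hu using Algebra.adjoin_induction with
    | mem y hy => exact hcp y hy
    | algebraMap r => exact (Algebra.commutes r z).symm
    | add a b _ _ ha hb => rw [mul_add, ha, hb, add_mul]
    | mul a b _ _ ha hb => rw [← mul_assoc, ha, mul_assoc, hb, mul_assoc]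
  refine ⟨σ, z, hσ, hσ1, hzg, hπz, hzz, fun x => ?_, fun x => ?_⟩
  · have hx : x ∈ hopfSpan F K := by rw [hopfSpan_eq_top F K hK]; trivial
    induction hx using Submodule.span_induction with
    | mem x hx =>
      obtain ⟨u, hu, g, hg, rfl⟩ := hx
      rw [← mul_assoc, hcu u hu, mul_assoc, hcg g hg, mul_assoc]
    | zero => simp
    | add a b _ _ ha hb => rw [mul_add, ha, hb, add_mul]
    | smul c a _ ha => rw [mul_smul_comm, ha, smul_mul_assoc]
  · have hx : x ∈ hopfSpan F K := by rw [hopfSpan_eq_top F K hK]; trivial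
    induction hx using Submodule.span_induction with
    | mem x hx =>
      obtain ⟨u, hu, g, hg, rfl⟩ := hx
      have hug : ∀ g, IsGroupLikeElem F g → χ g = 1 → u * g = σ (π (u * g)) := fun g hg h =>
        hfix _ (by rw [hit_primAlg_mul hχ hu, hitg g hg, h, one_smul])
      rcases hgl g hg with ⟨h, _⟩ | ⟨_, h⟩
      · exact ⟨π (u * g), 0, by rw [map_zero, mul_zero, add_zero]; exact hug g hg h⟩
      -- If `g` lies on the second copy then `z g` lies on the first: on the second both would be
      -- `σ' (π g)`, giving `z = 1`.
      · rcases hgl (z * g) (hzg.mul hg) with ⟨h', _⟩ | ⟨_, h'⟩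
        · refine ⟨0, π (u * (z * g)), ?_⟩
          rw [map_zero, zero_add, ← hug (z * g) (hzg.mul hg) h', ← mul_assoc, ← mul_assoc,
            hcu u hu, mul_assoc u, hzz, mul_one]
        · rw [map_mul, hπz, one_mul, ← h] at h'
          have h2 := congrArg (· * HopfAlgebra.antipode F g) h'
          simp only [mul_assoc, hg.mul_antipode_cancel, mul_one] at h2
          exact absurd h2 hz1
    | zero => exact ⟨0, 0, by simp⟩
    | add x y _ _ hx hy =>
      obtain ⟨a, b, rfl⟩ := hx
      obtain ⟨a', b', rfl⟩ := hy
      exact ⟨a + a', b + b', by rw [map_add, map_add, mul_add]; abel⟩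
    | smul c x _ hx =>
      obtain ⟨a, b, rfl⟩ := hx
      exact ⟨c • a, c • b, by rw [map_smul, map_smul, mul_smul_comm, smul_add]⟩

end DoubleCover

end BarbaschSahi

namespace BarbaschSahi

/-! ### Annihilating polynomials of sums of commuting idempotents. -/

section IdempotentSums

open Polynomial

variable {F R : Type*} [Field F] [Ring R] [Algebra F R]

theorem aeval_mul_eq_of_mul_eq {T E M : R} (hE : Commute E M) (h : T * M = E * M) (p : F[X]) :
    aeval T p * M = aeval E p * M := by
  have hn : ∀ n : ℕ, T ^ n * M = E ^ n * M := fun n => by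
    induction n with
    | zero => simp
    | succ n ih => rw [pow_succ, mul_assoc, h, hE.eq, ← mul_assoc, ih, mul_assoc, ← hE.eq,
        ← mul_assoc, pow_succ]
  induction p using Polynomial.induction_on' with
  | add p q hp hq => rw [map_add, add_mul, hp, hq, map_add, add_mul]
  | monomial n a => rw [aeval_monomial, aeval_monomial, mul_assoc, hn, mul_assoc]

/-- A sum of commuting idempotents is annihilated by a polynomial without negative integral
roots. -/
theorem exists_polynomial_aeval_sum_eq_zero {κ : Type*} (N : κ → R)
    (hN : ∀ k, N k * N k = N k) (hc : ∀ k l, Commute (N k) (N l)) (s : Finset κ) [CharZero F] :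
    ∃ p : F[X], aeval (∑ k ∈ s, N k) p = 0 ∧ ∀ n : ℕ, 1 ≤ n → p.eval (-(n : F)) ≠ 0 := by
  classical
  induction s using Finset.induction_on with
  | empty => exact ⟨X, by simp, fun n hn => by
      rw [eval_X, neg_ne_zero]; exact_mod_cast Nat.one_le_iff_ne_zero.1 hn⟩
  | insert k s hk ih =>
    obtain ⟨p, hp, hpn⟩ := ih
    -- The new sum acts as `E` on the range of `1 - N k` and as `E + 1` on that of `N k`, so `p(X)
    -- p(X - 1)` annihilates it. At `-n` the second factor is `p(-(n + 1))`, again nonzero.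
    refine ⟨p * p.comp (X - C 1), ?_, fun n hn => ?_⟩
    · set E := ∑ l ∈ s, N l with hE
      have hEk : Commute E (N k) := Commute.sum_left _ _ _ fun l _ => hc l k
      rw [Finset.sum_insert hk, ← hE, add_comm]
      have h1 : aeval (E + N k) p * (1 - N k) = 0 := by
        rw [aeval_mul_eq_of_mul_eq (E := E) ((Commute.one_right E).sub_right hEk) _ p, hp,
          zero_mul]
        rw [add_mul, mul_sub (N k), mul_one, hN, sub_self, add_zero]
      have h2 : aeval (E + N k) (p.comp (X - C 1)) * N k = 0 := by
        rw [aeval_comp, aeval_mul_eq_of_mul_eq hEk _ p, hp, zero_mul]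
        simp [add_mul, sub_mul, hN]
      have h3 : aeval (E + N k) (p * p.comp (X - C 1)) * N k = 0 := by
        rw [map_mul, mul_assoc, h2, mul_zero]
      have h4 : aeval (E + N k) (p * p.comp (X - C 1)) * (1 - N k) = 0 := by
        rw [mul_comm p, map_mul, mul_assoc, h1, mul_zero]
      calc _ = aeval (E + N k) (p * p.comp (X - C 1)) * N k +
          aeval (E + N k) (p * p.comp (X - C 1)) * (1 - N k) := by noncomm_ring
        _ = 0 := by rw [h3, h4, add_zero]
    · rw [eval_mul, eval_comp]
      refine mul_ne_zero (hpn n hn) ?_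
      have := hpn (n + 1) (by omega)
      rwa [eval_sub, eval_X, eval_C, ← neg_add', ← Nat.cast_succ]

end IdempotentSums

section RingIdentities

variable {R : Type*} [Ring R]

theorem sub_mul_sub_add_swap (a a' c c' : R) : (a - c) * (a' - c') + (a' - c') * (a - c) =
    (a * a' + a' * a) + (c * c' + c' * c) - (a * c' + c' * a) - (a' * c + c * a') := by
  noncomm_ring

theorem add_mul_add_add_swap (a a' c c' : R) : (a + c) * (a' + c') + (a' + c') * (a + c) =
    (a * a' + a' * a) + (c * c' + c' * c) + (a * c' + c' * a) + (a' * c + c * a') := by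
  noncomm_ring

theorem sub_mul_add_add_swap (a a' c c' : R) : (a - c) * (a' + c') + (a' + c') * (a - c) =
    (a * a' + a' * a) - (c * c' + c' * c) + (a * c' + c' * a) - (a' * c + c * a') := by
  noncomm_ring

theorem mul_mul_comm_of_anticomm {w c x : R} (h₁ : c * x = -(x * c)) (h₂ : w * x = -(x * w)) :
    w * c * x = x * (w * c) := by
  rw [mul_assoc, h₁, mul_neg, ← mul_assoc, h₂, neg_mul, neg_neg, mul_assoc]

end RingIdentities

/-! ### The Clifford algebra with contraction and exterior multiplication operators. -/

section Clifford

variable {F : Type*} [Field F] {V : Type*} [AddCommGroup V] [Module F V]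
  (B : LinearMap.BilinForm F V)

local notation "iv" => CliffordAlgebra.ι (LinearMap.BilinMap.toQuadraticMap B)

/-- Left multiplication by vectors on the Clifford algebra. -/
def vecLeft : V →ₗ[F] Module.End F (Cliff B) := LinearMap.mul F (Cliff B) ∘ₗ iv

/-- The signed right multiplication by vectors on the Clifford algebra, `c ↦ α(c) v`. -/
def vecRight : V →ₗ[F] Module.End F (Cliff B) :=
  (LinearMap.lcomp F (Cliff B) (CliffordAlgebra.involute (Q := B.toQuadraticMap)).toLinearMap) ∘ₗ
    (LinearMap.mul F (Cliff B)).flip ∘ₗ iv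

/-- Contraction with a vector on the Clifford algebra. -/
def contr : V →ₗ[F] Module.End F (Cliff B) := (2 : F)⁻¹ • (vecLeft B - vecRight B)

/-- Exterior multiplication with a vector on the Clifford algebra. -/
def wedge : V →ₗ[F] Module.End F (Cliff B) := (2 : F)⁻¹ • (vecLeft B + vecRight B)

@[simp] theorem vecLeft_apply (v : V) (c : Cliff B) : vecLeft B v c = iv v * c := rfl

@[simp] theorem vecRight_apply (v : V) (c : Cliff B) :
    vecRight B v c = CliffordAlgebra.involute c * iv v := rfl

theorem contr_apply (v : V) (c : Cliff B) :
    contr B v c = (2 : F)⁻¹ • (iv v * c - CliffordAlgebra.involute c * iv v) := rfl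

theorem wedge_apply (v : V) (c : Cliff B) :
    wedge B v c = (2 : F)⁻¹ • (iv v * c + CliffordAlgebra.involute c * iv v) := rfl

theorem contr_def (v : V) : contr B v = (2 : F)⁻¹ • (vecLeft B v - vecRight B v) := rfl

theorem wedge_def (v : V) : wedge B v = (2 : F)⁻¹ • (vecLeft B v + vecRight B v) := rfl

theorem contr_one (v : V) : contr B v 1 = 0 := by simp [contr_apply]

variable {B} (hB : B.IsSymm)

theorem iv_mul_iv_add_swap (hB : B.IsSymm) (v w : V) :
    iv v * iv w + iv w * iv v = algebraMap F (Cliff B) (2 * B v w) := by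
  rw [CliffordAlgebra.ι_mul_ι_add_swap]
  congr 1
  simp only [QuadraticMap.polar, LinearMap.BilinMap.toQuadraticMap_apply, map_add,
    LinearMap.add_apply]
  have := hB.eq v w
  rw [this]
  ring

theorem vecLeft_anticomm (hB : B.IsSymm) (v w : V) :
    vecLeft B v * vecLeft B w + vecLeft B w * vecLeft B v = (2 * B v w) • 1 := by
  refine LinearMap.ext fun c => ?_
  simp only [LinearMap.add_apply, Module.End.mul_apply, vecLeft_apply, LinearMap.smul_apply,
    Module.End.one_apply]
  rw [← mul_assoc, ← mul_assoc, ← add_mul, iv_mul_iv_add_swap hB, Algebra.smul_def]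

theorem vecRight_anticomm (hB : B.IsSymm) (v w : V) :
    vecRight B v * vecRight B w + vecRight B w * vecRight B v = -((2 * B v w) • 1) := by
  refine LinearMap.ext fun c => ?_
  simp only [LinearMap.add_apply, Module.End.mul_apply, vecRight_apply, LinearMap.smul_apply,
    Module.End.one_apply, map_mul, CliffordAlgebra.involute_involute, CliffordAlgebra.involute_ι,
    LinearMap.neg_apply]
  rw [mul_assoc, mul_assoc, neg_mul, neg_mul, ← mul_add, ← neg_add, add_comm (iv w * iv v),
    iv_mul_iv_add_swap hB, Algebra.smul_def, Algebra.commutes, mul_neg]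

theorem vecLeft_vecRight_anticomm (v w : V) :
    vecLeft B v * vecRight B w + vecRight B w * vecLeft B v = 0 := by
  refine LinearMap.ext fun c => ?_
  simp [mul_assoc]

variable [CharZero F]

/-- Left multiplications anticommute to `2 B`, signed right multiplications to `-2 B`, and the two
kinds anticommute with each other. In a half difference, as in a half sum, the contributions cancel.
-/
theorem contr_anticomm (hB : B.IsSymm) (v w : V) :
    contr B v * contr B w = - (contr B w * contr B v) := by
  have h1 := vecLeft_anticomm hB v w
  have h2 := vecRight_anticomm hB v w
  have h3 := vecLeft_vecRight_anticomm (B := B) v w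
  have h4 := vecLeft_vecRight_anticomm (B := B) w v
  rw [eq_neg_iff_add_eq_zero, contr_def, contr_def]
  simp only [smul_mul_smul_comm, ← smul_add]
  generalize vecLeft B v = a, vecLeft B w = a', vecRight B v = c, vecRight B w = c' at *
  rw [sub_mul_sub_add_swap, h1, h2, h3, h4]
  simp

theorem wedge_anticomm (hB : B.IsSymm) (v w : V) :
    wedge B v * wedge B w = - (wedge B w * wedge B v) := by
  have h1 := vecLeft_anticomm hB v w
  have h2 := vecRight_anticomm hB v w
  have h3 := vecLeft_vecRight_anticomm (B := B) v w
  have h4 := vecLeft_vecRight_anticomm (B := B) w v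
  rw [eq_neg_iff_add_eq_zero, wedge_def, wedge_def]
  simp only [smul_mul_smul_comm, ← smul_add]
  generalize vecLeft B v = a, vecLeft B w = a', vecRight B v = c, vecRight B w = c' at *
  rw [add_mul_add_add_swap, h1, h2, h3, h4]
  simp

/-- In the mixed product the contributions `2 B` and `-2 B` enter with opposite signs and add up to
`4 B / 4`. So `Cliff B` carries the operators of the exterior algebra without being identified with
it. -/
theorem contr_wedge (hB : B.IsSymm) (v w : V) :
    contr B v * wedge B w = B v w • 1 - wedge B w * contr B v := by
  have h1 := vecLeft_anticomm hB v w
  have h2 := vecRight_anticomm hB v w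
  have h3 := vecLeft_vecRight_anticomm (B := B) v w
  have h4 := vecLeft_vecRight_anticomm (B := B) w v
  rw [eq_sub_iff_add_eq, contr_def, wedge_def]
  simp only [smul_mul_smul_comm, ← smul_add]
  generalize vecLeft B v = a, vecLeft B w = a', vecRight B v = c, vecRight B w = c' at *
  rw [sub_mul_add_add_swap, h1, h2, h3, h4, sub_neg_eq_add, add_zero, sub_zero, ← add_smul, smul_smul]
  congr 1
  field_simp
  ring

theorem mul_self_eq_zero_of_anticomm {R : Type*} [Ring R] [Algebra F R] {x : R}
    (h : x * x = -(x * x)) : x * x = 0 := by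
  have h2 : (2 : F) • (x * x) = 0 := by
    rw [two_smul]
    nth_rw 1 [h]
    simp
  exact (smul_eq_zero.1 h2).resolve_left two_ne_zero

section Basis

variable {κ : Type*} [Fintype κ] [DecidableEq κ] (b : Module.Basis κ F V)
  (hn : B.Nondegenerate)

/-- The summand of the degree operator belonging to a basis vector. -/
def degPart (k : κ) : Module.End F (Cliff B) := wedge B (b k) * contr B (B.dualBasis hn b k)

/-- The exterior degree operator on the Clifford algebra. -/
def degC : Module.End F (Cliff B) := ∑ k, degPart b hn k

theorem contr_wedge_basis (hB : B.IsSymm) (i j : κ) :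
    contr B (B.dualBasis hn b i) * wedge B (b j) =
      (if j = i then 1 else 0) - wedge B (b j) * contr B (B.dualBasis hn b i) := by
  rw [contr_wedge hB, LinearMap.BilinForm.apply_dualBasis_left]
  congr 1
  split_ifs <;> simp

theorem degPart_mul_wedge_of_ne (hB : B.IsSymm) {i j : κ} (h : j ≠ i) :
    degPart b hn i * wedge B (b j) = wedge B (b j) * degPart b hn i :=
  mul_mul_comm_of_anticomm
    (by rw [contr_wedge_basis b hn hB, if_neg h, zero_sub]) (wedge_anticomm hB _ _)

theorem degPart_mul_wedge_self (hB : B.IsSymm) (i : κ) :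
    degPart b hn i * wedge B (b i) = wedge B (b i) := by
  rw [degPart, mul_assoc, contr_wedge_basis b hn hB, if_pos rfl, mul_sub, mul_one, ← mul_assoc,
    mul_self_eq_zero_of_anticomm (F := F) (wedge_anticomm hB _ _), zero_mul, sub_zero]

theorem degPart_mul_self (hB : B.IsSymm) (i : κ) :
    degPart b hn i * degPart b hn i = degPart b hn i := by
  nth_rw 2 [degPart]
  rw [← mul_assoc, degPart_mul_wedge_self b hn hB, degPart]

theorem degPart_commute (hB : B.IsSymm) (i j : κ) :
    Commute (degPart b hn i) (degPart b hn j) := by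
  rcases eq_or_ne j i with rfl | h
  · exact Commute.refl _
  · have h1 : degPart b hn i * contr B (B.dualBasis hn b j) =
        contr B (B.dualBasis hn b j) * degPart b hn i :=
      mul_mul_comm_of_anticomm (contr_anticomm hB _ _)
        (by rw [contr_wedge_basis b hn hB, if_neg h.symm, zero_sub]; exact (neg_neg _).symm)
    rw [commute_iff_eq]
    nth_rw 2 [degPart]
    rw [← mul_assoc, degPart_mul_wedge_of_ne b hn hB h, mul_assoc, h1, ← mul_assoc]
    rfl

theorem exists_polynomial_aeval_degC (hB : B.IsSymm) : ∃ p : Polynomial F,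
    Polynomial.aeval (degC b hn) p = 0 ∧ ∀ n : ℕ, 1 ≤ n → p.eval (-(n : F)) ≠ 0 :=
  exists_polynomial_aeval_sum_eq_zero _ (degPart_mul_self b hn hB) (degPart_commute b hn hB) _

/-- The product of the commuting idempotents `1 - degPart k` is the projection to exterior degree
zero along the ranges of the `wedge B (b k)`. -/
theorem exists_projection (hB : B.IsSymm) (s : Finset κ) : ∃ p : Module.End F (Cliff B), p 1 = 1 ∧
    (∀ c, (∀ k, contr B (B.dualBasis hn b k) c = 0) → p c = c) ∧
    ∀ k ∈ s, p * wedge B (b k) = 0 := by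
  induction s using Finset.induction_on with
  | empty => exact ⟨1, rfl, fun _ _ => rfl, by simp⟩
  | insert k s hk ih =>
    obtain ⟨p, hp1, hpc, hps⟩ := ih
    refine ⟨p * (1 - degPart b hn k), ?_, fun c hc => ?_, fun l hl => ?_⟩
    · simp [degPart, contr_one, hp1]
    · simp [degPart, hc k, hpc c hc]
    · rcases eq_or_ne l k with rfl | h
      · rw [mul_assoc, sub_mul, degPart_mul_wedge_self b hn hB, one_mul, sub_self, mul_zero]
      · rw [mul_assoc, sub_mul, degPart_mul_wedge_of_ne b hn hB h, one_mul,
          ← mul_one_sub, ← mul_assoc, hps l (Finset.mem_of_mem_insert_of_ne hl h), zero_mul]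

/-- The least subspace containing `1` and stable under `wedge` is also stable under `contr`, by
`contr_wedge`. Left multiplication by a vector is their sum, so this subspace is the whole algebra.
-/
theorem mem_of_wedge_mem (hB : B.IsSymm) {W : Submodule F (Cliff B)} (h1 : 1 ∈ W)
    (hW : ∀ v, ∀ x ∈ W, wedge B v x ∈ W) (c : Cliff B) : c ∈ W := by
  let S : Submodule F (Cliff B) := sInf {W | 1 ∈ W ∧ ∀ v, ∀ x ∈ W, wedge B v x ∈ W}
  have hS1 : 1 ∈ S := by
    simp only [S, Submodule.mem_sInf]
    exact fun W hW => hW.1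
  have hSw : ∀ v, ∀ x ∈ S, wedge B v x ∈ S := fun v x hx => by
    simp only [S, Submodule.mem_sInf] at hx ⊢
    exact fun W hW => hW.2 v x (hx W hW)
  have hSc : ∀ v, ∀ x ∈ S, contr B v x ∈ S := by
    let W' : Submodule F (Cliff B) :=
      { carrier := {x | x ∈ S ∧ ∀ v, contr B v x ∈ S}
        zero_mem' := ⟨S.zero_mem, fun v => by rw [map_zero]; exact S.zero_mem⟩
        add_mem' := fun hx hy => ⟨S.add_mem hx.1 hy.1, fun v => by
          rw [map_add]; exact S.add_mem (hx.2 v) (hy.2 v)⟩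
        smul_mem' := fun r x hx => ⟨S.smul_mem r hx.1, fun v => by
          rw [map_smul]; exact S.smul_mem r (hx.2 v)⟩ }
    have : S ≤ W' := sInf_le ⟨⟨hS1, fun v => by rw [contr_one]; exact S.zero_mem⟩,
      fun w x hx => ⟨hSw w x hx.1, fun v => by
        have := LinearMap.congr_fun (contr_wedge hB v w) x
        rw [Module.End.mul_apply] at this
        rw [this]
        exact S.sub_mem (S.smul_mem _ hx.1) (hSw _ _ (hx.2 v))⟩⟩
    exact fun v x hx => (this hx).2 v
  have hcS : c ∈ S := by
    induction c using CliffordAlgebra.left_induction with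
    | algebraMap r => rw [Algebra.algebraMap_eq_smul_one]; exact S.smul_mem _ hS1
    | add x y hx hy => exact S.add_mem hx hy
    | ι_mul x v hx =>
      have : iv v * x = wedge B v x + contr B v x := by
        rw [wedge_apply, contr_apply, ← smul_add]
        rw [show iv v * x + CliffordAlgebra.involute x * iv v +
          (iv v * x - CliffordAlgebra.involute x * iv v) = (2 : F) • (iv v * x) by
          rw [two_smul]; abel, inv_smul_smul₀ two_ne_zero]
      rw [this]
      exact S.add_mem (hSw v x hx) (hSc v x hx)
  exact (sInf_le ⟨h1, hW⟩ : S ≤ W) hcS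

/-- An element of the Clifford algebra killed by all contractions is a scalar. -/
theorem exists_eq_algebraMap (hB : B.IsSymm) {c : Cliff B}
    (hc : ∀ k, contr B (B.dualBasis hn b k) c = 0) : ∃ r : F, c = algebraMap F _ r := by
  obtain ⟨p, hp1, hpc, hpw⟩ := exists_projection b hn hB Finset.univ
  -- Scalars and the ranges of the `wedge B (b k)` span everything. The projection `p` maps this sum
  -- to the scalars and fixes `c`.
  let W : Submodule F (Cliff B) := (F ∙ (1 : Cliff B)) ⊔ ⨆ k, LinearMap.range (wedge B (b k))
  have hcW : c ∈ W := by
    refine mem_of_wedge_mem hB (Submodule.mem_sup_left (Submodule.mem_span_singleton_self 1))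
      (fun v x _ => Submodule.mem_sup_right ?_) c
    rw [← b.sum_repr v, map_sum, LinearMap.sum_apply]
    refine Submodule.sum_mem _ fun k _ => ?_
    rw [map_smul]
    exact Submodule.smul_mem _ _ (Submodule.mem_iSup_of_mem k ⟨x, rfl⟩)
  have hpW : W ≤ (F ∙ (1 : Cliff B)).comap p := by
    refine sup_le ?_ (iSup_le fun k => ?_)
    · rw [Submodule.span_singleton_le_iff_mem, Submodule.mem_comap, hp1]
      exact Submodule.mem_span_singleton_self 1
    · rintro _ ⟨x, rfl⟩
      rw [Submodule.mem_comap, ← Module.End.mul_apply, hpw k (Finset.mem_univ k)]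
      exact Submodule.zero_mem _
  have h := hpW hcW
  rw [Submodule.mem_comap, hpc c hc] at h
  obtain ⟨r, hr⟩ := Submodule.mem_span_singleton.1 h
  exact ⟨r, by rw [← hr, Algebra.algebraMap_eq_smul_one]⟩

end Basis

section Equivariance

/-- Applied with `x = γ(g)`, `x'` its inverse and `δ = det g`. The sign from the involution in the
right-hand term of `wedge` matches the sign in the conjugation formula. -/
theorem mul_wedge_of_conj {x x' : Cliff B} (hxx : x' * x = 1) {δ : F}
    (hδ : δ * δ = 1) (hα : CliffordAlgebra.involute x = δ • x) {R : V → V}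
    (hR : ∀ v, δ • iv (R v) = x * iv v * x') (v : V) (c : Cliff B) :
    x * wedge B v c = δ • (wedge B (R v) (x * c * x') * x) := by
  have hα' : CliffordAlgebra.involute x' * x = δ • 1 := by
    have h := congrArg CliffordAlgebra.involute hxx
    rw [map_mul, hα, map_one, mul_smul_comm] at h
    rw [← h, smul_smul, hδ, one_smul]
  rw [wedge_apply, wedge_apply, mul_smul_comm, smul_mul_assoc, smul_comm δ]
  congr 1
  have h1 : δ • (iv (R v) * (x * c * x') * x) = x * (iv v * c) := by
    rw [← smul_mul_assoc, ← smul_mul_assoc, hR]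
    simp only [mul_assoc]
    rw [hxx, mul_one, ← mul_assoc x' x, hxx, one_mul]
  have h2 : δ • (CliffordAlgebra.involute (x * c * x') * iv (R v) * x) =
      x * (CliffordAlgebra.involute c * iv v) := by
    rw [map_mul, map_mul, hα, ← smul_mul_assoc, ← mul_smul_comm, hR]
    simp only [smul_mul_assoc, mul_assoc]
    rw [hxx, mul_one, ← mul_assoc (CliffordAlgebra.involute x'), hα']
    simp only [smul_mul_assoc, mul_smul_comm, one_mul, smul_smul, hδ, one_smul]
  rw [add_mul, smul_add, h1, h2, mul_add]

/-- The infinitesimal form of `mul_wedge_of_conj`, applied to `γ` of a primitive element. -/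
theorem mul_wedge_of_comm {y : Cliff B} (hα : CliffordAlgebra.involute y = y) {R : V → V}
    (hR : ∀ v, y * iv v - iv v * y = iv (R v)) (v : V) (c : Cliff B) :
    y * wedge B v c - wedge B v c * y = wedge B (R v) c + wedge B v (y * c - c * y) := by
  simp only [wedge_apply, mul_smul_comm, smul_mul_assoc, ← smul_add, ← smul_sub, map_sub, map_mul,
    hα, ← hR]
  congr 1
  noncomm_ring

end Equivariance

end Clifford

end BarbaschSahi

namespace BarbaschSahi

/-! ### The symmetrization map and its equivariance. -/

section Symmetrization

open MvPolynomial

theorem derivation_sum_apply {R A M κ : Type*} [CommSemiring R] [CommSemiring A] [AddCommMonoid M]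
    [Algebra R A] [Module A M] [Module R M] (s : Finset κ) (D : κ → Derivation R A M) (a : A) :
    (∑ k ∈ s, D k) a = ∑ k ∈ s, D k a := by
  classical
  induction s using Finset.induction_on with
  | empty => simp
  | insert k s hk ih => rw [Finset.sum_insert hk, Finset.sum_insert hk, Derivation.add_apply, ih]

variable {F : Type*} [Field F] {ι : Type*} [Fintype ι]
  {A : Type*} [Ring A] [Algebra F A] (u : ι → A)

/-- The component of degree `n` of the symmetrization map `S(V) → A` attached to elements `u k`. -/
def symDeg : ℕ → MvPolynomial ι F →ₗ[F] A
  | 0 => Algebra.linearMap F A ∘ₗ lcoeff F 0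
  -- The symmetrized product is the average over the choice of its first factor, and choosing `u k`
  -- first leaves the symmetrization of `∂_k f`.
  | n + 1 => (((n + 1 : ℕ) : F))⁻¹ • ∑ k, LinearMap.mulLeft F (u k) ∘ₗ symDeg n ∘ₗ
      (pderiv k).toLinearMap

/-- The symmetrization map `S(V) → A`. -/
def sym : MvPolynomial ι F →ₗ[F] A :=
  (basisMonomials ι F).constr F fun s => symDeg u s.degree (monomial s (1 : F))

theorem symDeg_zero (f : MvPolynomial ι F) : symDeg u 0 f = algebraMap F A (f.coeff 0) := rfl

theorem symDeg_succ (n : ℕ) (f : MvPolynomial ι F) : symDeg u (n + 1) f =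
    (n + 1 : F)⁻¹ • ∑ k, u k * symDeg u n (pderiv k f) := by
  simp [symDeg, LinearMap.sum_apply]

theorem sym_monomial (s : ι →₀ ℕ) (r : F) :
    sym u (monomial s r) = symDeg u s.degree (monomial s r) := by
  have : monomial s r = r • (monomial s 1 : MvPolynomial ι F) := by simp [smul_monomial]
  rw [this, map_smul, map_smul]
  congr 1
  have h : monomial s (1 : F) = basisMonomials ι F s := by simp
  conv_lhs => rw [h, sym, Module.Basis.constr_basis]

theorem sym_eq_symDeg {n : ℕ} {f : MvPolynomial ι F} (hf : f.IsHomogeneous n) :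
    sym u f = symDeg u n f := by
  rw [f.as_sum, map_sum, map_sum]
  refine Finset.sum_congr rfl fun s hs => ?_
  rw [sym_monomial]
  have : s.degree = n := by
    rw [Finsupp.degree_eq_weight_one]
    exact hf (mem_support_iff.1 hs)
  rw [this]

theorem sym_C (r : F) : sym u (C r) = algebraMap F A r := by
  rw [sym_eq_symDeg u (isHomogeneous_C ι r), symDeg_zero, coeff_zero_C]

theorem sym_one : sym u (1 : MvPolynomial ι F) = 1 := by
  rw [← C_1, sym_C, map_one]

theorem sym_succ {n : ℕ} {f : MvPolynomial ι F} (hf : f.IsHomogeneous (n + 1)) :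
    sym u f = (n + 1 : F)⁻¹ • ∑ k, u k * sym u (pderiv k f) := by
  rw [sym_eq_symDeg u hf, symDeg_succ]
  congr 1
  refine Finset.sum_congr rfl fun k _ => ?_
  rw [sym_eq_symDeg u (by simpa using hf.pderiv)]

/-- Induction principle for linear statements about polynomials. -/
theorem induction_homogeneous {ι : Type*} {p : MvPolynomial ι F → Prop}
    (hadd : ∀ f g, p f → p g → p (f + g)) (hhom : ∀ n f, f.IsHomogeneous n → p f)
    (f : MvPolynomial ι F) : p f := by
  induction f using MvPolynomial.induction_on' with
  | monomial s a => exact hhom _ _ (isHomogeneous_monomial _ rfl)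
  | add f g hf hg => exact hadd _ _ hf hg

/-- The substitution `X k ↦ ∑ l, M l k X l`. -/
def substLin (M : ι → ι → F) : MvPolynomial ι F →ₐ[F] MvPolynomial ι F :=
  aeval fun k => ∑ l, C (M l k) * X l

/-- The derivation with `X k ↦ ∑ l, M l k X l`. -/
def derivLin (M : ι → ι → F) : Derivation F (MvPolynomial ι F) (MvPolynomial ι F) :=
  mkDerivation F fun k => ∑ l, C (M l k) * X l

variable [DecidableEq ι]

theorem pderiv_linear (M : ι → ι → F) (j k : ι) :
    pderiv j (∑ l, C (M l k) * X l : MvPolynomial ι F) = C (M j k) := by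
  simp [pderiv_X, Pi.single_apply]

theorem isHomogeneous_linear (M : ι → ι → F) (k : ι) :
    (∑ l, C (M l k) * X l : MvPolynomial ι F).IsHomogeneous 1 :=
  IsHomogeneous.sum _ _ _ fun l _ => by
    simpa using (isHomogeneous_C ι (M l k)).mul (isHomogeneous_X F l)

theorem isHomogeneous_substLin (M : ι → ι → F) {n : ℕ} {f : MvPolynomial ι F}
    (hf : f.IsHomogeneous n) : (substLin M f).IsHomogeneous n := by
  simpa [substLin] using hf.aeval (fun k => ∑ l, C (M l k) * X l) (isHomogeneous_linear M)

theorem derivLin_apply (M : ι → ι → F) (f : MvPolynomial ι F) :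
    derivLin M f = ∑ k, (∑ l, C (M l k) * X l) * pderiv k f := by
  have : derivLin M = ∑ k, (∑ l, C (M l k) * X l : MvPolynomial ι F) • pderiv k := by
    refine derivation_ext (fun i => ?_)
    simp [derivLin, mkDerivation_X, pderiv_X, Pi.single_apply, derivation_sum_apply]
  rw [this]
  simp [derivation_sum_apply]

theorem isHomogeneous_derivLin (M : ι → ι → F) {n : ℕ} {f : MvPolynomial ι F}
    (hf : f.IsHomogeneous n) : (derivLin M f).IsHomogeneous n := by
  rw [derivLin_apply]
  refine IsHomogeneous.sum _ _ _ fun k _ => ?_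
  cases n with
  | zero =>
    have : f = C (coeff 0 f) := by
      rw [← totalDegree_eq_zero_iff_eq_C]; exact (totalDegree_zero_iff_isHomogeneous _).2 hf
    rw [this]; simp [isHomogeneous_zero]
  | succ n =>
    have := (isHomogeneous_linear M k).mul (hf.pderiv (i := k))
    simpa [add_comm] using this

theorem pderiv_substLin (M : ι → ι → F) (j : ι) (f : MvPolynomial ι F) :
    pderiv j (substLin M f) = ∑ k, C (M j k) * substLin M (pderiv k f) := by
  induction f using MvPolynomial.induction_on with
  | C a => simp [substLin]
  | add f g hf hg => simp only [map_add, hf, hg, mul_add, Finset.sum_add_distrib]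
  | mul_X f i hf =>
    have h1 : substLin M (X i) = ∑ l, C (M l i) * X l := by simp [substLin]
    rw [map_mul, Derivation.leibniz, hf, h1, pderiv_linear]
    simp only [Derivation.leibniz, smul_eq_mul, map_add, map_mul, pderiv_X, h1, mul_add,
      Finset.sum_add_distrib, Finset.mul_sum]
    congr 1
    · rw [Finset.sum_eq_single i]
      · simp [mul_comm]
      · intro k _ hk; simp [hk.symm]
      · simp
    · refine Finset.sum_congr rfl fun k _ => ?_
      simp only [Finset.sum_mul, Finset.mul_sum]
      refine Finset.sum_congr rfl fun l _ => ?_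
      ring

/-- The commutator of two derivations is a derivation, so it is enough to compare both sides on the
variables. -/
theorem pderiv_derivLin (M : ι → ι → F) (j : ι) (f : MvPolynomial ι F) :
    pderiv j (derivLin M f) = derivLin M (pderiv j f) + ∑ k, C (M j k) * pderiv k f := by
  have h : ⁅pderiv (R := F) j, derivLin M⁆ = ∑ k, (C (M j k) : MvPolynomial ι F) • pderiv (R := F) k := by
    refine derivation_ext (fun i => ?_)
    have h1 : derivLin M (X i) = ∑ l, C (M l i) * X l := by simp [derivLin, mkDerivation_X]
    rw [Derivation.commutator_apply, h1, pderiv_linear, pderiv_X]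
    simp [derivation_sum_apply, pderiv_X, Pi.single_apply, apply_ite (derivLin M)]
  have := congrArg (fun D => D f) h
  simp only [Derivation.commutator_apply, derivation_sum_apply,
    Derivation.smul_apply, smul_eq_mul] at this
  rw [← this]; ring

variable {u}

/-- The recursion involves the basis only through `∑ u_k ⊗ ∂_k`. The chain rule shows that a linear
substitution on `f` compensates for conjugating the `u_k`. -/
theorem mul_symDeg_of_conj {M : ι → ι → F} {g : A} (hg : ∀ k, g * u k = (∑ l, M l k • u l) * g)
    (n : ℕ) (f : MvPolynomial ι F) : g * symDeg u n f = symDeg u n (substLin M f) * g := by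
  induction n generalizing f with
  | zero =>
    have : coeff 0 (substLin M f) = coeff 0 f := by
      rw [← constantCoeff_eq]
      induction f using MvPolynomial.induction_on with
      | C a => simp [substLin]
      | add f g hf hg => simp only [map_add, hf, hg]
      | mul_X f i hf => simp [substLin]
    rw [symDeg_zero, symDeg_zero, this, Algebra.commutes]
  | succ n ih =>
    simp only [symDeg_succ, pderiv_substLin, map_sum, C_mul', map_smul]
    rw [mul_smul_comm, smul_mul_assoc]
    congr 1
    simp only [Finset.mul_sum, ← mul_assoc, hg, Finset.sum_mul]
    rw [Finset.sum_comm]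
    refine Finset.sum_congr rfl fun l _ => Finset.sum_congr rfl fun k _ => ?_
    rw [mul_assoc, ih]
    simp [mul_assoc]

/-- The same induction with the Leibniz rule in place of the chain rule. -/
theorem mul_symDeg_of_comm {M : ι → ι → F} {y : A}
    (hy : ∀ k, y * u k = (∑ l, M l k • u l) + u k * y)
    (n : ℕ) (f : MvPolynomial ι F) :
    y * symDeg u n f = symDeg u n (derivLin M f) + symDeg u n f * y := by
  induction n generalizing f with
  | zero =>
    have : coeff 0 (derivLin M f) = 0 := by
      rw [← constantCoeff_eq, derivLin_apply]
      simp
    rw [symDeg_zero, symDeg_zero, this, Algebra.commutes]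
    simp
  | succ n ih =>
    simp only [symDeg_succ, pderiv_derivLin, map_sum, C_mul', map_smul, map_add]
    rw [mul_smul_comm, smul_mul_assoc, ← smul_add]
    congr 1
    simp only [Finset.mul_sum, ← mul_assoc, hy, add_mul, Finset.sum_mul, mul_add,
      Finset.sum_add_distrib]
    simp only [mul_assoc, ih, mul_add, Finset.sum_add_distrib]
    rw [Finset.sum_comm]
    simp only [smul_mul_assoc, mul_smul_comm]
    abel

theorem mul_sym_of_conj {M : ι → ι → F} {g : A} (hg : ∀ k, g * u k = (∑ l, M l k • u l) * g)
    (f : MvPolynomial ι F) : g * sym u f = sym u (substLin M f) * g := by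
  induction f using induction_homogeneous with
  | hadd f f' h h' => simp only [map_add, mul_add, add_mul, h, h']
  | hhom n f hf =>
    rw [sym_eq_symDeg u hf, sym_eq_symDeg u (isHomogeneous_substLin M hf),
      mul_symDeg_of_conj hg]

theorem mul_sym_of_comm {M : ι → ι → F} {y : A}
    (hy : ∀ k, y * u k = (∑ l, M l k • u l) + u k * y) (f : MvPolynomial ι F) :
    y * sym u f = sym u (derivLin M f) + sym u f * y := by
  induction f using induction_homogeneous with
  | hadd f f' h h' => simp only [map_add, mul_add, add_mul, h, h']; abel
  | hhom n f hf =>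
    rw [sym_eq_symDeg u hf, sym_eq_symDeg u (isHomogeneous_derivLin M hf),
      mul_symDeg_of_comm hy]

end Symmetrization

/-! ### The filtration by polynomial degree. -/

section DegreeFiltration

open MvPolynomial

variable {F : Type*} [Field F] {ι : Type*} (Y : Type*) [AddCommGroup Y] [Module F Y]

/-- The part of `F[X] ⊗ Y` of polynomial degree at most `n`. -/
def degLE (F ι : Type*) [Field F] (Y : Type*) [AddCommGroup Y] [Module F Y] (n : ℕ) :
    Submodule F (MvPolynomial ι F ⊗[F] Y) :=
  Submodule.span F {x | ∃ k ≤ n, ∃ f : MvPolynomial ι F, f.IsHomogeneous k ∧ ∃ y, x = f ⊗ₜ y}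

variable {Y}

theorem tmul_mem_degLE {k n : ℕ} (hk : k ≤ n) {f : MvPolynomial ι F} (hf : f.IsHomogeneous k)
    (y : Y) : f ⊗ₜ[F] y ∈ degLE F ι Y n :=
  Submodule.subset_span ⟨k, hk, f, hf, y, rfl⟩

theorem degLE_mono : Monotone (degLE F ι Y) := fun _ _ h =>
  Submodule.span_mono fun _ ⟨k, hk, r⟩ => ⟨k, hk.trans h, r⟩

theorem exists_mem_degLE (m : MvPolynomial ι F ⊗[F] Y) : ∃ n, m ∈ degLE F ι Y n := by
  induction m with
  | zero => exact ⟨0, Submodule.zero_mem _⟩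
  | add x y hx hy =>
    obtain ⟨n, hn⟩ := hx
    obtain ⟨n', hn'⟩ := hy
    exact ⟨max n n', Submodule.add_mem _ (degLE_mono (le_max_left _ _) hn)
      (degLE_mono (le_max_right _ _) hn')⟩
  | tmul f y =>
    induction f using induction_homogeneous with
    | hadd f g hf hg =>
      obtain ⟨n, hn⟩ := hf
      obtain ⟨n', hn'⟩ := hg
      rw [TensorProduct.add_tmul]
      exact ⟨max n n', Submodule.add_mem _ (degLE_mono (le_max_left _ _) hn)
        (degLE_mono (le_max_right _ _) hn')⟩
    | hhom n f hf => exact ⟨n, tmul_mem_degLE le_rfl hf y⟩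

theorem map_mem_of_degLE {N : Type*} [AddCommGroup N] [Module F N]
    (T : MvPolynomial ι F ⊗[F] Y →ₗ[F] N) {W : Submodule F N} {n : ℕ}
    (h : ∀ k ≤ n, ∀ f : MvPolynomial ι F, f.IsHomogeneous k → ∀ y, T (f ⊗ₜ y) ∈ W)
    {m : MvPolynomial ι F ⊗[F] Y} (hm : m ∈ degLE F ι Y n) : T m ∈ W := by
  have : degLE F ι Y n ≤ W.comap T := by
    refine Submodule.span_le.2 ?_
    rintro _ ⟨k, hk, f, hf, y, rfl⟩
    exact h k hk f hf y
  exact this hm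

/-- The projection to the part of polynomial degree `n`. -/
def degProj (n : ℕ) : MvPolynomial ι F ⊗[F] Y →ₗ[F] MvPolynomial ι F ⊗[F] Y :=
  (homogeneousComponent n).rTensor Y

theorem degProj_tmul {n k : ℕ} {f : MvPolynomial ι F} (hf : f.IsHomogeneous k) (y : Y) :
    degProj n (f ⊗ₜ[F] y) = if k = n then f ⊗ₜ[F] y else 0 := by
  rw [degProj, LinearMap.rTensor_tmul, homogeneousComponent_of_mem hf]
  by_cases h : n = k
  · simp [h]
  · simp [h, Ne.symm h]

theorem degProj_mem (n : ℕ) (m : MvPolynomial ι F ⊗[F] Y) : degProj n m ∈ degLE F ι Y n := by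
  induction m with
  | zero => simp
  | add x y hx hy => simpa only [map_add] using Submodule.add_mem _ hx hy
  | tmul f y =>
    exact tmul_mem_degLE le_rfl (homogeneousComponent_isHomogeneous n f) y

theorem degProj_zero_eq {m : MvPolynomial ι F ⊗[F] Y} (hm : m ∈ degLE F ι Y 0) :
    degProj 0 m = m := by
  have := map_mem_of_degLE (degProj 0 - LinearMap.id) (W := ⊥) (n := 0) (fun k hk f hf y => by
    simp [degProj_tmul hf, Nat.le_zero.1 hk]) hm
  simpa [sub_eq_zero] using this

theorem sub_degProj_mem {n : ℕ} {m : MvPolynomial ι F ⊗[F] Y} (hm : m ∈ degLE F ι Y (n + 1)) :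
    m - degProj (n + 1) m ∈ degLE F ι Y n := by
  refine map_mem_of_degLE (LinearMap.id - degProj (n + 1)) (fun k hk f hf y => ?_) hm
  rw [LinearMap.sub_apply, LinearMap.id_apply, degProj_tmul hf]
  split_ifs with h
  · simp
  · rw [sub_zero]
    exact tmul_mem_degLE (by omega) hf y

theorem degProj_degProj {n k : ℕ} (m : MvPolynomial ι F ⊗[F] Y) :
    degProj n (degProj k m) = if k = n then degProj k m else 0 := by
  induction m with
  | zero => simp
  | add x y hx hy => simp only [map_add, hx, hy]; split_ifs <;> simp
  | tmul f y => exact degProj_tmul (homogeneousComponent_isHomogeneous k f) y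

end DegreeFiltration

end BarbaschSahi

namespace BarbaschSahi

/-! ### Symbols in the associated graded algebra. -/

namespace AlgFiltration

variable {F R : Type*} [Field F] [Ring R] [Algebra F R] (𝓕 : AlgFiltration F R)

/-- `a ∈ Fₙ` has class `x` in the degree `n` component of the associated graded algebra. -/
def HasSymbol (n : ℕ) (a : R) (x : 𝓕.Gr) : Prop := ∃ h : a ∈ 𝓕.level n, 𝓕.toGr n ⟨a, h⟩ = x

variable {𝓕}

theorem HasSymbol.mul {m n : ℕ} {a a' : R} {x x' : 𝓕.Gr} (h : 𝓕.HasSymbol m a x)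
    (h' : 𝓕.HasSymbol n a' x') : 𝓕.HasSymbol (m + n) (a * a') (x * x') := by
  obtain ⟨h, rfl⟩ := h
  obtain ⟨h', rfl⟩ := h'
  exact ⟨𝓕.mul_mem h h', (𝓕.toGr_mul ⟨a, h⟩ ⟨a', h'⟩).symm⟩

theorem HasSymbol.smul {n : ℕ} {a : R} {x : 𝓕.Gr} (r : F) (h : 𝓕.HasSymbol n a x) :
    𝓕.HasSymbol n (r • a) (r • x) := by
  obtain ⟨h, rfl⟩ := h
  exact ⟨Submodule.smul_mem _ r h, map_smul (𝓕.toGr n) r ⟨a, h⟩⟩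

theorem HasSymbol.sum {n : ℕ} {κ : Type*} (s : Finset κ) {a : κ → R} {x : κ → 𝓕.Gr}
    (h : ∀ k ∈ s, 𝓕.HasSymbol n (a k) (x k)) : 𝓕.HasSymbol n (∑ k ∈ s, a k) (∑ k ∈ s, x k) := by
  classical
  induction s using Finset.induction_on with
  | empty => exact ⟨by simp, map_zero (𝓕.toGr n)⟩
  | insert k s hk ih =>
    rw [Finset.sum_insert hk, Finset.sum_insert hk]
    obtain ⟨h₁, e₁⟩ := h k (Finset.mem_insert_self k s)
    obtain ⟨h₂, e₂⟩ := ih fun j hj => h j (Finset.mem_insert_of_mem hj)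
    exact ⟨Submodule.add_mem _ h₁ h₂, by
      rw [← e₁, ← e₂, ← map_add]; rfl⟩

theorem HasSymbol.sub_mem_pred {n : ℕ} {a a' : R} {x : 𝓕.Gr} (h : 𝓕.HasSymbol n a x)
    (h' : 𝓕.HasSymbol n a' x) : a - a' ∈ 𝓕.pred n := by
  obtain ⟨h, rfl⟩ := h
  obtain ⟨h', e⟩ := h'
  have := (RingCon.eq _).1 e.symm n
  simpa [Polynomial.coeff_monomial] using this

end AlgFiltration

/-! ### Symmetrization as a linear isomorphism under the PBW property. -/

section PBW

open MvPolynomial HeckeAlg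

variable {F : Type*} [Field F] {V : Type*} [AddCommGroup V] [Module F V]
  {H : Type*} [Ring H] [HopfAlgebra F H] {ρ : H →ₐ[F] Module.End F V} {κ : V →ₗ[F] V →ₗ[F] H}
  {ι : Type*} [Fintype ι] (b : Module.Basis ι F V)

variable (ρ κ) in
/-- The map `S(V) → gr A` in terms of polynomials. -/
def grPoly : MvPolynomial ι F →ₐ[F] (filtration ρ κ).Gr :=
  (grS ρ κ).comp (SymmetricAlgebra.equivMvPolynomial b).symm.toAlgHom

theorem grPoly_X (k : ι) : grPoly ρ κ b (X k) = grV ρ κ (b k) := by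
  simp only [grPoly, AlgHom.comp_apply]
  have : (SymmetricAlgebra.equivMvPolynomial b).symm.toAlgHom (X k) =
      SymmetricAlgebra.ι F V (b k) := by simp
  rw [this]
  exact TensorAlgebra.lift_ι_apply _ _

variable (ρ κ) in
/-- The basis vectors of `V` as elements of `A`. -/
def gen (k : ι) : HeckeAlg ρ κ := ofV ρ κ (b k)

theorem hasSymbol_gen (k : ι) :
    (filtration ρ κ).HasSymbol 1 (gen ρ κ b k) (grPoly ρ κ b (X k)) :=
  ⟨ofV_mem ρ κ (b k), (grPoly_X b k).symm⟩

theorem hasSymbol_ofH (h : H) : (filtration ρ κ).HasSymbol 0 (ofH ρ κ h) (grH ρ κ h) :=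
  ⟨ofH_mem ρ κ h, rfl⟩

theorem hasSymbol_one : (filtration ρ κ).HasSymbol 0 1 1 :=
  ⟨(filtration ρ κ).one_mem, by
    simp only [AlgFiltration.toGr, LinearMap.coe_mk, AddHom.coe_mk]
    rw [← map_one (RingCon.mkₐ F (filtration ρ κ).grCon)]
    congr 1⟩

theorem exists_mem_level (a : HeckeAlg ρ κ) : ∃ n, a ∈ (filtration ρ κ).level n := by
  obtain ⟨t, rfl⟩ := RingQuot.mkAlgHom_surjective F (KappaRel ρ κ) a
  obtain ⟨t, rfl⟩ := RingQuot.mkAlgHom_surjective F (SmashRel ρ) t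
  change ∃ n, HeckeAlg.mk ρ κ (TensorSmash.mk ρ t) ∈ _
  induction t using TensorAlgebra.induction with
  | algebraMap r =>
    refine ⟨0, ?_⟩
    rw [AlgHom.commutes, AlgHom.commutes, Algebra.algebraMap_eq_smul_one]
    exact Submodule.smul_mem _ _ (filtration ρ κ).one_mem
  | ι x =>
    obtain ⟨v, h⟩ := x
    refine ⟨1, ?_⟩
    have : HeckeAlg.mk ρ κ (TensorSmash.mk ρ (TensorAlgebra.ι F (v, h))) =
        ofV ρ κ v + ofH ρ κ h := by
      have e : ((v, h) : V × H) = LinearMap.inl F V H v + LinearMap.inr F V H h := by simp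
      rw [e, map_add, map_add, map_add]
      rfl
    rw [this]
    exact Submodule.add_mem _ (ofV_mem ρ κ v)
      ((filtration ρ κ).mono zero_le_one (ofH_mem ρ κ h))
  | mul x y hx hy =>
    obtain ⟨n, hn⟩ := hx
    obtain ⟨n', hn'⟩ := hy
    exact ⟨n + n', by rw [map_mul, map_mul]; exact (filtration ρ κ).mul_mem hn hn'⟩
  | add x y hx hy =>
    obtain ⟨n, hn⟩ := hx
    obtain ⟨n', hn'⟩ := hy
    exact ⟨max n n', by
      rw [map_add, map_add]
      exact Submodule.add_mem _ ((filtration ρ κ).mono (le_max_left _ _) hn)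
        ((filtration ρ κ).mono (le_max_right _ _) hn')⟩

variable [CharZero F]

/-- In `gr A` the recursion defining `sym` turns into Euler's formula for homogeneous polynomials,
which returns `f`. -/
theorem hasSymbol_sym {n : ℕ} {f : MvPolynomial ι F} (hf : f.IsHomogeneous n) :
    (filtration ρ κ).HasSymbol n (sym (gen ρ κ b) f) (grPoly ρ κ b f) := by
  induction n generalizing f with
  | zero =>
    have : f = C (coeff 0 f) := by
      rw [← totalDegree_eq_zero_iff_eq_C]
      exact (totalDegree_zero_iff_isHomogeneous _).2 hf
    rw [this, sym_C, ← MvPolynomial.algebraMap_eq, AlgHom.commutes, Algebra.algebraMap_eq_smul_one,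
      Algebra.algebraMap_eq_smul_one]
    exact hasSymbol_one.smul _
  | succ n ih =>
    have hn : ((n + 1 : ℕ) : F) ≠ 0 := Nat.cast_ne_zero.2 n.succ_ne_zero
    have h1 : f = (n + 1 : F)⁻¹ • ∑ k, X k * pderiv k f := by
      rw [hf.sum_X_mul_pderiv, ← Nat.cast_smul_eq_nsmul F, smul_smul]
      push_cast at hn ⊢
      rw [inv_mul_cancel₀ hn, one_smul]
    rw [sym_succ _ hf]
    conv in grPoly ρ κ b f => rw [h1]
    rw [map_smul, map_sum]
    refine AlgFiltration.HasSymbol.smul _ (AlgFiltration.HasSymbol.sum _ fun k _ => ?_)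
    rw [map_mul, add_comm n 1]
    exact (hasSymbol_gen b k).mul (ih (by simpa using hf.pderiv))

/-- Both terms have symbol `X k * f` in degree `n + 1`. The same holds for right multiplication
because polynomials commute, so to top order the two multiplications agree. -/
theorem gen_mul_sym_sub_mem {n : ℕ} {f : MvPolynomial ι F} (hf : f.IsHomogeneous n) (k : ι) :
    gen ρ κ b k * sym (gen ρ κ b) f - sym (gen ρ κ b) (X k * f) ∈ (filtration ρ κ).level n := by
  have h := (hasSymbol_gen b k).mul (hasSymbol_sym (ρ := ρ) (κ := κ) b hf)
  rw [← map_mul, add_comm] at h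
  exact h.sub_mem_pred (hasSymbol_sym b (by
    simpa [add_comm] using (isHomogeneous_X F k).mul hf))

theorem sym_mul_gen_sub_mem {n : ℕ} {f : MvPolynomial ι F} (hf : f.IsHomogeneous n) (k : ι) :
    sym (gen ρ κ b) f * gen ρ κ b k - sym (gen ρ κ b) (X k * f) ∈ (filtration ρ κ).level n := by
  have h := (hasSymbol_sym (ρ := ρ) (κ := κ) b hf).mul (hasSymbol_gen b k)
  rw [← map_mul, mul_comm f] at h
  exact h.sub_mem_pred (hasSymbol_sym b (by
    simpa [add_comm] using (isHomogeneous_X F k).mul hf))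

variable (ρ κ) in
/-- The map `S(V) ⊗ H → A` given by symmetrization. -/
def symMul : MvPolynomial ι F ⊗[F] H →ₗ[F] HeckeAlg ρ κ :=
  LinearMap.mul' F _ ∘ₗ TensorProduct.map (sym (gen ρ κ b)) (ofH ρ κ).toLinearMap

@[simp]
theorem symMul_tmul (f : MvPolynomial ι F) (h : H) :
    symMul ρ κ b (f ⊗ₜ h) = sym (gen ρ κ b) f * ofH ρ κ h := rfl

variable (ρ κ) in
/-- The natural map `S(V) ⊗ H → gr A` in terms of polynomials. -/
def pbwPoly : MvPolynomial ι F ⊗[F] H →ₗ[F] (filtration ρ κ).Gr :=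
  LinearMap.mul' F _ ∘ₗ TensorProduct.map (grPoly ρ κ b).toLinearMap (grH ρ κ)

theorem pbwPoly_bijective (h : PBW ρ κ) : Function.Bijective (pbwPoly ρ κ b) := by
  have : pbwPoly ρ κ b = pbwMap ρ κ ∘ₗ
      (TensorProduct.congr (SymmetricAlgebra.equivMvPolynomial b).symm.toLinearEquiv
        (LinearEquiv.refl F H)).toLinearMap := by
    ext f h
    rfl
  rw [this, LinearMap.coe_comp]
  exact h.comp (LinearEquiv.bijective _)

theorem hasSymbol_symMul {n : ℕ} {f : MvPolynomial ι F} (hf : f.IsHomogeneous n) (h : H) :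
    (filtration ρ κ).HasSymbol n (symMul ρ κ b (f ⊗ₜ h)) (pbwPoly ρ κ b (f ⊗ₜ h)) := by
  have := (hasSymbol_sym (ρ := ρ) (κ := κ) b hf).mul (hasSymbol_ofH h)
  rw [add_zero] at this
  rw [pbwPoly, LinearMap.comp_apply, TensorProduct.map_tmul, LinearMap.mul'_apply, symMul_tmul]
  exact this

theorem symMul_mem_level {n : ℕ} {m : MvPolynomial ι F ⊗[F] H} (hm : m ∈ degLE F ι H n) :
    symMul ρ κ b m ∈ (filtration ρ κ).level n :=
  map_mem_of_degLE _ (fun _ hk _ hf h =>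
    (filtration ρ κ).mono hk (hasSymbol_symMul b hf h).choose) hm

/-- A representative in `⨁ Fₙ` with explicit coefficients turns equality in `gr A` into membership
conditions on `symMul`, degree by degree. -/
theorem exists_rees_pbwPoly (m : MvPolynomial ι F ⊗[F] H) :
    ∃ p : (filtration ρ κ).rees, RingCon.mkₐ F (filtration ρ κ).grCon p = pbwPoly ρ κ b m ∧
      ∀ j, p.1.coeff j = symMul ρ κ b (degProj j m) := by
  induction m with
  | zero => exact ⟨0, by simp, by simp⟩
  | add x y hx hy =>
    obtain ⟨p, hp, hp'⟩ := hx
    obtain ⟨q, hq, hq'⟩ := hy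
    exact ⟨p + q, by rw [map_add, hp, hq, map_add], fun j => by simp [hp', hq']⟩
  | tmul f h =>
    induction f using induction_homogeneous with
    | hadd f g hf hg =>
      obtain ⟨p, hp, hp'⟩ := hf
      obtain ⟨q, hq, hq'⟩ := hg
      exact ⟨p + q, by rw [map_add, hp, hq, TensorProduct.add_tmul, map_add],
        fun j => by simp only [TensorProduct.add_tmul, map_add, ← hp', ← hq']; simp⟩
    | hhom n f hf =>
      obtain ⟨h', e⟩ := hasSymbol_symMul (ρ := ρ) (κ := κ) b hf h
      refine ⟨_, e, fun j => ?_⟩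
      rw [degProj_tmul hf, Polynomial.coeff_monomial]
      split_ifs <;> simp

/-- If `symMul m = 0`, the image of the top degree part of `m` drops in the filtration. Its symbol
then vanishes, and the part itself is zero by injectivity on `gr A`. -/
theorem symMul_injective (hPBW : PBW ρ κ) : Function.Injective (symMul ρ κ b) := by
  rw [injective_iff_map_eq_zero]
  have key : ∀ n m, symMul ρ κ b (degProj n m) ∈ (filtration ρ κ).pred n → degProj n m = 0 := by
    intro n m hm
    refine (injective_iff_map_eq_zero _).1 (pbwPoly_bijective b hPBW).1 _ ?_
    obtain ⟨p, hp, hp'⟩ := exists_rees_pbwPoly (ρ := ρ) (κ := κ) b (degProj n m)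
    rw [← hp, ← map_zero (RingCon.mkₐ F (filtration ρ κ).grCon)]
    refine (RingCon.eq _).2 fun j => ?_
    rw [hp', degProj_degProj]
    split_ifs with h
    · subst h
      simpa using hm
    · simp
  intro m hm
  obtain ⟨n, hn⟩ := exists_mem_degLE m
  induction n with
  | zero =>
    rw [← degProj_zero_eq hn]
    refine key 0 m ?_
    rw [degProj_zero_eq hn, hm]
    exact Submodule.zero_mem _
  | succ n ih =>
    have h := sub_degProj_mem hn
    have h0 : degProj (n + 1) m = 0 := by
      refine key _ _ ?_
      have := symMul_mem_level (ρ := ρ) (κ := κ) b h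
      rw [map_sub, hm, zero_sub] at this
      exact neg_mem_iff.1 this
    rw [h0, sub_zero] at h
    exact ih h

/-- Surjectivity on `gr A` matches `a` up to lower order; the error is treated by induction, keeping
control of the degree. -/
theorem exists_symMul_eq (hPBW : PBW ρ κ) {n : ℕ} {a : HeckeAlg ρ κ}
    (ha : a ∈ (filtration ρ κ).level n) : ∃ m ∈ degLE F ι H n, symMul ρ κ b m = a := by
  have key : ∀ n a, a ∈ (filtration ρ κ).level n →
      ∃ m ∈ degLE F ι H n, a - symMul ρ κ b m ∈ (filtration ρ κ).pred n := by
    intro n a ha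
    obtain ⟨m, hm⟩ := (pbwPoly_bijective b hPBW).2 ((filtration ρ κ).toGr n ⟨a, ha⟩)
    obtain ⟨p, hp, hp'⟩ := exists_rees_pbwPoly (ρ := ρ) (κ := κ) b m
    rw [hm] at hp
    have := (RingCon.eq _).1 hp n
    refine ⟨degProj n m, degProj_mem n m, ?_⟩
    rw [hp'] at this
    simpa using Submodule.neg_mem _ this
  induction n generalizing a with
  | zero =>
    obtain ⟨m, hm, h⟩ := key 0 a ha
    exact ⟨m, hm, (sub_eq_zero.1 ((Submodule.mem_bot F).1 h)).symm⟩
  | succ n ih =>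
    obtain ⟨m, hm, h⟩ := key _ a ha
    obtain ⟨m', hm', h'⟩ := ih h
    exact ⟨m + m', Submodule.add_mem _ hm (degLE_mono n.le_succ hm'), by rw [map_add, h']; abel⟩

variable (ρ κ) in
/-- The linear isomorphism `S(V) ⊗ H ≃ A` of an algebra with the PBW property. -/
def symEquiv (hPBW : PBW ρ κ) : MvPolynomial ι F ⊗[F] H ≃ₗ[F] HeckeAlg ρ κ :=
  LinearEquiv.ofBijective (symMul ρ κ b) ⟨symMul_injective b hPBW, fun a => by
    obtain ⟨n, hn⟩ := exists_mem_level a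
    obtain ⟨m, -, hm⟩ := exists_symMul_eq b hPBW hn
    exact ⟨m, hm⟩⟩

@[simp]
theorem symEquiv_apply (hPBW : PBW ρ κ) (m : MvPolynomial ι F ⊗[F] H) :
    symEquiv ρ κ b hPBW m = symMul ρ κ b m := rfl

end PBW

/-! ### Group-like and primitive elements acting on symmetrized polynomials. -/

section Equivariance

open MvPolynomial HeckeAlg

variable {F : Type*} [Field F] {V : Type*} [AddCommGroup V] [Module F V]
  {H : Type*} [Ring H] [HopfAlgebra F H] (ρ : H →ₐ[F] Module.End F V) (κ : V →ₗ[F] V →ₗ[F] H)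
  {ι : Type*} [Fintype ι] (b : Module.Basis ι F V)

theorem ofH_mul_ofV_of_isGroupLikeElem {g : H} (hg : IsGroupLikeElem F g) (v : V) :
    ofH ρ κ g * ofV ρ κ v = ofV ρ κ (ρ g v) * ofH ρ κ g := by
  rw [ofH_mul_ofV, hg.comul_eq_tmul_self]
  simp

theorem ofH_mul_ofV_of_isPrimitive {y : H} (hy : IsPrimitive F y) (v : V) :
    ofH ρ κ y * ofV ρ κ v = ofV ρ κ (ρ y v) + ofV ρ κ v * ofH ρ κ y := by
  rw [ofH_mul_ofV, hy]
  simp [add_comm]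

/-- The matrix entries of an endomorphism in a basis. -/
def entries (R : Module.End F V) (l k : ι) : F := b.repr (R (b k)) l

theorem sum_entries_smul (R : Module.End F V) (k : ι) : ∑ l, entries b R l k • b l = R (b k) :=
  b.sum_repr _

variable [DecidableEq ι]

theorem ofH_mul_sym_of_isGroupLikeElem {g : H} (hg : IsGroupLikeElem F g)
    (f : MvPolynomial ι F) : ofH ρ κ g * sym (gen ρ κ b) f =
      sym (gen ρ κ b) (substLin (entries b (ρ g)) f) * ofH ρ κ g := by
  refine mul_sym_of_conj (fun k => ?_) f
  simp only [gen]
  rw [ofH_mul_ofV_of_isGroupLikeElem ρ κ hg, ← sum_entries_smul b, map_sum]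
  simp

theorem ofH_mul_sym_of_isPrimitive {y : H} (hy : IsPrimitive F y)
    (f : MvPolynomial ι F) : ofH ρ κ y * sym (gen ρ κ b) f =
      sym (gen ρ κ b) (derivLin (entries b (ρ y)) f) + sym (gen ρ κ b) f * ofH ρ κ y := by
  refine mul_sym_of_comm (fun k => ?_) f
  simp only [gen]
  rw [ofH_mul_ofV_of_isPrimitive ρ κ hy, ← sum_entries_smul b, map_sum]
  simp

end Equivariance

end BarbaschSahi

namespace BarbaschSahi

open Coalgebra

/-! ### Twisting a tensor product by a convolution invertible map. -/

section Twist

variable {F : Type*} [Field F] {R : Type*} [Ring R] [Algebra F R]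
  {D : Type*} [AddCommGroup D] [Module F D] [Coalgebra F D]

/-- The map `r ⊗ d ↦ r f(d₍₁₎) ⊗ d₍₂₎`. -/
def twist (f : WithConv (D →ₗ[F] R)) : R ⊗[F] D →ₗ[F] R ⊗[F] D :=
  LinearMap.rTensor D (LinearMap.mul' F R) ∘ₗ (TensorProduct.assoc F R R D).symm.toLinearMap ∘ₗ
    LinearMap.lTensor R (LinearMap.rTensor D f.ofConv ∘ₗ comul)

theorem twist_tmul (f : WithConv (D →ₗ[F] R)) (r : R) (d : D) :
    twist f (r ⊗ₜ d) = TensorProduct.map (LinearMap.mulLeft F r ∘ₗ f.ofConv) LinearMap.id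
      (comul (R := F) d) := by
  simp only [twist, LinearMap.comp_apply, LinearMap.lTensor_tmul]
  generalize comul (R := F) d = t
  induction t with
  | zero => simp
  | add x y hx hy => simp only [map_add, TensorProduct.tmul_add, hx, hy]
  | tmul x y => simp

/-- By coassociativity both sides send `r ⊗ d` to `r g(d₁) f(d₂) ⊗ d₃`, hence the reversed order. -/
theorem twist_twist (f g : WithConv (D →ₗ[F] R)) (x : R ⊗[F] D) :
    twist f (twist g x) = twist (g * f) x := by
  induction x with
  | zero => simp
  | add x y hx hy => simp only [map_add, hx, hy]
  | tmul r d =>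
    let Φ : D ⊗[F] (D ⊗[F] D) →ₗ[F] R ⊗[F] D :=
      LinearMap.rTensor D (LinearMap.mul' F R) ∘ₗ (TensorProduct.assoc F R R D).symm.toLinearMap ∘ₗ
        TensorProduct.map (LinearMap.mulLeft F r ∘ₗ g.ofConv) (LinearMap.rTensor D f.ofConv)
    have h1 : ∀ t : D ⊗[F] D, twist f (TensorProduct.map (LinearMap.mulLeft F r ∘ₗ g.ofConv)
        LinearMap.id t) = Φ (LinearMap.lTensor D comul t) := by
      intro t
      induction t with
      | zero => simp
      | add x y hx hy => simp only [map_add, hx, hy]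
      | tmul x y =>
        simp only [TensorProduct.map_tmul, twist_tmul, LinearMap.lTensor_tmul, LinearMap.id_apply]
        generalize comul (R := F) y = s
        induction s with
        | zero => simp
        | add x y hx hy => simp only [map_add, TensorProduct.tmul_add, hx, hy]
        | tmul a b => simp [Φ, mul_assoc]
    have h2 : ∀ t : D ⊗[F] D, TensorProduct.map (LinearMap.mulLeft F r ∘ₗ (g * f).ofConv)
        LinearMap.id t = Φ (TensorProduct.assoc F D D D (LinearMap.rTensor D comul t)) := by
      intro t
      induction t with
      | zero => simp
      | add x y hx hy => simp only [map_add, hx, hy]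
      | tmul x y =>
        simp only [TensorProduct.map_tmul, LinearMap.rTensor_tmul, LinearMap.id_apply,
          LinearMap.comp_apply]
        have h3 : (g * f).ofConv x = LinearMap.mul' F R (TensorProduct.map g.ofConv f.ofConv
            (comul x)) := LinearMap.convMul_apply _ _ _
        rw [h3]
        generalize comul (R := F) x = s
        induction s with
        | zero => simp
        | add x y hx hy => simp only [map_add, TensorProduct.add_tmul, hx, hy]
        | tmul a b => simp [Φ, mul_assoc]
    rw [twist_tmul, twist_tmul, h1, h2, Coalgebra.coassoc_apply]

theorem twist_one (x : R ⊗[F] D) : twist (1 : WithConv (D →ₗ[F] R)) x = x := by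
  induction x with
  | zero => simp
  | add x y hx hy => simp only [map_add, hx, hy]
  | tmul r d =>
    have h : ∀ t : D ⊗[F] D, TensorProduct.map (LinearMap.mulLeft F r ∘ₗ
        (1 : WithConv (D →ₗ[F] R)).ofConv) LinearMap.id t =
        r ⊗ₜ TensorProduct.lid F D (LinearMap.rTensor D counit t) := by
      intro t
      induction t with
      | zero => simp
      | add x y hx hy => simp only [map_add, TensorProduct.tmul_add, hx, hy]
      | tmul a b =>
        have : (1 : WithConv (D →ₗ[F] R)).ofConv a = algebraMap F R (counit (R := F) a) := rfl
        simp [this, Algebra.algebraMap_eq_smul_one, TensorProduct.smul_tmul]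
    rw [twist_tmul, h]
    simp

/-- Twisting by a convolution invertible map. -/
def twistEquiv (f g : WithConv (D →ₗ[F] R)) (h₁ : f * g = 1) (h₂ : g * f = 1) :
    R ⊗[F] D ≃ₗ[F] R ⊗[F] D :=
  LinearEquiv.ofLinearMap (twist f) (twist g)
    (LinearMap.ext fun x => by
      rw [LinearMap.comp_apply, twist_twist, h₂, twist_one, LinearMap.id_apply])
    (LinearMap.ext fun x => by
      rw [LinearMap.comp_apply, twist_twist, h₁, twist_one, LinearMap.id_apply])

end Twist

/-! ### Coordinates on `A ⊗ C` adapted to the diagonal map. -/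

section Pin

open HeckeAlg MvPolynomial

variable {F : Type*} [Field F] {V : Type*} [AddCommGroup V] [Module F V]
  {H : Type*} [Ring H] [HopfAlgebra F H] {ρ : H →ₐ[F] Module.End F V}
  {κ : V →ₗ[F] V →ₗ[F] H} {B : LinearMap.BilinForm F V}
  {Ht : Type*} [Ring Ht] [HopfAlgebra F Ht] (P : PinCover ρ B Ht)

/-- The restriction of `γ` along a section, as an element of the convolution algebra. -/
def secPin (σ : H →ₗc[F] Ht) : WithConv (H →ₗ[F] Cliff B) :=
  WithConv.toConv (P.γ.toLinearMap ∘ₗ (σ : H →ₗ[F] Ht))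

/-- The convolution inverse of `secPin`. -/
def secPinInv (σ : H →ₗc[F] Ht) : WithConv (H →ₗ[F] Cliff B) :=
  WithConv.toConv (P.γ.toLinearMap ∘ₗ HopfAlgebra.antipode F ∘ₗ (σ : H →ₗ[F] Ht))

theorem comul_section (σ : H →ₗc[F] Ht) (h : H) :
    comul (R := F) (σ h) = TensorProduct.map (σ : H →ₗ[F] Ht) (σ : H →ₗ[F] Ht) (comul h) :=
  (LinearMap.congr_fun σ.map_comp_comul h).symm

theorem counit_section (σ : H →ₗc[F] Ht) (h : H) :
    counit (R := F) (σ h) = counit (R := F) h :=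
  LinearMap.congr_fun σ.counit_comp h

theorem secPin_mul_secPinInv (σ : H →ₗc[F] Ht) : secPin P σ * secPinInv P σ = 1 := by
  apply WithConv.ofConv_injective
  ext h
  have e1 : (secPin P σ * secPinInv P σ).ofConv h = LinearMap.mul' F (Cliff B)
      (TensorProduct.map (secPin P σ).ofConv (secPinInv P σ).ofConv (comul h)) :=
    LinearMap.convMul_apply _ _ _
  have e2 : (1 : WithConv (H →ₗ[F] Cliff B)).ofConv h =
    algebraMap F (Cliff B) (counit (R := F) h) := rfl
  have e3 : P.γ (LinearMap.mul' F Ht (LinearMap.lTensor Ht (HopfAlgebra.antipode F)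
      (comul (R := F) (σ h)))) = algebraMap F (Cliff B) (counit (R := F) h) := by
    rw [HopfAlgebra.mul_antipode_lTensor_comul_apply, counit_section, AlgHom.commutes]
  rw [e1, e2, ← e3, comul_section]
  generalize comul (R := F) h = t
  induction t with
  | zero => simp
  | add x y hx hy => simp only [map_add, hx, hy]
  | tmul x y => simp [secPin, secPinInv]

theorem secPinInv_mul_secPin (σ : H →ₗc[F] Ht) : secPinInv P σ * secPin P σ = 1 := by
  apply WithConv.ofConv_injective
  ext h
  have e1 : (secPinInv P σ * secPin P σ).ofConv h = LinearMap.mul' F (Cliff B)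
      (TensorProduct.map (secPinInv P σ).ofConv (secPin P σ).ofConv (comul h)) :=
    LinearMap.convMul_apply _ _ _
  have e2 : (1 : WithConv (H →ₗ[F] Cliff B)).ofConv h =
    algebraMap F (Cliff B) (counit (R := F) h) := rfl
  have e3 : P.γ (LinearMap.mul' F Ht (LinearMap.rTensor Ht (HopfAlgebra.antipode F)
      (comul (R := F) (σ h)))) = algebraMap F (Cliff B) (counit (R := F) h) := by
    rw [HopfAlgebra.mul_antipode_rTensor_comul_apply, counit_section, AlgHom.commutes]
  rw [e1, e2, ← e3, comul_section]
  generalize comul (R := F) h = t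
  induction t with
  | zero => simp
  | add x y hx hy => simp only [map_add, hx, hy]
  | tmul x y => simp [secPin, secPinInv]

/-- The isomorphism `c ⊗ h ↦ (1 ⊗ c) Δ_C(σ h)`. -/
def secEquiv (σ : H →ₗc[F] Ht) : Cliff B ⊗[F] H ≃ₗ[F] H ⊗[F] Cliff B :=
  (twistEquiv _ _ (secPin_mul_secPinInv P σ) (secPinInv_mul_secPin P σ)).trans
    (TensorProduct.comm F _ _)

theorem secEquiv_tmul [IsCocomm F H] {σ : H →ₗc[F] Ht} (hσ : ∀ h, P.π (σ h) = h) (c : Cliff B)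
    (h : H) : secEquiv P σ (c ⊗ₜ h) = (1 ⊗ₜ[F] c) * P.diag (σ h) := by
  have e1 : P.diag (σ h) = TensorProduct.map LinearMap.id (secPin P σ).ofConv (comul h) := by
    change Algebra.TensorProduct.map (P.π : Ht →ₐ[F] H) P.γ (comul (R := F) (σ h)) = _
    rw [comul_section]
    generalize comul (R := F) h = t
    induction t with
    | zero => simp
    | add x y hx hy => simp only [map_add, hx, hy]
    | tmul x y => simp [secPin, hσ]
  have e2 : secEquiv P σ (c ⊗ₜ h) = TensorProduct.comm F _ _ (twist (secPin P σ) (c ⊗ₜ h)) := rfl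
  rw [e1, e2, twist_tmul]
  -- The left side puts `γ σ` on the first leg of `Δ h` and the right side on the second;
  -- cocommutativity reconciles them.
  conv_lhs => rw [← Coalgebra.comm_comul F h]
  generalize comul (R := F) h = t
  induction t with
  | zero => simp
  | add x y hx hy => simp only [map_add, hx, hy, mul_add]
  | tmul x y => simp

variable (κ)

theorem diagAC_apply (t : Ht) : P.diagAC κ t =
    Algebra.TensorProduct.map (HeckeAlg.ofH ρ κ) (AlgHom.id F (Cliff B)) (P.diag t) := rfl

variable {κ}
variable {ι : Type*} [Fintype ι] (b : Module.Basis ι F V)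

variable (ρ κ B) in
/-- The filtration of `A ⊗ C` coming from that of `A`. -/
def levC (n : ℕ) : Submodule F (AC ρ κ B) :=
  Submodule.span F {x | ∃ a ∈ (filtration ρ κ).level n, ∃ c, x = a ⊗ₜ c}

theorem tmul_mem_levC {n : ℕ} {a : HeckeAlg ρ κ} (ha : a ∈ (filtration ρ κ).level n)
    (c : Cliff B) : a ⊗ₜ c ∈ levC ρ κ B n := Submodule.subset_span ⟨a, ha, c, rfl⟩

theorem levC_mono : Monotone (levC ρ κ B) := fun _ _ h =>
  Submodule.span_mono fun _ ⟨a, ha, c, hc⟩ => ⟨a, (filtration ρ κ).mono h ha, c, hc⟩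

theorem mul_mem_levC {m n : ℕ} {x y : AC ρ κ B} (hx : x ∈ levC ρ κ B m)
    (hy : y ∈ levC ρ κ B n) : x * y ∈ levC ρ κ B (m + n) := by
  induction hx using Submodule.span_induction with
  | zero => simp
  | add x x' _ _ h h' => rw [add_mul]; exact Submodule.add_mem _ h h'
  | smul r x _ h => rw [smul_mul_assoc]; exact Submodule.smul_mem _ r h
  | mem x hx =>
    obtain ⟨a, ha, c, rfl⟩ := hx
    induction hy using Submodule.span_induction with
    | zero => simp
    | add x x' _ _ h h' => rw [mul_add]; exact Submodule.add_mem _ h h'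
    | smul r x _ h => rw [mul_smul_comm]; exact Submodule.smul_mem _ r h
    | mem y hy =>
      obtain ⟨a', ha', c', rfl⟩ := hy
      rw [Algebra.TensorProduct.tmul_mul_tmul]
      exact tmul_mem_levC ((filtration ρ κ).mul_mem ha ha') _

theorem exists_mem_levC (x : AC ρ κ B) : ∃ n, x ∈ levC ρ κ B n := by
  induction x using TensorProduct.induction_on with
  | zero => exact ⟨0, Submodule.zero_mem _⟩
  | add x y hx hy =>
    obtain ⟨n, hn⟩ := hx
    obtain ⟨n', hn'⟩ := hy
    exact ⟨max n n', Submodule.add_mem _ (levC_mono (le_max_left _ _) hn)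
      (levC_mono (le_max_right _ _) hn')⟩
  | tmul a c =>
    obtain ⟨n, hn⟩ := exists_mem_level a
    exact ⟨n, tmul_mem_levC hn c⟩

theorem diagAC_mem_levC (t : Ht) : P.diagAC κ t ∈ levC ρ κ B 0 := by
  rw [diagAC_apply]
  generalize P.diag t = s
  induction s with
  | zero => simp
  | add x y hx hy => rw [map_add]; exact Submodule.add_mem _ hx hy
  | tmul x y => exact tmul_mem_levC (ofH_mem ρ κ x) y

variable [CharZero F]

/-- The isomorphism `S(V) ⊗ C ⊗ H → A ⊗ C`, `f ⊗ c ⊗ h ↦ (f ⊗ c) Δ_C(σ h)`. -/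
def triEquiv (hPBW : PBW ρ κ) (σ : H →ₗc[F] Ht) :
    MvPolynomial ι F ⊗[F] (Cliff B ⊗[F] H) ≃ₗ[F] AC ρ κ B :=
  (TensorProduct.congr (LinearEquiv.refl F _) (secEquiv P σ)).trans
    ((TensorProduct.assoc F _ _ _).symm.trans
      (TensorProduct.congr (symEquiv ρ κ b hPBW) (LinearEquiv.refl F _)))

theorem triEquiv_tmul [IsCocomm F H] (hPBW : PBW ρ κ) {σ : H →ₗc[F] Ht}
    (hσ : ∀ h, P.π (σ h) = h) (f : MvPolynomial ι F) (c : Cliff B) (h : H) :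
    triEquiv P b hPBW σ (f ⊗ₜ (c ⊗ₜ h)) =
      (sym (gen ρ κ b) f ⊗ₜ[F] c) * P.diagAC κ (σ h) := by
  have e1 : triEquiv P b hPBW σ (f ⊗ₜ (c ⊗ₜ h)) =
    TensorProduct.congr (symEquiv ρ κ b hPBW) (LinearEquiv.refl F _)
      ((TensorProduct.assoc F _ _ _).symm (f ⊗ₜ secEquiv P σ (c ⊗ₜ h))) := rfl
  rw [e1, secEquiv_tmul P hσ, diagAC_apply]
  generalize P.diag (σ h) = t
  induction t with
  | zero => simp
  | add x y hx hy => simp only [map_add, hx, hy, mul_add, TensorProduct.tmul_add]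
  | tmul x y => simp

/-- The passage between `H ⊗ C` and `C ⊗ H` does not touch the polynomial factor, and symmetrization
matches polynomial degree with the filtration of `A` in both directions. -/
theorem triEquiv_mem_levC_iff [IsCocomm F H] (hPBW : PBW ρ κ) {σ : H →ₗc[F] Ht}
    (hσ : ∀ h, P.π (σ h) = h) {n : ℕ} (m : MvPolynomial ι F ⊗[F] (Cliff B ⊗[F] H)) :
    triEquiv P b hPBW σ m ∈ levC ρ κ B n ↔ m ∈ degLE F ι (Cliff B ⊗[F] H) n := by
  constructor
  · have key : levC ρ κ B n ≤ (degLE F ι (Cliff B ⊗[F] H) n).comap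
        (triEquiv P b hPBW σ).symm.toLinearMap := by
      refine Submodule.span_le.2 ?_
      rintro _ ⟨a, ha, c, rfl⟩
      obtain ⟨m, hm, rfl⟩ := exists_symMul_eq b hPBW ha
      change (triEquiv P b hPBW σ).symm _ ∈ degLE F ι (Cliff B ⊗[F] H) n
      have e : ∀ m, triEquiv P b hPBW σ (LinearMap.lTensor _ ((secEquiv P σ).symm.toLinearMap ∘ₗ
            (TensorProduct.mk F H (Cliff B)).flip c) m) = symMul ρ κ b m ⊗ₜ c := by
        intro m
        induction m with
        | zero => simp
        | add x y hx hy => rw [map_add, map_add, hx, hy, map_add, TensorProduct.add_tmul]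
        | tmul f h => simp [triEquiv]
      rw [← e, LinearEquiv.symm_apply_apply]
      exact map_mem_of_degLE (LinearMap.lTensor _ ((secEquiv P σ).symm.toLinearMap ∘ₗ
            (TensorProduct.mk F H (Cliff B)).flip c)) (W := degLE F ι (Cliff B ⊗[F] H) n)
        (fun k hk f hf h => tmul_mem_degLE hk hf _) hm
    intro h
    simpa using key h
  · refine map_mem_of_degLE (triEquiv P b hPBW σ).toLinearMap (W := levC ρ κ B n)
      (fun k hk f hf y => ?_)
    induction y with
    | zero => simp
    | add x y hx hy => rw [TensorProduct.tmul_add, map_add]; exact Submodule.add_mem _ hx hy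
    | tmul c h =>
      change triEquiv P b hPBW σ _ ∈ _
      rw [triEquiv_tmul P b hPBW hσ]
      obtain ⟨hl, -⟩ := hasSymbol_sym (ρ := ρ) (κ := κ) b hf
      have := mul_mem_levC (tmul_mem_levC ((filtration ρ κ).mono hk hl) c)
        (diagAC_mem_levC P (κ := κ) (σ h))
      rwa [add_zero] at this

end Pin

end BarbaschSahi

namespace BarbaschSahi

/-! ### Descent along a filtration by a contracting homotopy. -/

section Descent

variable {F : Type*} [Field F] [CharZero F] {W : Type*} [AddCommGroup W] [Module F W]

/-- Two operators which agree modulo a subspace `L` on a subspace `Y` agree modulo `L` after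
applying any polynomial. -/
theorem aeval_mem_and_sub_mem {T E : Module.End F W} {Y L : Submodule F W}
    (hT : ∀ y ∈ Y, T y ∈ Y) (hE : ∀ y ∈ L, E y ∈ L) (hTE : ∀ y ∈ Y, T y - E y ∈ L)
    (q : Polynomial F) {y : W} (hy : y ∈ Y) :
    Polynomial.aeval T q y ∈ Y ∧ Polynomial.aeval T q y - Polynomial.aeval E q y ∈ L := by
  have key : ∀ n : ℕ, (T ^ n) y ∈ Y ∧ (T ^ n) y - (E ^ n) y ∈ L := by
    intro n
    induction n with
    | zero => simp [hy]
    | succ n ih =>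
      rw [pow_succ', pow_succ', Module.End.mul_apply, Module.End.mul_apply]
      refine ⟨hT _ ih.1, ?_⟩
      have := L.add_mem (hTE _ ih.1) (hE _ ih.2)
      rwa [map_sub, sub_add_sub_cancel] at this
  induction q using Polynomial.induction_on' with
  | add p q hp hq =>
    rw [map_add, map_add, LinearMap.add_apply, LinearMap.add_apply, add_sub_add_comm]
    exact ⟨Y.add_mem hp.1 hq.1, L.add_mem hp.2 hq.2⟩
  | monomial n r =>
    simp only [Polynomial.aeval_monomial, ← Algebra.smul_def, LinearMap.smul_apply, ← smul_sub]
    exact ⟨Y.smul_mem r (key n).1, L.smul_mem r (key n).2⟩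

/-- Descent along a filtration: if `d` is modulo lower order terms a Koszul differential `δ` with
contracting homotopy `h`, and `d h` acts as `2 (N + E)` modulo lower order terms with `N` the degree
operator and `N + E` invertible in positive degrees, then elements killed by `d` modulo degree zero
are exact modulo degree zero. -/
theorem exists_eq_add_of_descent {d h δ N E : Module.End F W} {L : ℕ → Submodule F W}
    {X X' : Submodule F W} (hL : Monotone L) (hX : ∀ x ∈ X, h x ∈ X') (hX' : ∀ x ∈ X', d x ∈ X)
    (hdd : ∀ x ∈ X', d (d x) = 0) (hδ : ∀ x, δ (h x) + h (δ x) = (2 : F) • (N x + E x))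
    (hd : ∀ n, ∀ x ∈ L n, d x - δ x ∈ L n) (hh : ∀ n, ∀ x ∈ L (n + 1), h x ∈ L n)
    (hdL : ∀ n, ∀ x ∈ L n, d x ∈ L (n + 1))
    (hN : ∀ n, ∀ x ∈ L (n + 1), N x - ((n + 1 : ℕ) : F) • x ∈ L n)
    (hE : ∀ n, ∀ x ∈ L n, E x ∈ L n) {p : Polynomial F} (hp : Polynomial.aeval E p = 0)
    (hp0 : ∀ n : ℕ, 1 ≤ n → p.eval (-(n : F)) ≠ 0) (n : ℕ) {x : W} (hx : x ∈ X) (hn : x ∈ L n)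
    (hdx : d x ∈ L 0) : ∃ w ∈ X', ∃ x₀ ∈ X ⊓ L 0, x = d w + x₀ := by
  induction n generalizing x with
  | zero => exact ⟨0, X'.zero_mem, x, ⟨hx, hn⟩, by simp⟩
  | succ n ih =>
    set c : F := ((n + 1 : ℕ) : F) with hc
    -- On `L (n + 1)` the degree operator is `n + 1` modulo `L n`, so `d h / 2` acts there as `c +
    -- E` on elements with `d y ∈ L 0`. Thus `T` is a substitute for `E` that preserves `X`, which
    -- `E` itself need not do.
    let T : Module.End F W := (2 : F)⁻¹ • (d * h) - c • 1
    have hTa : ∀ y, T y = (2 : F)⁻¹ • d (h y) - c • y := fun y => rfl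
    let Y : Submodule F W := (X ⊓ L (n + 1)) ⊓ (L 0).comap d
    have hT : ∀ y ∈ Y, T y ∈ Y := by
      rintro y ⟨⟨hy, hyL⟩, hyd⟩
      refine ⟨⟨?_, ?_⟩, ?_⟩
      · exact X.sub_mem (X.smul_mem _ (hX' _ (hX _ hy))) (X.smul_mem _ hy)
      · exact (L _).sub_mem ((L _).smul_mem _ (hdL _ _ (hh _ _ hyL))) ((L _).smul_mem _ hyL)
      · change d (T y) ∈ L 0
        rw [hTa, map_sub, map_smul, hdd _ (hX _ hy), smul_zero, zero_sub, map_smul]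
        exact (L 0).neg_mem ((L 0).smul_mem _ hyd)
    have hTE : ∀ y ∈ Y, T y - E y ∈ L n := by
      rintro y ⟨⟨hy, hyL⟩, hyd⟩
      -- The assumption `d y ∈ L 0` enters here: it puts `δ y` in `L (n + 1)` and makes the term `h
      -- δ` of lower order.
      have h1 : h (δ y) ∈ L n := by
        refine hh _ _ ?_
        have := (L (n + 1)).sub_mem (hL (Nat.zero_le _) hyd) (hd _ _ hyL)
        rwa [sub_sub_cancel] at this
      have h2 := hd _ _ (hh _ _ hyL)
      have h3 := (L n).smul_mem ((2 : F)⁻¹) ((L n).sub_mem h2 h1)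
      have h4 := (L n).add_mem h3 (hN _ _ hyL)
      have e : T y - E y = (2 : F)⁻¹ • (d (h y) - δ (h y) - h (δ y)) + (N y - c • y) := by
        have : δ (h y) = (2 : F) • (N y + E y) - h (δ y) := by rw [← hδ]; abel
        rw [this, hTa]
        simp only [smul_sub, smul_smul, smul_add]
        rw [inv_mul_cancel₀ two_ne_zero, one_smul, one_smul]
        abel
      rw [e]
      exact h4
    have hxY : x ∈ Y := ⟨⟨hx, hn⟩, hdx⟩
    -- As `p(E) = 0`, the element `p(T) x` drops to `L n`.
    have hP := aeval_mem_and_sub_mem hT (hE n) hTE p hxY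
    rw [hp, LinearMap.zero_apply, sub_zero] at hP
    -- Write `p = p(-c) + (X + c) r`. Since `T + c = d h / 2`, the element `p(T) x` differs from
    -- `p(-c) x` by an exact term. As `p(-c) ≠ 0`, induction applied to `p(T) x` settles `x`.
    obtain ⟨r, hr⟩ := Polynomial.X_sub_C_dvd_sub_C_eval (a := -c) (p := p)
    have hr' : p = Polynomial.C (p.eval (-c)) + (Polynomial.X - Polynomial.C (-c)) * r := by
      rw [← hr]; ring
    have e : Polynomial.aeval T p x = p.eval (-c) • x +
        (2 : F)⁻¹ • d (h (Polynomial.aeval T r x)) := by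
      conv_lhs => rw [hr']
      simp only [map_add, map_mul, map_sub, Polynomial.aeval_C, Polynomial.aeval_X,
        LinearMap.add_apply, Module.End.mul_apply, Module.algebraMap_end_apply,
        LinearMap.sub_apply, hTa]
      rw [neg_smul, sub_neg_eq_add, sub_add_cancel]
    have hs := hp0 (n + 1) (by omega)
    rw [← hc] at hs
    obtain ⟨w, hw, x₀, hx₀, ex⟩ := ih hP.1.1.1 hP.2 hP.1.2
    refine ⟨(p.eval (-c))⁻¹ • (w - (2 : F)⁻¹ • h (Polynomial.aeval T r x)),
      X'.smul_mem _ (X'.sub_mem hw (X'.smul_mem _ (hX _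
        (aeval_mem_and_sub_mem hT (hE n) hTE r hxY).1.1.1))), (p.eval (-c))⁻¹ • x₀,
      Submodule.smul_mem _ _ hx₀, ?_⟩
    rw [map_smul, map_sub, map_smul, ← smul_add, eq_inv_smul_iff₀ hs, sub_add_eq_add_sub, ← ex, e,
      add_sub_cancel_right]

end Descent

/-! ### The Koszul differential and the de Rham homotopy. -/

section Koszul

open MvPolynomial

variable {F : Type*} [Field F] [CharZero F] {V : Type*} [AddCommGroup V] [Module F V]
  {B : LinearMap.BilinForm F V} {ι : Type*} [Fintype ι] [DecidableEq ι] (b : Module.Basis ι F V)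
  (hn : B.Nondegenerate) (H : Type*) [AddCommGroup H] [Module F H]

/-- The Koszul differential on `S(V) ⊗ Λ(V) ⊗ H`. -/
def koszul : Module.End F (MvPolynomial ι F ⊗[F] (Cliff B ⊗[F] H)) :=
  (2 : F) • ∑ k, TensorProduct.map (LinearMap.mulLeft F (X k))
    (LinearMap.rTensor H (contr B (B.dualBasis hn b k)))

variable (B) in
/-- The homotopy (de Rham differential) on `S(V) ⊗ Λ(V) ⊗ H`. -/
def deRham : Module.End F (MvPolynomial ι F ⊗[F] (Cliff B ⊗[F] H)) :=
  ∑ k, TensorProduct.map (pderiv k).toLinearMap (LinearMap.rTensor H (wedge B (b k)))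

/-- The polynomial degree operator. -/
def euler (F ι H : Type*) [Field F] [Fintype ι] [AddCommGroup H] [Module F H] :
    Module.End F (MvPolynomial ι F ⊗[F] H) :=
  LinearMap.rTensor H (∑ k, LinearMap.mulLeft F (X k) ∘ₗ (pderiv k).toLinearMap)

/-- The exterior degree operator. -/
def extDeg : Module.End F (MvPolynomial ι F ⊗[F] (Cliff B ⊗[F] H)) :=
  LinearMap.lTensor _ (LinearMap.rTensor H (degC b hn))

variable {H}

theorem koszul_tmul (f : MvPolynomial ι F) (c : Cliff B) (h : H) :
    koszul b hn H (f ⊗ₜ (c ⊗ₜ h)) =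
      (2 : F) • ∑ k, (X k * f) ⊗ₜ (contr B (B.dualBasis hn b k) c ⊗ₜ h) := by
  simp [koszul, LinearMap.sum_apply]

theorem deRham_tmul (f : MvPolynomial ι F) (c : Cliff B) (h : H) :
    deRham B b H (f ⊗ₜ (c ⊗ₜ h)) = ∑ k, (pderiv k f) ⊗ₜ (wedge B (b k) c ⊗ₜ h) := by
  simp [deRham, LinearMap.sum_apply]

/-- For distinct indices the terms cancel because contraction and wedge anticommute while `X k` and
`∂_l` commute. A diagonal pair leaves twice `X_k ∂_k f ⊗ c + f ⊗ degPart k c`. -/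
theorem koszul_deRham_add (hB : B.IsSymm) (m : MvPolynomial ι F ⊗[F] (Cliff B ⊗[F] H)) :
    koszul b hn H (deRham B b H m) + deRham B b H (koszul b hn H m) =
      (2 : F) • (euler F ι _ m + extDeg b hn H m) := by
  induction m with
  | zero => simp
  | add x y hx hy =>
    simp only [map_add, add_add_add_comm _ _ (deRham B b H (koszul b hn H x)), hx, hy]
    simp only [smul_add]
    abel
  | tmul f y =>
    induction y with
    | zero => simp
    | add x y hx hy =>
      simp only [map_add, TensorProduct.tmul_add,
        add_add_add_comm _ _ (deRham B b H (koszul b hn H (f ⊗ₜ x))), hx, hy]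
      simp only [smul_add]
      abel
    | tmul c h =>
      have hcw : ∀ i j, contr B (B.dualBasis hn b i) (wedge B (b j) c) =
          (if j = i then c else 0) - wedge B (b j) (contr B (B.dualBasis hn b i) c) := by
        intro i j
        have := LinearMap.congr_fun (contr_wedge_basis b hn hB i j) c
        refine this.trans ?_
        split_ifs <;> rfl
      rw [koszul_tmul, deRham_tmul, map_sum, map_smul, map_sum]
      simp only [koszul_tmul, deRham_tmul]
      rw [← Finset.smul_sum, ← smul_add]
      congr 1
      rw [Finset.sum_comm, ← Finset.sum_add_distrib]
      have e1 : euler F ι (Cliff B ⊗[F] H) (f ⊗ₜ (c ⊗ₜ h)) =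
          ∑ k, (X k * pderiv k f) ⊗ₜ (c ⊗ₜ h) := by
        simp [euler, LinearMap.sum_apply, TensorProduct.sum_tmul]
      have e2 : extDeg b hn H (f ⊗ₜ (c ⊗ₜ h)) = ∑ k, f ⊗ₜ
          (wedge B (b k) (contr B (B.dualBasis hn b k) c) ⊗ₜ h) := by
        simp [extDeg, degC, degPart, LinearMap.sum_apply, TensorProduct.sum_tmul,
          TensorProduct.tmul_sum]
      rw [e1, e2, ← Finset.sum_add_distrib]
      refine Finset.sum_congr rfl fun k _ => ?_
      rw [← Finset.sum_add_distrib]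
      rw [Finset.sum_eq_single k]
      · rw [hcw, if_pos rfl, Derivation.leibniz, pderiv_X_self]
        simp only [smul_eq_mul, mul_one, TensorProduct.sub_tmul, TensorProduct.tmul_sub,
          TensorProduct.add_tmul]
        abel
      · intro l _ hl
        rw [hcw, if_neg hl, Derivation.leibniz, pderiv_X_of_ne hl.symm]
        simp only [smul_eq_mul, mul_zero, add_zero, TensorProduct.sub_tmul, TensorProduct.tmul_sub,
          TensorProduct.zero_tmul, TensorProduct.tmul_zero]
        abel
      · simp

theorem euler_sub_mem {Y : Type*} [AddCommGroup Y] [Module F Y] {n : ℕ}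
    {m : MvPolynomial ι F ⊗[F] Y} (hm : m ∈ degLE F ι Y (n + 1)) :
    euler F ι Y m - ((n + 1 : ℕ) : F) • m ∈ degLE F ι Y n := by
  refine map_mem_of_degLE (euler F ι Y - ((n + 1 : ℕ) : F) • LinearMap.id)
    (fun k hk f hf y => ?_) hm
  have e : euler F ι Y (f ⊗ₜ y) = (k : F) • (f ⊗ₜ y) := by
    have : (∑ k, LinearMap.mulLeft F (X k) ∘ₗ (pderiv k).toLinearMap) f = k • f := by
      rw [LinearMap.sum_apply]
      exact hf.sum_X_mul_pderiv
    rw [euler, LinearMap.rTensor_tmul, this, ← Nat.cast_smul_eq_nsmul F, TensorProduct.smul_tmul']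
  have e' : euler F ι Y (f ⊗ₜ y) - ((n + 1 : ℕ) : F) • (f ⊗ₜ[F] y) =
      ((k : F) - ((n + 1 : ℕ) : F)) • (f ⊗ₜ y) := by
    rw [e]
    exact (sub_smul (k : F) ((n + 1 : ℕ) : F) (f ⊗ₜ[F] y)).symm
  change euler F ι Y (f ⊗ₜ y) - ((n + 1 : ℕ) : F) • (f ⊗ₜ[F] y) ∈ _
  rw [e']
  rcases hk.eq_or_lt with rfl | hk
  · simp
  · exact Submodule.smul_mem _ _ (tmul_mem_degLE (by omega) hf y)

theorem deRham_mem {n : ℕ} {m : MvPolynomial ι F ⊗[F] (Cliff B ⊗[F] H)}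
    (hm : m ∈ degLE F ι _ (n + 1)) : deRham B b H m ∈ degLE F ι _ n := by
  refine map_mem_of_degLE _ (fun k hk f hf y => ?_) hm
  simp only [deRham, LinearMap.sum_apply, TensorProduct.map_tmul]
  refine Submodule.sum_mem _ fun l _ => ?_
  -- For `k = 0` the truncated subtraction is harmless, since the derivative is zero.
  exact tmul_mem_degLE (k := k - 1) (by omega) hf.pderiv _

theorem extDeg_mem {n : ℕ} {m : MvPolynomial ι F ⊗[F] (Cliff B ⊗[F] H)}
    (hm : m ∈ degLE F ι _ n) : extDeg b hn H m ∈ degLE F ι _ n :=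
  map_mem_of_degLE (extDeg b hn H) (fun _ hk _ hf _ => tmul_mem_degLE hk hf _) hm

theorem exists_polynomial_aeval_extDeg (hB : B.IsSymm) : ∃ p : Polynomial F,
    Polynomial.aeval (extDeg b hn H) p = 0 ∧ ∀ n : ℕ, 1 ≤ n → p.eval (-(n : F)) ≠ 0 := by
  obtain ⟨p, hp, hp'⟩ := exists_polynomial_aeval_degC b hn hB
  refine ⟨p, ?_, hp'⟩
  let φ : Module.End F (Cliff B) →ₐ[F] Module.End F (MvPolynomial ι F ⊗[F] (Cliff B ⊗[F] H)) :=
    (Module.End.lTensorAlgHom F _ _).comp (Module.End.rTensorAlgHom F _ _)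
  have : extDeg b hn H = φ (degC b hn) := rfl
  rw [this, Polynomial.aeval_algHom_apply, hp, map_zero]

/-- All slices of `y` are killed by the contractions, hence scalar, so a retraction onto the scalars
fixes `y`. -/
theorem exists_eq_one_tmul (hB : B.IsSymm) {y : Cliff B ⊗[F] H}
    (hy : ∀ k, LinearMap.rTensor H (contr B (B.dualBasis hn b k)) y = 0) :
    ∃ h : H, y = 1 ⊗ₜ h := by
  obtain ⟨q, hqW, hq⟩ := exists_retraction (Submodule.span F {(1 : Cliff B)})
  have h1 : q.rTensor H y = y := by
    refine rTensor_eq_self hq fun φ => ?_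
    obtain ⟨r, hr⟩ := exists_eq_algebraMap b hn hB (c := slice φ y) fun k => by
      rw [← slice_rTensor, hy, map_zero]
    rw [hr, Algebra.algebraMap_eq_smul_one]
    exact Submodule.smul_mem _ _ (Submodule.mem_span_singleton_self 1)
  rw [← h1]
  clear h1 hy
  induction y with
  | zero => exact ⟨0, by simp⟩
  | add x y hx hy =>
    obtain ⟨h, e⟩ := hx
    obtain ⟨h', e'⟩ := hy
    exact ⟨h + h', by rw [map_add, e, e', TensorProduct.tmul_add]⟩
  | tmul c h =>
    obtain ⟨r, hr⟩ := Submodule.mem_span_singleton.1 (hqW c)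
    exact ⟨r • h, by rw [LinearMap.rTensor_tmul, ← hr, TensorProduct.smul_tmul]⟩

/-- In degree zero the kernel of the Koszul differential is `1 ⊗ 1 ⊗ H`. -/
theorem exists_eq_of_koszul_mem (hB : B.IsSymm) {m : MvPolynomial ι F ⊗[F] (Cliff B ⊗[F] H)}
    (hm : m ∈ degLE F ι _ 0) (hk : koszul b hn H m ∈ degLE F ι _ 0) :
    ∃ h : H, m = 1 ⊗ₜ (1 ⊗ₜ h) := by
  obtain ⟨y, rfl⟩ : ∃ y, m = 1 ⊗ₜ y := by
    clear hk
    induction hm using Submodule.span_induction with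
    | zero => exact ⟨0, by simp⟩
    | add x y _ _ hx hy =>
      obtain ⟨z, rfl⟩ := hx
      obtain ⟨z', rfl⟩ := hy
      exact ⟨z + z', (TensorProduct.tmul_add _ _ _).symm⟩
    | smul r x _ hx =>
      obtain ⟨z, rfl⟩ := hx
      exact ⟨r • z, (TensorProduct.tmul_smul _ _ _).symm⟩
    | mem x hx =>
      obtain ⟨k, hk, f, hf, y, rfl⟩ := hx
      obtain rfl := Nat.le_zero.1 hk
      have : f = coeff 0 f • 1 := by
        rw [← C_eq_smul_one, ← totalDegree_eq_zero_iff_eq_C]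
        exact (totalDegree_zero_iff_isHomogeneous _).2 hf
      exact ⟨coeff 0 f • y, by rw [← TensorProduct.smul_tmul, ← this]⟩
  obtain ⟨h, rfl⟩ := exists_eq_one_tmul b hn hB (y := y) fun j => by
    -- The coefficient of `X j` in the Koszul image of `1 ⊗ y` is twice the contraction of `y` with
    -- the dual vector. It vanishes on elements of degree zero.
    let c : MvPolynomial ι F ⊗[F] (Cliff B ⊗[F] H) →ₗ[F] Cliff B ⊗[F] H :=
      (TensorProduct.lid F _).toLinearMap ∘ₗ LinearMap.rTensor _ (lcoeff F (Finsupp.single j 1))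
    have hc : ∀ f y, c (f ⊗ₜ y) = coeff (Finsupp.single j 1) f • y := fun f y => rfl
    have h0 : c (koszul b hn H (1 ⊗ₜ y)) ∈ (⊥ : Submodule F (Cliff B ⊗[F] H)) := by
      refine map_mem_of_degLE c (fun k hk f hf y => ?_) hk
      rw [hc, hf.coeff_eq_zero, zero_smul]
      · exact Submodule.zero_mem _
      · rw [Finsupp.degree_single]
        omega
    have h1 : c (koszul b hn H (1 ⊗ₜ y)) =
        (2 : F) • LinearMap.rTensor H (contr B (B.dualBasis hn b j)) y := by
      simp only [koszul, LinearMap.smul_apply, LinearMap.sum_apply, TensorProduct.map_tmul,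
        map_smul, map_sum, hc, LinearMap.mulLeft_apply, mul_one]
      congr 1
      rw [Finset.sum_eq_single j]
      · rw [coeff_X, if_pos rfl, one_smul]
      · intro k _ hk
        rw [coeff_X, if_neg (by simpa [Finsupp.single_left_inj] using hk), zero_smul]
      · simp
    rw [h1, Submodule.mem_bot] at h0
    exact (smul_eq_zero.1 h0).resolve_left two_ne_zero
  exact ⟨h, rfl⟩

end Koszul

end BarbaschSahi

namespace BarbaschSahi

open Coalgebra

/-! ### The adjoint action on group-like and primitive elements. -/

section Adjoint

variable {F : Type*} [Field F] {K : Type*} [Ring K] [HopfAlgebra F K]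
  {R : Type*} [Ring R] [Algebra F R] (f : K →ₐ[F] R)

theorem IsPrimitive.counit_eq_zero {y : K} (hy : IsPrimitive F y) :
    counit (R := F) y = 0 := by
  have h := Coalgebra.rTensor_counit_comul (R := F) y
  rw [hy] at h
  simp only [map_add, LinearMap.rTensor_tmul, Bialgebra.counit_one] at h
  have h1 := congrArg (fun t => counit (R := F) (TensorProduct.lid F K t)) h
  simpa using h1

theorem IsPrimitive.antipode_eq_neg {y : K} (hy : IsPrimitive F y) :
    HopfAlgebra.antipode F y = -y := by
  have h := HopfAlgebra.mul_antipode_rTensor_comul_apply (R := F) y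
  rw [hy, hy.counit_eq_zero] at h
  simp only [map_add, LinearMap.rTensor_tmul, LinearMap.mul'_apply, HopfAlgebra.antipode_one,
    one_mul, mul_one, map_zero] at h
  exact eq_neg_of_add_eq_zero_right h

theorem IsPrimitive.map {K' : Type*} [Ring K'] [HopfAlgebra F K'] (π : K →ₐc[F] K') {y : K}
    (hy : IsPrimitive F y) : IsPrimitive F (π y) := by
  have h := LinearMap.congr_fun (π : K →ₗc[F] K').map_comp_comul y
  simp only [LinearMap.comp_apply] at h
  have h' : comul (R := F) (π y) = _ := h.symm
  rw [IsPrimitive, h', hy]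
  simp

theorem adAction_of_isGroupLikeElem {g : K} (hg : IsGroupLikeElem F g) (x : R) :
    adAction f g x = f g * x * f (HopfAlgebra.antipode F g) := by
  rw [adAction, LinearMap.comp_apply, hg.comul_eq_tmul_self]
  simp [mul_assoc]

theorem adAction_of_isPrimitive {y : K} (hy : IsPrimitive F y) (x : R) :
    adAction f y x = f y * x - x * f y := by
  rw [adAction, LinearMap.comp_apply, hy]
  simp [hy.antipode_eq_neg, sub_eq_neg_add]

theorem adAction_mul (h k : K) (x : R) : adAction f (h * k) x = adAction f h (adAction f k x) := by
  simp only [adAction, LinearMap.comp_apply, Bialgebra.comul_mul]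
  generalize comul (R := F) h = s
  generalize comul (R := F) k = t
  induction s with
  | zero => simp
  | add a b ha hb => simp only [add_mul, map_add, LinearMap.add_apply, ha, hb]
  | tmul a b =>
    induction t with
    | zero => simp
    | add c d hc hd => simp only [mul_add, map_add, LinearMap.add_apply, hc, hd]
    | tmul c d => simp [HopfAlgebra.antipode_mul_antidistrib, mul_assoc]

theorem adAction_of_commute {x : R} (hx : ∀ t, f t * x = x * f t) (t : K) :
    adAction f t x = counit (R := F) t • x := by
  have h : ∀ s : K ⊗[F] K, TensorProduct.lift
      (LinearMap.mk₂ F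
        (fun h k : K => LinearMap.mulLeft F (f h) ∘ₗ
          LinearMap.mulRight F (f (HopfAlgebra.antipode F k)))
        (fun _ _ _ => by ext; simp [add_mul])
        (fun _ _ _ => by ext; simp)
        (fun _ _ _ => by ext; simp [mul_add])
        (fun _ _ _ => by ext; simp)) s x =
      x * f (LinearMap.mul' F K (LinearMap.lTensor K (HopfAlgebra.antipode F) s)) := by
    intro s
    induction s with
    | zero => simp
    | add a b ha hb => simp only [map_add, LinearMap.add_apply, ha, hb, mul_add]
    | tmul a b => simp [← mul_assoc, hx]
  rw [adAction, LinearMap.comp_apply, h, HopfAlgebra.mul_antipode_lTensor_comul_apply,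
    AlgHom.commutes, ← Algebra.commutes, Algebra.smul_def]

/-- A subalgebra of a pointed cocommutative Hopf algebra in characteristic zero which contains the
primitive and the group-like elements is everything. -/
theorem mem_of_generators [CharZero F] [IsCocomm F K] (hK : IsPointed F K) (S : Subalgebra F K)
    (hg : ∀ g, IsGroupLikeElem F g → g ∈ S) (hy : ∀ y, IsPrimitive F y → y ∈ S) (t : K) :
    t ∈ S := by
  have h : hopfSpan F K ≤ Subalgebra.toSubmodule S := by
    refine Submodule.span_le.2 ?_
    rintro _ ⟨u, hu, g, hgg, rfl⟩
    exact S.mul_mem (Algebra.adjoin_le hy hu) (hg g hgg)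
  rw [hopfSpan_eq_top F K hK] at h
  exact h trivial

end Adjoint

/-! ### Determinants of isometries and the canonical tensor of the form. -/

section Orthogonal

variable {F : Type*} [Field F] {V : Type*} [AddCommGroup V] [Module F V]
  {B : LinearMap.BilinForm F V}

/-- Take determinants in `Rᵀ G R = G` with `G` the invertible Gram matrix. -/
theorem det_mul_self_of_isometry {ι : Type*} [Fintype ι] [DecidableEq ι]
    (b : Module.Basis ι F V) (hn : B.Nondegenerate) {R : Module.End F V}
    (hR : ∀ v w, B (R v) (R w) = B v w) : LinearMap.det R * LinearMap.det R = 1 := by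
  have h1 : B.comp R R = B := by ext v w; exact hR v w
  have h2 := LinearMap.BilinForm.toMatrix_comp b b B R R
  rw [h1] at h2
  have h3 := congrArg Matrix.det h2
  rw [Matrix.det_mul, Matrix.det_mul, Matrix.det_transpose, LinearMap.det_toMatrix] at h3
  have h4 := (LinearMap.BilinForm.nondegenerate_iff_det_ne_zero b).1 hn
  refine mul_right_cancel₀ h4 ?_
  rw [one_mul]
  linear_combination -h3

variable {ι : Type*} [Fintype ι] [DecidableEq ι] (b : Module.Basis ι F V)

/-- An operator on one leg of the canonical tensor moves to the other leg as its adjoint: both sides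
have coefficient `B (R b_k) b^l` at `b_l ⊗ b^k`. -/
theorem sum_map_tmul_dualBasis (hn : B.Nondegenerate) (hB : B.IsSymm) {R R' : Module.End F V}
    (hR : ∀ v w, B (R v) w = B v (R' w)) :
    ∑ k, R (b k) ⊗ₜ[F] B.dualBasis hn b k = ∑ k, b k ⊗ₜ[F] R' (B.dualBasis hn b k) := by
  have h1 : ∀ v, v = ∑ l, B v (b l) • B.dualBasis hn b l := fun v => by
    conv_lhs => rw [← (B.dualBasis hn b).sum_repr v]
    simp [LinearMap.BilinForm.dualBasis_repr_apply]
  have h2 : ∀ v, v = ∑ l, B v (B.dualBasis hn b l) • b l := fun v => by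
    conv_lhs => rw [← (B.dualBasis hn (B.dualBasis hn b)).sum_repr v]
    simp only [LinearMap.BilinForm.dualBasis_repr_apply]
    rw [LinearMap.BilinForm.dualBasis_dualBasis hn hB]
  have e1 : ∀ k, R (b k) ⊗ₜ[F] B.dualBasis hn b k =
      ∑ l, B (R (b k)) (B.dualBasis hn b l) • (b l ⊗ₜ[F] B.dualBasis hn b k) := fun k => by
    conv_lhs => rw [h2 (R (b k))]
    rw [TensorProduct.sum_tmul]
    rfl
  have e2 : ∀ l, b l ⊗ₜ[F] R' (B.dualBasis hn b l) =
      ∑ k, B (R (b k)) (B.dualBasis hn b l) • (b l ⊗ₜ[F] B.dualBasis hn b k) := fun l => by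
    conv_lhs => rw [h1 (R' (B.dualBasis hn b l))]
    rw [TensorProduct.tmul_sum]
    refine Finset.sum_congr rfl fun k _ => ?_
    rw [TensorProduct.tmul_smul, hR, hB.eq]
  simp only [e1, e2]
  exact Finset.sum_comm

end Orthogonal

section Generators

variable {F : Type*} [Field F] {V : Type*} [AddCommGroup V] [Module F V]
  {H : Type*} [Ring H] [HopfAlgebra F H] {ρ : H →ₐ[F] Module.End F V}
  {κ : V →ₗ[F] V →ₗ[F] H} {B : LinearMap.BilinForm F V}
  {Ht : Type*} [Ring Ht] [HopfAlgebra F Ht] (P : PinCover ρ B Ht)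
  {ι : Type*} [Fintype ι] [DecidableEq ι]

namespace PinCover

/-- The determinant character on group-like elements. -/
def detChar (t : Ht) : F := LinearMap.det (ρ (P.π t))

theorem mem_parity_of_isGroupLikeElem {g : Ht} (hg : IsGroupLikeElem F g) {i : ZMod 2}
    (h : P.detChar g = (-1) ^ i.val) : g ∈ parity P.action i :=
  Submodule.subset_span ⟨1, one_mem _, g, hg, h, (one_mul g).symm⟩

theorem mem_parity_of_isPrimitive {y : Ht} (hy : IsPrimitive F y) : y ∈ parity P.action 0 :=
  Submodule.subset_span ⟨y, Algebra.subset_adjoin hy, 1, .one, by simp, (mul_one y).symm⟩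

variable {P}

theorem detChar_mul_self (b : Module.Basis ι F V) (hB : IsOrthogonal ρ B) {g : Ht} (hg : IsGroupLikeElem F g) :
    P.detChar g * P.detChar g = 1 :=
  det_mul_self_of_isometry b hB.nondegenerate fun v w => by
    rw [hB.invariant, ← Module.End.mul_apply, ← map_mul, (hg.map P.π).antipode_mul_cancel, map_one,
      Module.End.one_apply]

end PinCover

end Generators

end BarbaschSahi

namespace BarbaschSahi

open Coalgebra HeckeAlg

namespace PinCover

variable {F : Type*} [Field F] {V : Type*} [AddCommGroup V] [Module F V]
  {H : Type*} [Ring H] [HopfAlgebra F H] {ρ : H →ₐ[F] Module.End F V}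
  {κ : V →ₗ[F] V →ₗ[F] H} {B : LinearMap.BilinForm F V}
  {Ht : Type*} [Ring Ht] [HopfAlgebra F Ht] {P : PinCover ρ B Ht}

local notation "iv" => CliffordAlgebra.ι (LinearMap.BilinMap.toQuadraticMap B)

/-! ### `γ` and `Δ_C` on group-like and primitive elements. -/

section GroupLike

variable {g : Ht}

theorem exists_parity (hδ : P.detChar g * P.detChar g = 1) :
    ∃ i : ZMod 2, P.detChar g = (-1) ^ i.val := by
  rcases mul_self_eq_one_iff.1 hδ with h | h
  · exact ⟨0, by simpa using h⟩
  · exact ⟨1, by rw [h, ZMod.val_one, pow_one]⟩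

theorem antipode_γ_mul_γ (hg : IsGroupLikeElem F g) :
    P.γ (HopfAlgebra.antipode F g) * P.γ g = 1 := by
  rw [← map_mul, hg.antipode_mul_cancel, map_one]

theorem γ_mul_iv_mul (hg : IsGroupLikeElem F g) (hδ : P.detChar g * P.detChar g = 1) (v : V) :
    P.detChar g • iv (ρ (P.π g) v) = P.γ g * iv v * P.γ (HopfAlgebra.antipode F g) := by
  obtain ⟨i, hi⟩ := exists_parity hδ
  rw [hi, P.γ_conj i g (P.mem_parity_of_isGroupLikeElem hg hi) v, adAction_of_isGroupLikeElem _ hg]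

theorem γ_mul_iv (hg : IsGroupLikeElem F g) (hδ : P.detChar g * P.detChar g = 1) (v : V) :
    P.γ g * iv v = P.detChar g • (iv (ρ (P.π g) v) * P.γ g) := by
  rw [← smul_mul_assoc, γ_mul_iv_mul hg hδ, mul_assoc, antipode_γ_mul_γ hg, mul_one]

theorem involute_γ_of_isGroupLikeElem (hg : IsGroupLikeElem F g)
    (hδ : P.detChar g * P.detChar g = 1) :
    CliffordAlgebra.involute (P.γ g) = P.detChar g • P.γ g := by
  rcases mul_self_eq_one_iff.1 hδ with h | h
  · have := P.γ_parity 0 g (P.mem_parity_of_isGroupLikeElem hg (by simpa using h))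
    rw [h, one_smul, CliffordAlgebra.involute_eq_of_mem_even this]
  · have := P.γ_parity 1 g (P.mem_parity_of_isGroupLikeElem hg (by rw [h, ZMod.val_one, pow_one]))
    rw [h, neg_one_smul, CliffordAlgebra.involute_eq_of_mem_odd this]

theorem diagAC_of_isGroupLikeElem (hg : IsGroupLikeElem F g) :
    P.diagAC κ g = ofH ρ κ (P.π g) ⊗ₜ P.γ g := by
  change Algebra.TensorProduct.map (HeckeAlg.ofH ρ κ) (AlgHom.id F (Cliff B))
    (Algebra.TensorProduct.map (P.π : Ht →ₐ[F] H) P.γ (comul (R := F) g)) = _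
  rw [hg.comul_eq_tmul_self]
  simp

theorem sign_diagAC_of_isGroupLikeElem (hg : IsGroupLikeElem F g)
    (hδ : P.detChar g * P.detChar g = 1) :
    sign ρ κ B (P.diagAC κ g) = P.detChar g • P.diagAC κ g := by
  rw [diagAC_of_isGroupLikeElem hg, sign, Algebra.TensorProduct.map_tmul,
    involute_γ_of_isGroupLikeElem hg hδ, TensorProduct.tmul_smul, AlgHom.id_apply]

end GroupLike

section Primitive

variable {y : Ht}

theorem γ_mul_iv_sub (hy : IsPrimitive F y) (v : V) :
    P.γ y * iv v - iv v * P.γ y = iv (ρ (P.π y) v) := by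
  have := P.γ_conj 0 y (P.mem_parity_of_isPrimitive hy) v
  rw [adAction_of_isPrimitive _ hy] at this
  simpa using this.symm

theorem involute_γ_of_isPrimitive (hy : IsPrimitive F y) :
    CliffordAlgebra.involute (P.γ y) = P.γ y :=
  CliffordAlgebra.involute_eq_of_mem_even (P.γ_parity 0 y (P.mem_parity_of_isPrimitive hy))

theorem diagAC_of_isPrimitive (hy : IsPrimitive F y) :
    P.diagAC κ y = ofH ρ κ (P.π y) ⊗ₜ 1 + 1 ⊗ₜ P.γ y := by
  change Algebra.TensorProduct.map (HeckeAlg.ofH ρ κ) (AlgHom.id F (Cliff B))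
    (Algebra.TensorProduct.map (P.π : Ht →ₐ[F] H) P.γ (comul (R := F) y)) = _
  rw [hy]
  simp [add_comm]

theorem sign_diagAC_of_isPrimitive (hy : IsPrimitive F y) :
    sign ρ κ B (P.diagAC κ y) = P.diagAC κ y := by
  rw [diagAC_of_isPrimitive hy, sign, map_add, Algebra.TensorProduct.map_tmul,
    Algebra.TensorProduct.map_tmul, map_one, map_one, involute_γ_of_isPrimitive hy,
    AlgHom.id_apply]

end Primitive

/-! ### Commutation of the diagonal image with the Dirac element. -/

section Sign

theorem sign_sign (x : AC ρ κ B) : sign ρ κ B (sign ρ κ B x) = x := by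
  have : (sign ρ κ B).comp (sign ρ κ B) = AlgHom.id F _ := by
    ext
    · simp [sign]
    · simp [sign]
  exact AlgHom.congr_fun this x

theorem dMap_apply (D x : AC ρ κ B) : dMap ρ κ B D x = D * x - sign ρ κ B x * D := rfl

variable {ι : Type*} [Fintype ι] [DecidableEq ι] (b : Module.Basis ι F V)

theorem sign_dirac (hn : B.Nondegenerate) : sign ρ κ B (dirac ρ κ B hn b) = -dirac ρ κ B hn b := by
  simp [dirac, sign, TensorProduct.tmul_neg]

/-- `D` is odd, so the cross terms `D ε(x) D` cancel, with `ε` the sign automorphism. -/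
theorem dMap_dMap (hn : B.Nondegenerate) (x : AC ρ κ B) :
    dMap ρ κ B (dirac ρ κ B hn b) (dMap ρ κ B (dirac ρ κ B hn b) x) =
      dirac ρ κ B hn b ^ 2 * x - x * dirac ρ κ B hn b ^ 2 := by
  simp only [dMap_apply, map_sub, map_mul, sign_dirac, sign_sign]
  simp only [mul_neg, neg_mul, pow_two, mul_assoc]
  abel

variable [CharZero F] [IsCocomm F H]

/-- The tensor `∑ v_k ⊗ v^k` is fixed by `g ⊗ g`; moving `γ(g)` past a vector produces the
determinant. -/
theorem diagAC_mul_dirac_of_isGroupLikeElem (hB : IsOrthogonal ρ B) {g : Ht}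
    (hg : IsGroupLikeElem F g) :
    P.diagAC κ g * dirac ρ κ B hB.nondegenerate b =
      P.detChar g • (dirac ρ κ B hB.nondegenerate b * P.diagAC κ g) := by
  have hδ := detChar_mul_self (P := P) b hB hg
  have hπ := hg.map P.π
  have h1 : ∑ k, ρ (P.π g) (b k) ⊗ₜ[F] ρ (P.π g) (B.dualBasis hB.nondegenerate b k) =
      ∑ k, b k ⊗ₜ[F] B.dualBasis hB.nondegenerate b k := by
    have := congrArg (LinearMap.lTensor V (ρ (P.π g)))
      (sum_map_tmul_dualBasis b hB.nondegenerate hB.symm (hB.invariant (P.π g)))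
    simp only [map_sum, LinearMap.lTensor_tmul] at this
    rw [this]
    refine Finset.sum_congr rfl fun k _ => ?_
    rw [← Module.End.mul_apply, ← map_mul, hπ.mul_antipode_cancel, map_one, Module.End.one_apply]
  have h2 := congrArg (TensorProduct.map (ofV ρ κ) iv) h1
  simp only [map_sum, TensorProduct.map_tmul] at h2
  have h3 : dirac ρ κ B hB.nondegenerate b = _ := h2.symm
  conv_rhs => rw [h3]
  rw [dirac, diagAC_of_isGroupLikeElem hg, Finset.mul_sum, Finset.sum_mul, Finset.smul_sum]
  refine Finset.sum_congr rfl fun k _ => ?_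
  rw [Algebra.TensorProduct.tmul_mul_tmul, Algebra.TensorProduct.tmul_mul_tmul,
    ofH_mul_ofV_of_isGroupLikeElem ρ κ hπ, γ_mul_iv hg hδ, TensorProduct.tmul_smul]

/-- The commutator with `D` is the image of the canonical tensor under `y ⊗ 1 + 1 ⊗ y`, which
vanishes because `y` acts skew-symmetrically. -/
theorem diagAC_mul_dirac_of_isPrimitive (hB : IsOrthogonal ρ B) {y : Ht} (hy : IsPrimitive F y) :
    P.diagAC κ y * dirac ρ κ B hB.nondegenerate b =
      dirac ρ κ B hB.nondegenerate b * P.diagAC κ y := by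
  have hπ := hy.map P.π
  have h1 := sum_map_tmul_dualBasis b hB.nondegenerate hB.symm (hB.invariant (P.π y))
  rw [hπ.antipode_eq_neg, map_neg] at h1
  have h2 := congrArg (TensorProduct.map (ofV ρ κ) iv) h1
  simp only [map_sum, TensorProduct.map_tmul, LinearMap.neg_apply, map_neg, TensorProduct.tmul_neg]
    at h2
  rw [Finset.sum_neg_distrib, eq_neg_iff_add_eq_zero] at h2
  rw [← sub_eq_zero]
  refine Eq.trans ?_ h2
  rw [dirac, diagAC_of_isPrimitive hy, Finset.mul_sum, Finset.sum_mul, ← Finset.sum_sub_distrib,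
    ← Finset.sum_add_distrib]
  refine Finset.sum_congr rfl fun k _ => ?_
  simp only [add_mul, mul_add, Algebra.TensorProduct.tmul_mul_tmul, one_mul, mul_one,
    ofH_mul_ofV_of_isPrimitive ρ κ hπ, ← γ_mul_iv_sub hy, TensorProduct.add_tmul,
    TensorProduct.tmul_sub]
  abel

/-- The `t` with this property form a subalgebra. On a group-like the determinant from the sign
cancels the one from commuting with `D`. -/
theorem sign_diagAC_mul_dirac (hB : IsOrthogonal ρ B) (t : Ht) :
    sign ρ κ B (P.diagAC κ t) * dirac ρ κ B hB.nondegenerate b =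
      dirac ρ κ B hB.nondegenerate b * P.diagAC κ t := by
  have := P.cocomm
  let S : Subalgebra F Ht :=
    { carrier := {t | sign ρ κ B (P.diagAC κ t) * dirac ρ κ B hB.nondegenerate b =
        dirac ρ κ B hB.nondegenerate b * P.diagAC κ t}
      mul_mem' := fun {a c} ha hc => by
        simp only [Set.mem_ofPred_eq, map_mul] at *
        rw [mul_assoc, hc, ← mul_assoc, ha, mul_assoc]
      add_mem' := fun {a c} ha hc => by
        simp only [Set.mem_ofPred_eq, map_add] at *
        rw [add_mul, ha, hc, mul_add]
      algebraMap_mem' := fun r => by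
        simp only [Set.mem_ofPred_eq, AlgHom.commutes]
        exact Algebra.commutes _ _ }
  refine mem_of_generators P.pointed S (fun g hg => ?_) (fun y hy => ?_) t
  · have hδ := detChar_mul_self (P := P) b hB hg
    change sign ρ κ B (P.diagAC κ g) * dirac ρ κ B hB.nondegenerate b =
      dirac ρ κ B hB.nondegenerate b * P.diagAC κ g
    rw [sign_diagAC_of_isGroupLikeElem hg hδ, smul_mul_assoc,
      diagAC_mul_dirac_of_isGroupLikeElem b hB hg, smul_smul, hδ, one_smul]
  · change sign ρ κ B (P.diagAC κ y) * dirac ρ κ B hB.nondegenerate b =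
      dirac ρ κ B hB.nondegenerate b * P.diagAC κ y
    rw [sign_diagAC_of_isPrimitive hy, diagAC_mul_dirac_of_isPrimitive b hB hy]

theorem dMap_mul_diagAC (hB : IsOrthogonal ρ B) (x : AC ρ κ B) (t : Ht) :
    dMap ρ κ B (dirac ρ κ B hB.nondegenerate b) (x * P.diagAC κ t) =
      dMap ρ κ B (dirac ρ κ B hB.nondegenerate b) x * P.diagAC κ t := by
  rw [dMap_apply, dMap_apply, map_mul, mul_assoc (sign ρ κ B x), sign_diagAC_mul_dirac b hB,
    sub_mul, mul_assoc, mul_assoc]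

theorem dMap_diagAC (hB : IsOrthogonal ρ B) (t : Ht) :
    dMap ρ κ B (dirac ρ κ B hB.nondegenerate b) (P.diagAC κ t) = 0 := by
  rw [← one_mul (P.diagAC κ t), dMap_mul_diagAC b hB, dMap_apply, map_one, mul_one, one_mul,
    sub_self, zero_mul]

end Sign

/-! ### The trivial and determinant components, and `d` between them. -/

section Isotypic

variable (P κ)

/-- The subspace of `A ⊗ C` of elements commuting with `Δ_C` of primitive elements, and commuting
with `Δ_C g` up to the `n`-th power of the determinant character for `g` group-like. -/
def twisted (n : ℕ) : Submodule F (AC ρ κ B) where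
  carrier := {x | (∀ g : Ht, IsGroupLikeElem F g →
      P.diagAC κ g * x = P.detChar g ^ n • (x * P.diagAC κ g)) ∧
    ∀ y : Ht, IsPrimitive F y → P.diagAC κ y * x = x * P.diagAC κ y}
  zero_mem' := by simp
  add_mem' {x x'} hx hx' := ⟨fun g hg => by rw [mul_add, hx.1 g hg, hx'.1 g hg, add_mul, smul_add],
    fun y hy => by rw [mul_add, hx.2 y hy, hx'.2 y hy, add_mul]⟩
  smul_mem' r x hx := ⟨fun g hg => by
      rw [mul_smul_comm, hx.1 g hg, smul_mul_assoc, smul_comm],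
    fun y hy => by rw [mul_smul_comm, hx.2 y hy, smul_mul_assoc]⟩

variable {P κ}

/-- The even part is spanned by products `u g` with `u` in `primAlg` and `det g = 1`, so the twist
by the determinant is invisible on it. -/
theorem commute_of_mem_twisted {n : ℕ} {x : AC ρ κ B} (hx : x ∈ P.twisted κ n) {t : Ht}
    (ht : t ∈ parity P.action 0) : P.diagAC κ t * x = x * P.diagAC κ t := by
  let S : Subalgebra F Ht := (Subalgebra.centralizer F {x}).comap (P.diagAC κ)
  have hS : ∀ t, t ∈ S ↔ x * P.diagAC κ t = P.diagAC κ t * x := fun t => by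
    simp [S, Subalgebra.mem_centralizer_iff]
  have : parity P.action 0 ≤ Subalgebra.toSubmodule S := by
    refine Submodule.span_le.2 ?_
    rintro _ ⟨u, hu, g, hg, hdet, rfl⟩
    refine S.mul_mem (Algebra.adjoin_le (fun y hy => (hS y).2 (hx.2 y hy).symm) hu) ((hS g).2 ?_)
    have : P.detChar g = 1 := by simpa [detChar] using hdet
    rw [hx.1 g hg, this, one_pow, one_smul]
  exact ((hS t).1 (this ht)).symm

variable [CharZero F]

theorem commute_of_mem_twisted_zero {x : AC ρ κ B} (hx : x ∈ P.twisted κ 0) (t : Ht) :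
    P.diagAC κ t * x = x * P.diagAC κ t := by
  have := P.cocomm
  let S : Subalgebra F Ht := (Subalgebra.centralizer F {x}).comap (P.diagAC κ)
  have hS : ∀ t, t ∈ S ↔ x * P.diagAC κ t = P.diagAC κ t * x := fun t => by
    simp [S, Subalgebra.mem_centralizer_iff]
  refine ((hS t).1 (mem_of_generators P.pointed S (fun g hg => (hS g).2 ?_)
    (fun y hy => (hS y).2 (hx.2 y hy).symm) t)).symm
  rw [hx.1 g hg, pow_zero, one_smul]

theorem triv_eq_twisted : P.triv κ = P.twisted κ 0 := by
  ext x
  simp only [triv, Submodule.mem_iInf, LinearMap.mem_ker, LinearMap.sub_apply,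
    LinearMap.smul_apply, LinearMap.id_apply, sub_eq_zero]
  constructor
  · intro h
    refine ⟨fun g hg => ?_, fun y hy => ?_⟩
    · have := h g
      rw [adAction_of_isGroupLikeElem _ hg, hg.counit_eq_one, one_smul] at this
      conv_rhs => rw [← this]
      rw [pow_zero, one_smul, mul_assoc, ← map_mul, hg.antipode_mul_cancel, map_one, mul_one]
    · have := h y
      rw [adAction_of_isPrimitive _ hy, hy.counit_eq_zero, zero_smul] at this
      exact sub_eq_zero.1 this
  · intro h t
    exact adAction_of_commute _ (commute_of_mem_twisted_zero h) t

/-- The adjoint action is multiplicative: on a product `u g` the factor `g` acts by its determinant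
and `u` by the counit. The hypothesis on `detChar` makes every group-like homogeneous. -/
theorem det_eq_twisted (hδ : ∀ g : Ht, IsGroupLikeElem F g → P.detChar g * P.detChar g = 1) :
    P.det κ = P.twisted κ 1 := by
  ext x
  simp only [det, Submodule.mem_iInf, LinearMap.mem_ker, LinearMap.sub_apply,
    LinearMap.smul_apply, LinearMap.id_apply, sub_eq_zero]
  constructor
  · intro h
    refine ⟨fun g hg => ?_, fun y hy => ?_⟩
    · obtain ⟨i, hi⟩ := exists_parity (hδ g hg)
      have := h i g (P.mem_parity_of_isGroupLikeElem hg hi)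
      rw [adAction_of_isGroupLikeElem _ hg, hg.counit_eq_one, mul_one, ← hi] at this
      rw [pow_one, ← smul_mul_assoc, ← this, mul_assoc, ← map_mul, hg.antipode_mul_cancel, map_one,
        mul_one]
    · have := h 0 y (P.mem_parity_of_isPrimitive hy)
      rw [adAction_of_isPrimitive _ hy, hy.counit_eq_zero, mul_zero, zero_smul] at this
      exact sub_eq_zero.1 this
  · intro h i t ht
    induction ht using Submodule.span_induction with
    | zero => simp
    | add a c _ _ ha hc => rw [map_add, LinearMap.add_apply, ha, hc, map_add, mul_add, add_smul]
    | smul r a _ ha =>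
      rw [map_smul, LinearMap.smul_apply, ha, map_smul, smul_eq_mul, smul_smul, mul_left_comm]
    | mem t ht =>
      obtain ⟨u, hu, g, hg, hdet, rfl⟩ := ht
      have h1 : adAction (P.diagAC κ) g x = (-1 : F) ^ i.val • x := by
        rw [adAction_of_isGroupLikeElem _ hg, h.1 g hg, pow_one, smul_mul_assoc, mul_assoc,
          ← map_mul, hg.mul_antipode_cancel, map_one, mul_one, ← hdet]
        rfl
      have h2 : adAction (P.diagAC κ) u x = counit (R := F) u • x := by
        induction hu using Algebra.adjoin_induction with
        | mem y hy =>
          have hy : IsPrimitive F y := hy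
          rw [adAction_of_isPrimitive _ hy, h.2 y hy, hy.counit_eq_zero, sub_self, zero_smul]
        | algebraMap r =>
          rw [Algebra.algebraMap_eq_smul_one, map_smul, LinearMap.smul_apply,
            adAction_of_isGroupLikeElem _ .one, map_smul]
          simp
        | add a c _ _ ha hc => rw [map_add, LinearMap.add_apply, ha, hc, map_add, add_smul]
        | mul a c _ _ ha hc =>
          rw [adAction_mul, hc, map_smul, ha, Bialgebra.counit_mul, smul_smul, mul_comm]
      rw [adAction_mul, h1, map_smul, h2, smul_smul, Bialgebra.counit_mul, hg.counit_eq_one,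
        mul_one]

variable {ι : Type*} [Fintype ι] [DecidableEq ι] (b : Module.Basis ι F V) [IsCocomm F H]

/-- Commuting `Δ_C(g)` past `D` costs one determinant. Both sides of the relation for `x` change by
the same factor under the sign automorphism, so it also holds for the sign-twisted `x` in `d`. -/
theorem dMap_mem_twisted (hB : IsOrthogonal ρ B) {n : ℕ} {x : AC ρ κ B}
    (hx : x ∈ P.twisted κ n) :
    dMap ρ κ B (dirac ρ κ B hB.nondegenerate b) x ∈ P.twisted κ (n + 1) := by
  refine ⟨fun g hg => ?_, fun y hy => ?_⟩
  · have hδ := detChar_mul_self (P := P) b hB hg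
    have hs : P.diagAC κ g * sign ρ κ B x = P.detChar g ^ n • (sign ρ κ B x * P.diagAC κ g) := by
      have h := congrArg (sign ρ κ B) (hx.1 g hg)
      rw [map_mul, map_smul, map_mul, sign_diagAC_of_isGroupLikeElem hg hδ, smul_mul_assoc,
        mul_smul_comm, smul_comm] at h
      have h' := congrArg (P.detChar g • ·) h
      simpa only [smul_smul, ← mul_assoc, hδ, one_mul, one_smul] using h'
    rw [dMap_apply, mul_sub, ← mul_assoc, diagAC_mul_dirac_of_isGroupLikeElem b hB hg,
      smul_mul_assoc, mul_assoc, hx.1 g hg, ← mul_assoc, hs, smul_mul_assoc, mul_assoc,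
      diagAC_mul_dirac_of_isGroupLikeElem b hB hg, sub_mul, mul_smul_comm, mul_smul_comm, smul_smul,
      smul_smul, ← pow_succ, ← pow_succ', smul_sub, mul_assoc, mul_assoc]
  · have hs : P.diagAC κ y * sign ρ κ B x = sign ρ κ B x * P.diagAC κ y := by
      have h := congrArg (sign ρ κ B) (hx.2 y hy)
      rwa [map_mul, map_mul, sign_diagAC_of_isPrimitive hy] at h
    rw [dMap_apply, mul_sub, ← mul_assoc, diagAC_mul_dirac_of_isPrimitive b hB hy, mul_assoc,
      hx.2 y hy, ← mul_assoc (P.diagAC κ y), hs, mul_assoc,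
      diagAC_mul_dirac_of_isPrimitive b hB hy, sub_mul]
    simp only [mul_assoc]

/-- The determinant character squares to one, so `twisted` depends only on the parity of its index.
-/
theorem twisted_add_two (b : Module.Basis ι F V) (hB : IsOrthogonal ρ B) :
    P.twisted κ (0 + 1 + 1) = P.twisted κ 0 := by
  ext x
  have : ∀ g : Ht, IsGroupLikeElem F g → P.detChar g ^ (0 + 1 + 1) = P.detChar g ^ 0 :=
    fun g hg => by rw [pow_zero, ← detChar_mul_self (P := P) b hB hg]; ring
  exact and_congr_left' (forall₂_congr fun g hg => by rw [this g hg])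

theorem dMap_dMap_of_mem_twisted (hB : IsOrthogonal ρ B)
    (hD : P.Parthasarathy κ (dirac ρ κ B hB.nondegenerate b)) {n : ℕ} {x : AC ρ κ B}
    (hx : x ∈ P.twisted κ n) : dMap ρ κ B (dirac ρ κ B hB.nondegenerate b)
      (dMap ρ κ B (dirac ρ κ B hB.nondegenerate b) x) = 0 := by
  obtain ⟨z, hz, h, hh, e⟩ := hD
  rw [dMap_dMap, e, add_mul, mul_add, commute_of_mem_twisted hx hh,
    ← Subalgebra.mem_center_iff.1 hz x, sub_self]

end Isotypic

end PinCover

end BarbaschSahi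

namespace BarbaschSahi

open Coalgebra HeckeAlg MvPolynomial

namespace PinCover

variable {F : Type*} [Field F] [CharZero F] {V : Type*} [AddCommGroup V] [Module F V]
  {H : Type*} [Ring H] [HopfAlgebra F H] [IsCocomm F H] {ρ : H →ₐ[F] Module.End F V}
  {κ : V →ₗ[F] V →ₗ[F] H} {B : LinearMap.BilinForm F V}
  {Ht : Type*} [Ring Ht] [HopfAlgebra F Ht] {P : PinCover ρ B Ht}

local notation "iv" => CliffordAlgebra.ι (LinearMap.BilinMap.toQuadraticMap B)

/-! ### The leading term of `d`. -/

section Filtration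

variable {ι : Type*} [Fintype ι] [DecidableEq ι] (b : Module.Basis ι F V)

theorem dirac_mem_levC (hn : B.Nondegenerate) : dirac ρ κ B hn b ∈ levC ρ κ B 1 :=
  Submodule.sum_mem _ fun k _ => tmul_mem_levC (ofV_mem ρ κ (b k)) _

theorem sign_mem_levC {n : ℕ} {x : AC ρ κ B} (hx : x ∈ levC ρ κ B n) :
    sign ρ κ B x ∈ levC ρ κ B n := by
  induction hx using Submodule.span_induction with
  | zero => simp
  | add x x' _ _ h h' => rw [map_add]; exact Submodule.add_mem _ h h'
  | smul r x _ h => rw [map_smul]; exact Submodule.smul_mem _ r h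
  | mem x hx =>
    obtain ⟨a, ha, c, rfl⟩ := hx
    exact tmul_mem_levC ha _

theorem dMap_mem_levC (hn : B.Nondegenerate) {n : ℕ} {x : AC ρ κ B} (hx : x ∈ levC ρ κ B n) :
    dMap ρ κ B (dirac ρ κ B hn b) x ∈ levC ρ κ B (n + 1) := by
  rw [dMap_apply]
  refine Submodule.sub_mem _ ?_ (mul_mem_levC (sign_mem_levC hx) (dirac_mem_levC b hn))
  rw [add_comm]
  exact mul_mem_levC (dirac_mem_levC b hn) hx

/-- Left and right multiplication by a basis vector have the same symbol, so to top order the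
Clifford factors combine to `v c - α(c) v`, which is twice the contraction. -/
theorem dMap_sym_tmul_sub_mem (hn : B.Nondegenerate) {n : ℕ} {f : MvPolynomial ι F}
    (hf : f.IsHomogeneous n) (c : Cliff B) :
    dMap ρ κ B (dirac ρ κ B hn b) (sym (gen ρ κ b) f ⊗ₜ c) - (2 : F) • ∑ k,
      sym (gen ρ κ b) (X k * f) ⊗ₜ[F] contr B (B.dualBasis hn b k) c ∈ levC ρ κ B n := by
  rw [dMap_apply, dirac, sign, Algebra.TensorProduct.map_tmul, Finset.sum_mul, Finset.mul_sum,
    Finset.smul_sum, ← Finset.sum_sub_distrib, ← Finset.sum_sub_distrib]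
  refine Submodule.sum_mem _ fun k _ => ?_
  have e : (2 : F) • (sym (gen ρ κ b) (X k * f) ⊗ₜ[F] contr B (B.dualBasis hn b k) c) =
      sym (gen ρ κ b) (X k * f) ⊗ₜ[F] (iv (B.dualBasis hn b k) * c) -
      sym (gen ρ κ b) (X k * f) ⊗ₜ[F]
        (CliffordAlgebra.involute c * iv (B.dualBasis hn b k)) := by
    rw [contr_apply, TensorProduct.tmul_smul, smul_smul, mul_inv_cancel₀ two_ne_zero, one_smul,
      TensorProduct.tmul_sub]
  rw [e]
  have h := (levC ρ κ B n).sub_mem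
    (tmul_mem_levC (gen_mul_sym_sub_mem (ρ := ρ) (κ := κ) b hf k) (iv (B.dualBasis hn b k) * c))
    (tmul_mem_levC (sym_mul_gen_sub_mem (ρ := ρ) (κ := κ) b hf k)
      (CliffordAlgebra.involute c * iv (B.dualBasis hn b k)))
  rw [TensorProduct.sub_tmul, TensorProduct.sub_tmul] at h
  rw [Algebra.TensorProduct.tmul_mul_tmul, Algebra.TensorProduct.tmul_mul_tmul, AlgHom.id_apply]
  convert h using 1
  simp only [gen]
  abel

end Filtration

/-! ### The equivariant homotopy on `A ⊗ C` and the descent. -/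

section Homotopy

variable {ι : Type*} [Fintype ι] [DecidableEq ι] (b : Module.Basis ι F V) (hPBW : PBW ρ κ)
  {σ : H →ₗc[F] Ht}

theorem ext_of_tri (hPBW : PBW ρ κ) (hσ : ∀ h, P.π (σ h) = h) {N : Type*} [AddCommGroup N]
    [Module F N] {T T' : AC ρ κ B →ₗ[F] N}
    (h : ∀ (f : MvPolynomial ι F) (c : Cliff B) (h : H),
      T ((sym (gen ρ κ b) f ⊗ₜ c) * P.diagAC κ (σ h)) =
      T' ((sym (gen ρ κ b) f ⊗ₜ c) * P.diagAC κ (σ h))) (x : AC ρ κ B) : T x = T' x := by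
  obtain ⟨m, rfl⟩ := (triEquiv P b hPBW σ).surjective x
  induction m with
  | zero => simp
  | add x y hx hy => simp only [map_add, hx, hy]
  | tmul f y =>
    induction y with
    | zero => simp
    | add x y hx hy => simp only [map_add, TensorProduct.tmul_add, hx, hy]
    | tmul c k => rw [triEquiv_tmul P b hPBW hσ, h]

variable (P σ) in
/-- The homotopy on `A ⊗ C`. -/
def homotopy : Module.End F (AC ρ κ B) := (triEquiv P b hPBW σ).conj (deRham B b H)

theorem homotopy_apply (hσ : ∀ h, P.π (σ h) = h)
    (hT : ∀ t, ∃ h, P.diagAC κ t = P.diagAC κ (σ h)) (f : MvPolynomial ι F) (c : Cliff B)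
    (t : Ht) :
    homotopy P b hPBW σ ((sym (gen ρ κ b) f ⊗ₜ c) * P.diagAC κ t) =
      ∑ k, (sym (gen ρ κ b) (pderiv k f) ⊗ₜ wedge B (b k) c) * P.diagAC κ t := by
  obtain ⟨h, e⟩ := hT t
  rw [e, ← triEquiv_tmul P b hPBW hσ, homotopy, LinearEquiv.conj_apply_apply,
    LinearEquiv.symm_apply_apply, deRham_tmul, map_sum]
  simp only [triEquiv_tmul P b hPBW hσ]

/-- The homotopy does not touch the factor `H`. As `σ` is only a coalgebra map, `hT` is what brings
`Δ_C(σ h) Δ_C(t)` back to the form `Δ_C(σ h')`. -/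
theorem homotopy_mul_diagAC (hσ : ∀ h, P.π (σ h) = h)
    (hT : ∀ t, ∃ h, P.diagAC κ t = P.diagAC κ (σ h)) (x : AC ρ κ B) (t : Ht) :
    homotopy P b hPBW σ (x * P.diagAC κ t) = homotopy P b hPBW σ x * P.diagAC κ t := by
  refine ext_of_tri b hPBW hσ
    (T := homotopy P b hPBW σ ∘ₗ LinearMap.mulRight F (P.diagAC κ t))
    (T' := LinearMap.mulRight F (P.diagAC κ t) ∘ₗ homotopy P b hPBW σ) (fun f c h => ?_) x
  simp only [LinearMap.comp_apply, LinearMap.mulRight_apply]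
  rw [mul_assoc, ← map_mul, homotopy_apply b hPBW hσ hT, homotopy_apply b hPBW hσ hT,
    Finset.sum_mul]
  simp only [map_mul, mul_assoc]

theorem diagAC_mul_sym_tmul_of_isGroupLikeElem {g : Ht} (hg : IsGroupLikeElem F g)
    (f : MvPolynomial ι F) (c : Cliff B) :
    P.diagAC κ g * (sym (gen ρ κ b) f ⊗ₜ c) =
      (sym (gen ρ κ b) (substLin (entries b (ρ (P.π g))) f) ⊗ₜ
        (P.γ g * c * P.γ (HopfAlgebra.antipode F g))) * P.diagAC κ g := by
  rw [diagAC_of_isGroupLikeElem hg, Algebra.TensorProduct.tmul_mul_tmul,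
    Algebra.TensorProduct.tmul_mul_tmul, ofH_mul_sym_of_isGroupLikeElem ρ κ b (hg.map P.π),
    mul_assoc (P.γ g * c), antipode_γ_mul_γ hg, mul_one]

/-- The operator `∑ ∂_k ⊗ wedge(v_k)` does not depend on the basis, so moving it by `g` changes it
only by the determinant in `mul_wedge_of_conj`. -/
theorem diagAC_mul_homotopy_of_isGroupLikeElem (hσ : ∀ h, P.π (σ h) = h)
    (hT : ∀ t, ∃ h, P.diagAC κ t = P.diagAC κ (σ h)) {g : Ht} (hg : IsGroupLikeElem F g)
    (hδ : P.detChar g * P.detChar g = 1) (x : AC ρ κ B) :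
    P.diagAC κ g * homotopy P b hPBW σ x =
      P.detChar g • homotopy P b hPBW σ (P.diagAC κ g * x) := by
  refine ext_of_tri b hPBW hσ
    (T := LinearMap.mulLeft F (P.diagAC κ g) ∘ₗ homotopy P b hPBW σ)
    (T' := P.detChar g • (homotopy P b hPBW σ ∘ₗ LinearMap.mulLeft F (P.diagAC κ g)))
    (fun f c h => ?_) x
  simp only [LinearMap.comp_apply, LinearMap.mulLeft_apply, LinearMap.smul_apply]
  rw [homotopy_apply b hPBW hσ hT, ← mul_assoc, diagAC_mul_sym_tmul_of_isGroupLikeElem b hg,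
    mul_assoc, ← map_mul, homotopy_apply b hPBW hσ hT, map_mul, Finset.mul_sum]
  have e1 : ∀ k, P.diagAC κ g * ((sym (gen ρ κ b) (pderiv k f) ⊗ₜ wedge B (b k) c) *
      P.diagAC κ (σ h)) = P.detChar g • ((sym (gen ρ κ b)
        (substLin (entries b (ρ (P.π g))) (pderiv k f)) ⊗ₜ wedge B (ρ (P.π g) (b k))
          (P.γ g * c * P.γ (HopfAlgebra.antipode F g))) *
        (P.diagAC κ g * P.diagAC κ (σ h))) := by
    intro k
    rw [← mul_assoc, ← mul_assoc, ← smul_mul_assoc]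
    congr 1
    rw [diagAC_of_isGroupLikeElem hg, Algebra.TensorProduct.tmul_mul_tmul,
      Algebra.TensorProduct.tmul_mul_tmul, ofH_mul_sym_of_isGroupLikeElem ρ κ b (hg.map P.π),
      mul_wedge_of_conj (antipode_γ_mul_γ hg) hδ (involute_γ_of_isGroupLikeElem hg hδ)
        (R := ρ (P.π g)) (γ_mul_iv_mul hg hδ), TensorProduct.tmul_smul]
  simp only [e1]
  rw [← Finset.smul_sum, ← Finset.sum_mul, ← Finset.sum_mul]
  congr 2
  simp only [← sum_entries_smul b (ρ (P.π g)), pderiv_substLin, map_sum, map_smul,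
    LinearMap.sum_apply, LinearMap.smul_apply, C_mul', TensorProduct.tmul_sum,
    TensorProduct.sum_tmul, TensorProduct.tmul_smul, TensorProduct.smul_tmul']
  exact Finset.sum_comm

theorem diagAC_mul_sym_tmul_of_isPrimitive {y : Ht} (hy : IsPrimitive F y)
    (f : MvPolynomial ι F) (c : Cliff B) :
    P.diagAC κ y * (sym (gen ρ κ b) f ⊗ₜ c) =
      sym (gen ρ κ b) (derivLin (entries b (ρ (P.π y))) f) ⊗ₜ c +
      sym (gen ρ κ b) f ⊗ₜ (P.γ y * c - c * P.γ y) +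
      (sym (gen ρ κ b) f ⊗ₜ c) * P.diagAC κ y := by
  rw [diagAC_of_isPrimitive hy, add_mul, mul_add]
  simp only [Algebra.TensorProduct.tmul_mul_tmul, one_mul, mul_one,
    ofH_mul_sym_of_isPrimitive ρ κ b (hy.map P.π), TensorProduct.add_tmul, TensorProduct.tmul_sub]
  abel

/-- The terms from commuting `y` past `∂_k` and past `wedge(v_k)` cancel, again by basis
independence. -/
theorem diagAC_mul_homotopy_of_isPrimitive (hσ : ∀ h, P.π (σ h) = h)
    (hT : ∀ t, ∃ h, P.diagAC κ t = P.diagAC κ (σ h)) {y : Ht} (hy : IsPrimitive F y)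
    (x : AC ρ κ B) :
    P.diagAC κ y * homotopy P b hPBW σ x = homotopy P b hPBW σ (P.diagAC κ y * x) := by
  refine ext_of_tri b hPBW hσ
    (T := LinearMap.mulLeft F (P.diagAC κ y) ∘ₗ homotopy P b hPBW σ)
    (T' := homotopy P b hPBW σ ∘ₗ LinearMap.mulLeft F (P.diagAC κ y))
    (fun f c h => ?_) x
  simp only [LinearMap.comp_apply, LinearMap.mulLeft_apply]
  rw [homotopy_apply b hPBW hσ hT, ← mul_assoc, diagAC_mul_sym_tmul_of_isPrimitive b hy,
    add_mul, add_mul, mul_assoc _ (P.diagAC κ y), ← map_mul, map_add, map_add,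
    homotopy_apply b hPBW hσ hT, homotopy_apply b hPBW hσ hT, homotopy_apply b hPBW hσ hT, map_mul,
    Finset.mul_sum]
  simp only [← mul_assoc, diagAC_mul_sym_tmul_of_isPrimitive b hy, ← Finset.sum_mul, ← add_mul,
    ← Finset.sum_add_distrib]
  congr 1
  have e1 : ∀ k, P.γ y * wedge B (b k) c - wedge B (b k) c * P.γ y =
      wedge B (ρ (P.π y) (b k)) c + wedge B (b k) (P.γ y * c - c * P.γ y) := fun k =>
    mul_wedge_of_comm (involute_γ_of_isPrimitive hy) (R := ρ (P.π y)) (γ_mul_iv_sub hy) _ _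
  simp only [e1, pderiv_derivLin, map_add, TensorProduct.add_tmul, TensorProduct.tmul_add,
    Finset.sum_add_distrib]
  have e2 : ∑ k, sym (gen ρ κ b) (pderiv k f) ⊗ₜ[F] wedge B (ρ (P.π y) (b k)) c =
      ∑ k, sym (gen ρ κ b) (∑ l, C (entries b (ρ (P.π y)) k l) * pderiv l f) ⊗ₜ[F]
        wedge B (b k) c := by
    simp only [← sum_entries_smul b (ρ (P.π y)), map_sum, map_smul,
      LinearMap.sum_apply, LinearMap.smul_apply, C_mul', TensorProduct.tmul_sum,
      TensorProduct.sum_tmul, TensorProduct.tmul_smul, TensorProduct.smul_tmul']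
    exact Finset.sum_comm
  rw [e2, ← Finset.sum_mul]
  abel

theorem homotopy_mem_twisted (hσ : ∀ h, P.π (σ h) = h)
    (hT : ∀ t, ∃ h, P.diagAC κ t = P.diagAC κ (σ h))
    (hδ : ∀ g : Ht, IsGroupLikeElem F g → P.detChar g * P.detChar g = 1) {n : ℕ} {x : AC ρ κ B}
    (hx : x ∈ P.twisted κ n) : homotopy P b hPBW σ x ∈ P.twisted κ (n + 1) := by
  refine ⟨fun g hg => ?_, fun y hy => ?_⟩
  · rw [diagAC_mul_homotopy_of_isGroupLikeElem b hPBW hσ hT hg (hδ g hg), hx.1 g hg, map_smul,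
      smul_smul, ← pow_succ', homotopy_mul_diagAC b hPBW hσ hT]
  · rw [diagAC_mul_homotopy_of_isPrimitive b hPBW hσ hT hy, hx.2 y hy,
      homotopy_mul_diagAC b hPBW hσ hT]

theorem dMap_sub_koszul_mem (hB : IsOrthogonal ρ B) (hσ : ∀ h, P.π (σ h) = h) {n : ℕ}
    {x : AC ρ κ B} (hx : x ∈ levC ρ κ B n) :
    dMap ρ κ B (dirac ρ κ B hB.nondegenerate b) x -
      (triEquiv P b hPBW σ).conj (koszul b hB.nondegenerate H) x ∈ levC ρ κ B n := by
  obtain ⟨m, rfl⟩ := (triEquiv P b hPBW σ).surjective x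
  rw [triEquiv_mem_levC_iff P b hPBW hσ] at hx
  rw [LinearEquiv.conj_apply_apply, LinearEquiv.symm_apply_apply]
  refine map_mem_of_degLE (dMap ρ κ B (dirac ρ κ B hB.nondegenerate b) ∘ₗ
    (triEquiv P b hPBW σ).toLinearMap -
      (triEquiv P b hPBW σ).toLinearMap ∘ₗ (koszul b hB.nondegenerate H :
        MvPolynomial ι F ⊗[F] (Cliff B ⊗[F] H) →ₗ[F] MvPolynomial ι F ⊗[F] (Cliff B ⊗[F] H)))
    (fun k hk f hf y => ?_) hx
  simp only [LinearMap.sub_apply, LinearMap.comp_apply, LinearEquiv.coe_coe]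
  induction y with
  | zero => simp
  | add y y' h h' =>
    simp only [TensorProduct.tmul_add, map_add, add_sub_add_comm]
    exact Submodule.add_mem _ h h'
  | tmul c h =>
    rw [triEquiv_tmul P b hPBW hσ, dMap_mul_diagAC b hB, koszul_tmul, map_smul, map_sum]
    simp only [triEquiv_tmul P b hPBW hσ]
    rw [← Finset.sum_mul, ← smul_mul_assoc, ← sub_mul]
    have := mul_mem_levC (dMap_sym_tmul_sub_mem (ρ := ρ) (κ := κ) b hB.nondegenerate hf c)
      (diagAC_mem_levC P (κ := κ) (σ h))
    rw [add_zero] at this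
    exact levC_mono hk this

/-- In filtration degree zero, the elements with differential in degree zero are in the image of
the diagonal map. -/
theorem exists_eq_diagAC (hB : IsOrthogonal ρ B) (hσ : ∀ h, P.π (σ h) = h) {x : AC ρ κ B}
    (hx : x ∈ levC ρ κ B 0)
    (hdx : dMap ρ κ B (dirac ρ κ B hB.nondegenerate b) x ∈ levC ρ κ B 0) (hPBW : PBW ρ κ) :
    ∃ h, x = P.diagAC κ (σ h) := by
  have h1 := (levC ρ κ B 0).sub_mem hdx (dMap_sub_koszul_mem (P := P) b hPBW hB hσ hx)
  rw [sub_sub_cancel] at h1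
  obtain ⟨m, rfl⟩ := (triEquiv P b hPBW σ).surjective x
  rw [LinearEquiv.conj_apply_apply, LinearEquiv.symm_apply_apply,
    triEquiv_mem_levC_iff P b hPBW hσ] at h1
  rw [triEquiv_mem_levC_iff P b hPBW hσ] at hx
  obtain ⟨h, rfl⟩ := exists_eq_of_koszul_mem b hB.nondegenerate hB.symm hx h1
  exact ⟨h, by rw [triEquiv_tmul P b hPBW hσ, sym_one, ← Algebra.TensorProduct.one_def, one_mul]⟩

/-- One statement serves both components, `n` and `n'` being of opposite parity. Asking only that `d
x` lie in filtration degree zero, not that it vanish, is what yields the directness of the sum. -/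
theorem exists_eq_dMap_add_diagAC (hB : IsOrthogonal ρ B) (hPBW : PBW ρ κ)
    (hσ : ∀ h, P.π (σ h) = h) (hT : ∀ t, ∃ h, P.diagAC κ t = P.diagAC κ (σ h))
    (hD : P.Parthasarathy κ (dirac ρ κ B hB.nondegenerate b)) {n n' : ℕ}
    (hn : P.twisted κ (n + 1) = P.twisted κ n') (hn' : P.twisted κ (n' + 1) = P.twisted κ n)
    {x : AC ρ κ B} (hx : x ∈ P.twisted κ n)
    (hdx : dMap ρ κ B (dirac ρ κ B hB.nondegenerate b) x ∈ levC ρ κ B 0) :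
    ∃ w ∈ P.twisted κ n', ∃ t, P.diagAC κ t ∈ P.twisted κ n ∧
      x = dMap ρ κ B (dirac ρ κ B hB.nondegenerate b) w + P.diagAC κ t := by
  have hδ : ∀ g : Ht, IsGroupLikeElem F g → P.detChar g * P.detChar g = 1 := fun g hg =>
    detChar_mul_self b hB hg
  obtain ⟨p, hp, hp0⟩ := exists_polynomial_aeval_extDeg b hB.nondegenerate (H := H) hB.symm
  obtain ⟨N, hN⟩ := exists_mem_levC x
  have hmem : ∀ {n x}, x ∈ levC ρ κ B n ↔ (triEquiv P b hPBW σ).symm x ∈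
      degLE F ι (Cliff B ⊗[F] H) n := fun {n x} => by
    rw [← triEquiv_mem_levC_iff P b hPBW hσ, LinearEquiv.apply_symm_apply]
  obtain ⟨w, hw, x₀, ⟨hx₀, hx₀'⟩, e⟩ := exists_eq_add_of_descent
    (d := dMap ρ κ B (dirac ρ κ B hB.nondegenerate b)) (h := homotopy P b hPBW σ)
    (δ := (triEquiv P b hPBW σ).conj (koszul b hB.nondegenerate H))
    (N := (triEquiv P b hPBW σ).conj (euler F ι _))
    (E := (triEquiv P b hPBW σ).conj (extDeg b hB.nondegenerate H)) (L := levC ρ κ B)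
    (X := P.twisted κ n) (X' := P.twisted κ n') levC_mono
    (fun x hx => hn ▸ homotopy_mem_twisted b hPBW hσ hT hδ hx)
    (fun x hx => hn' ▸ dMap_mem_twisted b hB hx)
    (fun x hx => dMap_dMap_of_mem_twisted b hB hD hx)
    (fun x => by
      simp only [homotopy, LinearEquiv.conj_apply_apply, LinearEquiv.symm_apply_apply, ← map_add,
        koszul_deRham_add b hB.nondegenerate hB.symm, map_smul])
    (fun n x hx => dMap_sub_koszul_mem b hPBW hB hσ hx)
    (fun n x hx => by
      rw [homotopy, LinearEquiv.conj_apply_apply, triEquiv_mem_levC_iff P b hPBW hσ]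
      exact deRham_mem b (hmem.1 hx))
    (fun n x hx => dMap_mem_levC b hB.nondegenerate hx)
    (fun n x hx => by
      have := euler_sub_mem (hmem.1 hx)
      rw [← triEquiv_mem_levC_iff P b hPBW hσ, map_sub, map_smul,
        LinearEquiv.apply_symm_apply] at this
      exact this)
    (fun n x hx => by
      rw [LinearEquiv.conj_apply_apply, triEquiv_mem_levC_iff P b hPBW hσ]
      exact extDeg_mem b hB.nondegenerate (hmem.1 hx))
    (p := p)
    (by
      have : (triEquiv P b hPBW σ).conj (extDeg b hB.nondegenerate H) =
        (triEquiv P b hPBW σ).conjAlgEquiv F (extDeg b hB.nondegenerate H) := rfl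
      rw [this, Polynomial.aeval_algHom_apply, hp, map_zero])
    hp0 N hx hN hdx
  -- Since `d² w = 0`, the remainder has the same differential as `x`, so it lies in the degree-zero
  -- kernel of the Koszul differential.
  have hd : dMap ρ κ B (dirac ρ κ B hB.nondegenerate b) x₀ ∈ levC ρ κ B 0 := by
    rw [e, map_add, dMap_dMap_of_mem_twisted b hB hD hw, zero_add] at hdx
    exact hdx
  obtain ⟨h, rfl⟩ := exists_eq_diagAC b hB hσ hx₀' hd hPBW
  exact ⟨w, hw, σ h, hx₀, e⟩

end Homotopy

end PinCover

end BarbaschSahi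

namespace BarbaschSahi

open Coalgebra HeckeAlg MvPolynomial

/-! ### Central elements and the image of the diagonal map. -/

namespace PinCover

variable {F : Type*} [Field F] [CharZero F] {V : Type*} [AddCommGroup V] [Module F V]
  {H : Type*} [Ring H] [HopfAlgebra F H] {ρ : H →ₐ[F] Module.End F V}
  {κ : V →ₗ[F] V →ₗ[F] H} {B : LinearMap.BilinForm F V}
  {Ht : Type*} [Ring Ht] [HopfAlgebra F Ht] {P : PinCover ρ B Ht}
  {ι : Type*} [Fintype ι] [DecidableEq ι]

theorem algebraMap_cliff_injective : Function.Injective (algebraMap F (Cliff B)) := by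
  have : Invertible (2 : F) := invertibleOfNonzero two_ne_zero
  exact (algebraMap F (Cliff B)).injective

/-- `γ(z)` is even and commutes with all vectors, so every contraction kills it and it is a scalar.
-/
theorem exists_γ_eq (b : Module.Basis ι F V) (hB : IsOrthogonal ρ B) {z : Ht}
    (hz : IsGroupLikeElem F z) (hπ : P.π z = 1) (hzz : z * z = 1) : ∃ s : F, s * s = 1 ∧ P.γ z = algebraMap F _ s := by
  have hd : P.detChar z = 1 := by simp [detChar, hπ]
  have hδ : P.detChar z * P.detChar z = 1 := by rw [hd, one_mul]
  have hα := involute_γ_of_isGroupLikeElem hz hδ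
  rw [hd, one_smul] at hα
  obtain ⟨s, hs⟩ := exists_eq_algebraMap b hB.nondegenerate hB.symm (c := P.γ z) fun k => by
    rw [contr_apply, hα, γ_mul_iv hz hδ, hd, hπ, map_one, one_smul, Module.End.one_apply, sub_self,
      smul_zero]
  refine ⟨s, algebraMap_cliff_injective (B := B) ?_, hs⟩
  rw [map_mul, ← hs, ← map_mul, hzz, map_one, map_one]

variable [IsCocomm F H]

theorem diagAC_section_injective (b : Module.Basis ι F V) (hPBW : PBW ρ κ) {σ : H →ₗc[F] Ht}
    (hσ : ∀ h, P.π (σ h) = h) : Function.Injective fun h => P.diagAC κ (σ h) := by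
  intro h h' e
  have key : ∀ h, P.diagAC κ (σ h) = triEquiv P b hPBW σ (1 ⊗ₜ (1 ⊗ₜ h)) := fun h => by
    rw [triEquiv_tmul P b hPBW hσ, sym_one, ← Algebra.TensorProduct.one_def, one_mul]
  simp only [key] at e
  have e1 := (triEquiv P b hPBW σ).injective e
  have e2 := Algebra.TensorProduct.includeRight_injective (R := F) (A := MvPolynomial ι F)
    (B := Cliff B ⊗[F] H) (MvPolynomial.C_injective ι F) e1
  exact Algebra.TensorProduct.includeRight_injective (R := F) (A := Cliff B) (B := H)
    algebraMap_cliff_injective e2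

/-- The structural facts on the diagonal map of a pin cover: it has the same image as its
restriction along a coalgebra section, and any element whose image commutes with the image of the
diagonal map has the same image as a central element. -/
theorem exists_section (b : Module.Basis ι F V) (hB : IsOrthogonal ρ B) (hPBW : PBW ρ κ) :
    ∃ σ : H →ₗc[F] Ht, (∀ h, P.π (σ h) = h) ∧ (∀ t, ∃ h, P.diagAC κ t = P.diagAC κ (σ h)) ∧
      ∀ k, P.diagAC κ k ∈ P.twisted κ 0 → ∃ k' ∈ Subalgebra.center F Ht,
        P.diagAC κ k' = P.diagAC κ k := by
  have := P.cocomm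
  obtain ⟨e, h₁, h₂⟩ := P.double_cover
  obtain ⟨σ, z, hσ, -, hz, hπz, hzz, hzc, hdec⟩ := exists_splitting P.pointed P.π e h₁ h₂
  obtain ⟨s, hss, hs⟩ := exists_γ_eq b hB hz hπz hzz
  have hΔz : P.diagAC κ z = algebraMap F _ s := by
    rw [diagAC_of_isGroupLikeElem hz, hπz, map_one, hs, Algebra.algebraMap_eq_smul_one,
      Algebra.algebraMap_eq_smul_one, TensorProduct.tmul_smul, Algebra.TensorProduct.one_def]
  have hT : ∀ x y, P.diagAC κ (σ x + z * σ y) = P.diagAC κ (σ (x + s • y)) := fun x y => by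
    rw [map_add, map_mul, hΔz, map_add, map_add, map_smul, map_smul, Algebra.smul_def]
  refine ⟨σ, hσ, fun t => ?_, fun k hk => ?_⟩
  · obtain ⟨x, y, rfl⟩ := hdec t
    exact ⟨_, hT x y⟩
  -- The central element attached to the eigenvalue `s` of `z`, on which `Δ_C` takes the value `1`.
  obtain ⟨p, hp⟩ : ∃ p : Ht, p = (2 : F)⁻¹ • (1 + s • z) := ⟨_, rfl⟩
  have hpc : ∀ t, p * t = t * p := fun t => by
    rw [hp, smul_mul_assoc, mul_smul_comm, add_mul, mul_add, smul_mul_assoc, mul_smul_comm, hzc,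
      one_mul, mul_one]
  have hpz : p * z = s • p := by
    have h : s • (1 + s • z) = z + s • 1 := by
      rw [smul_add, smul_smul, hss, one_smul, add_comm]
    rw [hp, smul_mul_assoc, add_mul, smul_mul_assoc, hzz, one_mul, smul_comm s, h]
  have hΔp : P.diagAC κ p = 1 := by
    rw [hp, map_smul, map_add, map_smul, hΔz, map_one, Algebra.smul_def s, ← map_mul, hss, map_one,
      ← two_smul F (1 : AC ρ κ B), smul_smul, inv_mul_cancel₀ two_ne_zero, one_smul]
  -- On `σ x + z σ y` multiplication by `p` gives `p σ(x + s y)`, and `Δ_C ∘ σ` is injective.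
  have hker : ∀ t, P.diagAC κ t = 0 → p * t = 0 := fun t ht => by
    obtain ⟨x, y, rfl⟩ := hdec t
    have h0 : x + s • y = 0 := diagAC_section_injective (P := P) (κ := κ) b hPBW hσ (by
      change P.diagAC κ (σ (x + s • y)) = P.diagAC κ (σ 0)
      rw [← hT, ht, map_zero, map_zero])
    rw [mul_add, ← mul_assoc, hpz, smul_mul_assoc, ← mul_smul_comm s p, ← mul_add, ← map_smul,
      ← map_add, h0, map_zero, mul_zero]
  -- Commutators of `k` lie in the kernel of `Δ_C`, so `p` kills them and `p k` is central.
  refine ⟨p * k, Subalgebra.mem_center_iff.2 fun t => ?_, by rw [map_mul, hΔp, one_mul]⟩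
  have h1 := hker (t * k - k * t) (by
    rw [map_sub, map_mul, map_mul, commute_of_mem_twisted_zero hk t, sub_self])
  rw [mul_sub, sub_eq_zero] at h1
  rw [← mul_assoc, ← hpc, mul_assoc, h1, mul_assoc]

theorem diagAC_mem_twisted_of_mem_center {k : Ht} (hk : k ∈ Subalgebra.center F Ht) :
    P.diagAC κ k ∈ P.twisted κ 0 :=
  ⟨fun g _ => by
    rw [pow_zero, one_smul, ← map_mul, Subalgebra.mem_center_iff.1 hk g, map_mul],
    fun y _ => by rw [← map_mul, Subalgebra.mem_center_iff.1 hk y, map_mul]⟩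

end PinCover

end BarbaschSahi

end

theorem proposition3p14
    {F : Type*} [Field F] [CharZero F]
    {H : Type*} [Ring H] [HopfAlgebra F H] [Coalgebra.IsCocomm F H]
    (hH : BarbaschSahi.IsPointed F H)
    {V : Type*} [AddCommGroup V] [Module F V] [FiniteDimensional F V]
    (ρ : H →ₐ[F] Module.End F V) (B : LinearMap.BilinForm F V)
    (hB : BarbaschSahi.IsOrthogonal ρ B)
    (κ : V →ₗ[F] V →ₗ[F] H) (hκ : κ.IsAlt)
    (hPBW : BarbaschSahi.HeckeAlg.PBW ρ κ)
    {Ht : Type*} [Ring Ht] [HopfAlgebra F Ht] (P : BarbaschSahi.PinCover ρ B Ht)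
    {ι : Type*} [Fintype ι] [DecidableEq ι] (b : Module.Basis ι F V)
    (hD : P.Parthasarathy κ (BarbaschSahi.dirac ρ κ B hB.nondegenerate b)) :
    Disjoint
        ((P.det κ).map (BarbaschSahi.dMap ρ κ B
          (BarbaschSahi.dirac ρ κ B hB.nondegenerate b)))
        ((Subalgebra.center F Ht).toSubmodule.map (P.diagAC κ).toLinearMap) ∧
      P.triv κ ⊓ LinearMap.ker (BarbaschSahi.dMap ρ κ B
          (BarbaschSahi.dirac ρ κ B hB.nondegenerate b)) =
        (P.det κ).map (BarbaschSahi.dMap ρ κ B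
            (BarbaschSahi.dirac ρ κ B hB.nondegenerate b)) ⊔
          (Subalgebra.center F Ht).toSubmodule.map (P.diagAC κ).toLinearMap := by
  open BarbaschSahi BarbaschSahi.PinCover in
  obtain ⟨σ, hσ, hT, hcenter⟩ := exists_section (P := P) (κ := κ) b hB hPBW
  have h2 := twisted_add_two (P := P) (κ := κ) b hB
  rw [triv_eq_twisted, det_eq_twisted fun g hg => detChar_mul_self b hB hg]
  constructor
  · rw [Submodule.disjoint_def]
    rintro _ ⟨x, hx, rfl⟩ ⟨k, hk, e⟩
    have e : P.diagAC κ k = dMap ρ κ B (dirac ρ κ B hB.nondegenerate b) x := e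
    -- Here `d x = Δ_C(k)` has filtration degree zero. So `x` is `d w` plus a diagonal element, and
    -- `d` kills both.
    obtain ⟨w, hw, t, -, rfl⟩ := exists_eq_dMap_add_diagAC b hB hPBW hσ hT hD (n := 1) (n' := 0) h2
      rfl hx (by rw [← e]; exact diagAC_mem_levC P k)
    rw [map_add, dMap_dMap_of_mem_twisted b hB hD hw, dMap_diagAC b hB, add_zero]
  · refine le_antisymm ?_ (sup_le ?_ ?_)
    · rintro x ⟨hx, hdx⟩
      obtain ⟨w, hw, t, ht, rfl⟩ := exists_eq_dMap_add_diagAC b hB hPBW hσ hT hD (n := 0) (n' := 1)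
        rfl h2 hx (by rw [LinearMap.mem_ker.1 hdx]; exact Submodule.zero_mem _)
      obtain ⟨k, hk, e⟩ := hcenter t ht
      exact Submodule.add_mem_sup ⟨w, hw, rfl⟩ ⟨k, hk, e⟩
    · rintro _ ⟨w, hw, rfl⟩
      exact ⟨h2 ▸ dMap_mem_twisted b hB hw, dMap_dMap_of_mem_twisted b hB hD hw⟩
    · rintro _ ⟨k, hk, rfl⟩
      exact ⟨diagAC_mem_twisted_of_mem_center hk, dMap_diagAC b hB k⟩
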